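/- **Corollary 3.2.** Let $k$ be a field of characteristic $3$, and let $V$ be a two-dimensional vector space over $k$ with a nonzero alternating bilinear form $\langle\cdot|\cdot\rangle$. Then there are isomorphisms of Lie superalgebras $$\mathfrak g(S_2,S_{1,2})\;\cong\;\mathfrak{pstr}\,H_3(B(1,2)),\qquad \mathfrak g(S_2,S_{4,2})\;\cong\;\mathfrak{pstr}\,H_3(B(4,2)),$$ that is, all four are Lie superalgebras, and in both cases there is an even linear bijection preserving the brackets. The objects are the following; in signs $(-1)^{\cdots}$ a homogeneous element stands for its parity. *Lie superalgebras.* A Lie superalgebra is a superspace with an even superanticommutative bracket that satisfies the super Jacobi identity and $[x,[x,x]]=0$ for all odd $x$. $\mathfrak{gl}(U)$ is $\mathrm{End}_k(U)$ with $[f,g]=fg-(-1)^{fg}gf$. *Composition superalgebras.* A composition superalgebra is a superalgebra $C$ with a nondegenerate even supersymmetric bilinear form $b$ (the polar form of the norm $q$, $q(x)=\frac12 b(x,x)$ for even $x$) such that $$b(xy,zt)+(-1)^{xy+xz+yz}b(zy,xt)=(-1)^{yz}b(x,z)b(y,t)$$ for homogeneous $x,y,z,t$. It is symmetric if $b(xy,z)=b(x,yz)$,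 and a Hurwitz superalgebra if it has a unit; then $\bar x=b(x,1)1-x$ is its standard involution, and $C$ with the product $x\bullet y=\bar x\,\bar y$ and the same form is a symmetric composition superalgebra, the para-Hurwitz superalgebra of $C$. The Hurwitz superalgebras used here are * $k\times k$ (even), with $q(\alpha,\beta)=\alpha\beta$; * $B(1,2)=k1\oplus V$ with even part $k1$ and odd part $V$, with $1$ the unit, $uv=\langle u|v\rangle 1$, $q(1)=1$ and $b(u,v)=\langle u|v\rangle$ for $u,v\in V$; * $B(4,2)=\mathrm{End}_k(V)\oplus V$ with even part $\mathrm{End}_k(V)$ and odd part $V$, with composition of maps as product in $\mathrm{End}_k(V)$, $v\cdot f=f(v)=\bar f\cdot v$, $u\cdot v=\langle\cdot|u\rangle v$, $q(f)=\det f$ and $b(u,v)=\langle u|v\rangle$, where $f\mapsto\bar f$ is the symplectic involution: $\langle f(u)|v\rangle=\langle u|\bar f(v)\rangle$. $S_2$, $S_{1,2}$ and $S_{4,2}$ are the para-Hurwitz superalgebras of $k\times k$, $B(1,2)$ and $B(4,2)$. *The superalgebra $\mathfrak g(S,S')$.* For a symmetric composition superalgebra $S$ with product $\bullet$, $\mathfrak{osp}(S)\subseteq\mathfrak{gl}(S)$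 is spanned by the homogeneous $f$ with $b(f(x),y)+(-1)^{fx}b(x,f(y))=0$, and $\mathfrak{tri}(S)$ is spanned by the homogeneous triples $(d_0,d_1,d_2)\in\mathfrak{osp}(S)^3$ of a common parity $i$ with $d_0(x\bullet y)=d_1(x)\bullet y+(-1)^{ix}x\bullet d_2(y)$, with the componentwise bracket. Put $\theta(d_0,d_1,d_2)=(d_2,d_0,d_1)$, $l_x(y)=x\bullet y$, $r_x(y)=(-1)^{xy}y\bullet x$, $\sigma_{x,y}(z)=(-1)^{yz}b(x,z)y-(-1)^{x(y+z)}b(y,z)x$ and $$t_{x,y}=\bigl(\sigma_{x,y},\tfrac12 b(x,y)1-r_xl_y,\tfrac12 b(x,y)1-l_xr_y\bigr)\in\mathfrak{tri}(S).$$ For symmetric composition superalgebras $S,S'$ (primes denote the objects of $S'$), $$\mathfrak g(S,S')=\bigl(\mathfrak{tri}(S)\oplus\mathfrak{tri}(S')\bigr)\oplus\bigoplus_{i=0}^{2}\iota_i(S\otimes S'),$$ where $\iota_i(S\otimes S')$ is a copy of $S\otimes S'$, with the superanticommutative bracket that extends the one of the direct sum of Lie superalgebras $\mathfrak{tri}(S)\oplus\mathfrak{tri}(S')$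 and satisfies, with indices modulo $3$, \begin{align*} [(d_0,d_1,d_2),\iota_i(x\otimes x')]&=\iota_i(d_i(x)\otimes x'),\\ [(d_0',d_1',d_2'),\iota_i(x\otimes x')]&=(-1)^{d_i'x}\iota_i(x\otimes d_i'(x')),\\ [\iota_i(x\otimes x'),\iota_{i+1}(y\otimes y')]&=(-1)^{x'y}\iota_{i+2}\bigl((x\bullet y)\otimes(x'\bullet y')\bigr),\\ [\iota_i(x\otimes x'),\iota_i(y\otimes y')]&=(-1)^{xx'+xy'+yy'}b'(x',y')\,\theta^i(t_{x,y})+(-1)^{yx'}b(x,y)\,\theta'^i(t'_{x',y'}). \end{align*} *The projective structure superalgebra.* For a Hurwitz superalgebra $C$, $J=H_3(C)$ is the Jordan superalgebra of $3\times3$ matrices $X=(a_{ij})$ over $C$ with $\bar a_{ji}=a_{ij}$, with the product $X\circ Y=\frac12\bigl(XY+(-1)^{XY}YX\bigr)$. The structure superalgebra $\mathfrak{str}\,J$ is the subalgebra of $\mathfrak{gl}(J)$ generated by the Lie superalgebra $\mathfrak{der}\,J$ of superderivations and the left multiplications $L_x$, $x\in J$, and $\mathfrak{pstr}\,J$ is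 the quotient of $\mathfrak{str}\,J$ by its center. -/

import Mathlib

namespace Supermagic

noncomputable section

open TensorProduct

/-! Superspaces: `ZMod 2`-graded vector spaces over a field, given by the two projections onto
the homogeneous components. -/

/-- The sign `(-1)^i` for `i : ZMod 2`. -/
def sgn (k : Type*) [Field k] (i : ZMod 2) : k := if i = 0 then 1 else -1

/-- A superspace: a vector space with a decomposition `V = V₀ ⊕ V₁`; `proj i` is the projection
onto `Vᵢ`. -/
class Superspace (k : Type*) (V : Type*) [Field k] [AddCommGroup V] [Module k V] where
  proj : ZMod 2 → V →ₗ[k] V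
  proj_proj : ∀ i j v, proj i (proj j v) = if i = j then proj j v else 0
  proj_add : ∀ v, proj 0 v + proj 1 v = v

section Basic

variable {k : Type*} [Field k]
variable {V : Type*} [AddCommGroup V] [Module k V] [Superspace k V]
variable {W : Type*} [AddCommGroup W] [Module k W] [Superspace k W]
variable {P : Type*} [AddCommGroup P] [Module k P]

variable (k) in
/-- The projection onto the component of parity `i`. -/
def proj (i : ZMod 2) : V →ₗ[k] V := Superspace.proj i

variable (k V) in
/-- The component `Vᵢ` of homogeneous elements of parity `i`. -/
def part (i : ZMod 2) : Submodule k V := LinearMap.eqLocus (proj k i) LinearMap.id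

theorem mem_part {i : ZMod 2} {v : V} : v ∈ part k V i ↔ proj k i v = v := Iff.rfl

theorem proj_proj (i j : ZMod 2) (v : V) :
    proj k i (proj k j v) = if i = j then proj k j v else 0 := Superspace.proj_proj i j v

theorem proj_add (v : V) : proj k 0 v + proj k 1 v = v := Superspace.proj_add v

theorem proj_mem (i : ZMod 2) (v : V) : proj k i v ∈ part k V i := by
  rw [mem_part, proj_proj, if_pos rfl]

theorem proj_of_mem {i j : ZMod 2} {v : V} (h : v ∈ part k V j) :
    proj k i v = if i = j then v else 0 := by
  rw [mem_part] at h
  rw [← h, proj_proj]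

theorem zmod2 (i : ZMod 2) : i = 0 ∨ i = 1 := by
  revert i; decide

theorem sgn_zero : sgn k 0 = 1 := by simp [sgn]

theorem sgn_one : sgn k 1 = -1 := by simp [sgn]

/-- For a bilinear map `β`, the bilinear map `(n, m) ↦ (-1)^{nm} β(m, n)`
(for homogeneous `n`, `m`). -/
def superSwap (β : V →ₗ[k] W →ₗ[k] P) : W →ₗ[k] V →ₗ[k] P :=
  ∑ i : ZMod 2, ∑ j : ZMod 2, sgn k (i * j) • (β.compl₁₂ (proj k j) (proj k i)).flip

theorem superSwap_apply (β : V →ₗ[k] W →ₗ[k] P) {i j : ZMod 2} {w : W} {v : V}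
    (hw : w ∈ part k W i) (hv : v ∈ part k V j) :
    superSwap β w v = sgn k (i * j) • β v w := by
  have h : ∀ f : ZMod 2 → P, ∑ i, f i = f 0 + f 1 := fun f => Fin.sum_univ_two f
  simp only [superSwap, h, LinearMap.smul_apply, LinearMap.flip_apply,
    LinearMap.compl₁₂_apply, LinearMap.sum_apply, proj_of_mem hw, proj_of_mem hv]
  rcases zmod2 i with rfl | rfl <;> rcases zmod2 j with rfl | rfl <;> simp

theorem superSwap_add (β γ : V →ₗ[k] W →ₗ[k] P) :
    superSwap (β + γ) = superSwap β + superSwap γ := by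
  ext
  simp only [superSwap, LinearMap.sum_apply, LinearMap.smul_apply, LinearMap.flip_apply,
    LinearMap.compl₁₂_apply, LinearMap.add_apply, smul_add, Finset.sum_add_distrib]

theorem superSwap_smul (c : k) (β : V →ₗ[k] W →ₗ[k] P) :
    superSwap (c • β) = c • superSwap β := by
  ext
  simp only [superSwap, LinearMap.sum_apply, LinearMap.smul_apply, LinearMap.flip_apply,
    LinearMap.compl₁₂_apply, Finset.smul_sum, smul_comm c]

/-- A bilinear map of superspaces is even if parities add up. -/
def IsEven {U : Type*} [AddCommGroup U] [Module k U] [Superspace k U]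
    (β : V →ₗ[k] W →ₗ[k] U) : Prop :=
  ∀ ⦃i j : ZMod 2⦄ ⦃x : V⦄ ⦃y : W⦄, x ∈ part k V i → y ∈ part k W j → β x y ∈ part k U (i + j)

/-- To prove that a bilinear map sends two graded sets into a submodule, it is enough to consider
homogeneous elements. -/
theorem mem_of_hom (β : V →ₗ[k] W →ₗ[k] P) (N : Submodule k P) (x : V) (y : W)
    (h : ∀ i j, β (proj k i x) (proj k j y) ∈ N) : β x y ∈ N := by
  rw [← proj_add (k := k) x, ← proj_add (k := k) y]
  simp only [map_add, LinearMap.add_apply]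
  exact N.add_mem (N.add_mem (h _ _) (h _ _)) (N.add_mem (h _ _) (h _ _))

section Even

variable {U : Type*} [AddCommGroup U] [Module k U] [Superspace k U]

theorem IsEven.add {β γ : V →ₗ[k] W →ₗ[k] U} (h : IsEven β) (h' : IsEven γ) : IsEven (β + γ) :=
  fun _ _ _ _ hx hy => Submodule.add_mem _ (h hx hy) (h' hx hy)

theorem IsEven.sub {β γ : V →ₗ[k] W →ₗ[k] U} (h : IsEven β) (h' : IsEven γ) : IsEven (β - γ) :=
  fun _ _ _ _ hx hy => Submodule.sub_mem _ (h hx hy) (h' hx hy)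

theorem IsEven.smul {β : V →ₗ[k] W →ₗ[k] U} (c : k) (h : IsEven β) : IsEven (c • β) :=
  fun _ _ _ _ hx hy => Submodule.smul_mem _ c (h hx hy)

theorem IsEven.superSwap {β : V →ₗ[k] W →ₗ[k] U} (h : IsEven β) : IsEven (superSwap β) := by
  intro i j x y hx hy
  rw [superSwap_apply β hx hy, add_comm]
  exact Submodule.smul_mem _ _ (h hy hx)

end Even

end Basic

/-! Constructions of superspaces. -/

section Constructions

variable {k : Type*} [Field k]

/-- The superspace with even part `V₀` and odd part `V₁`: its elements are the pairs
`(even, odd)`, written `⟨even, odd⟩`. -/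
@[ext]
structure EvenOdd (V₀ V₁ : Type*) where
  even : V₀
  odd : V₁

namespace EvenOdd

variable {V₀ V₁ : Type*}

/-- The underlying product. -/
def equivProd (V₀ V₁ : Type*) : EvenOdd V₀ V₁ ≃ V₀ × V₁ where
  toFun x := (x.even, x.odd)
  invFun x := ⟨x.1, x.2⟩

variable [AddCommGroup V₀] [AddCommGroup V₁]

instance : AddCommGroup (EvenOdd V₀ V₁) := (equivProd V₀ V₁).addCommGroup

variable [Module k V₀] [Module k V₁]

instance : Module k (EvenOdd V₀ V₁) := (equivProd V₀ V₁).module k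

@[simp] theorem even_zero : (0 : EvenOdd V₀ V₁).even = 0 := rfl

@[simp] theorem odd_zero : (0 : EvenOdd V₀ V₁).odd = 0 := rfl

@[simp] theorem even_add (x y : EvenOdd V₀ V₁) : (x + y).even = x.even + y.even := rfl

@[simp] theorem odd_add (x y : EvenOdd V₀ V₁) : (x + y).odd = x.odd + y.odd := rfl

@[simp] theorem even_smul (c : k) (x : EvenOdd V₀ V₁) : (c • x).even = c • x.even := rfl

@[simp] theorem odd_smul (c : k) (x : EvenOdd V₀ V₁) : (c • x).odd = c • x.odd := rfl

instance : Superspace k (EvenOdd V₀ V₁) where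
  proj i :=
    { toFun := fun x => if i = 0 then ⟨x.even, 0⟩ else ⟨0, x.odd⟩
      map_add' := fun x y => by split_ifs <;> ext <;> simp
      map_smul' := fun c x => by split_ifs <;> ext <;> simp }
  proj_proj i j x := by
    rcases zmod2 i with rfl | rfl <;> rcases zmod2 j with rfl | rfl <;> ext <;> simp
  proj_add x := by ext <;> simp

theorem mem_zero {x : EvenOdd V₀ V₁} : x ∈ part k (EvenOdd V₀ V₁) 0 ↔ x.odd = 0 :=
  ⟨fun h => (congrArg odd h).symm, fun h => EvenOdd.ext rfl h.symm⟩

theorem mem_one {x : EvenOdd V₀ V₁} : x ∈ part k (EvenOdd V₀ V₁) 1 ↔ x.even = 0 :=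
  ⟨fun h => (congrArg even h).symm, fun h => EvenOdd.ext h.symm rfl⟩

theorem hom_cases {i : ZMod 2} {x : EvenOdd V₀ V₁} (h : x ∈ part k (EvenOdd V₀ V₁) i) :
    (i = 0 ∧ ∃ a, x = ⟨a, 0⟩) ∨ (i = 1 ∧ ∃ u, x = ⟨0, u⟩) := by
  rcases zmod2 i with rfl | rfl
  · exact Or.inl ⟨rfl, x.even, EvenOdd.ext rfl (mem_zero.1 h)⟩
  · exact Or.inr ⟨rfl, x.odd, EvenOdd.ext (mem_one.1 h) rfl⟩

@[elab_as_elim]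
theorem hom_ind {motive : ZMod 2 → EvenOdd V₀ V₁ → Prop} (h0 : ∀ a, motive 0 ⟨a, 0⟩)
    (h1 : ∀ u, motive 1 ⟨0, u⟩) (i : ZMod 2) (x : EvenOdd V₀ V₁)
    (h : x ∈ part k (EvenOdd V₀ V₁) i) : motive i x := by
  obtain ⟨rfl, a, rfl⟩ | ⟨rfl, u, rfl⟩ := hom_cases h
  · exact h0 a
  · exact h1 u

end EvenOdd

variable {V : Type*} [AddCommGroup V] [Module k V] [Superspace k V]
variable {W : Type*} [AddCommGroup W] [Module k W] [Superspace k W]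

instance : Superspace k (V × W) where
  proj i := (proj k i).prodMap (proj k i)
  proj_proj i j v := by
    by_cases h : i = j <;> simp [proj_proj, h]
  proj_add v := by
    ext <;> simp [proj_add]

instance (ι : Type*) : Superspace k (ι → V) where
  proj i := LinearMap.pi fun a => proj k i ∘ₗ LinearMap.proj a
  proj_proj i j v := by
    by_cases h : i = j <;> ext <;> simp [proj_proj, h]
  proj_add v := by
    ext; simp [proj_add]

instance (m n : Type*) : Superspace k (Matrix m n V) where
  proj i := (proj k i).mapMatrix
  proj_proj i j v := by
    by_cases h : i = j <;> ext <;> simp [proj_proj, h]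
  proj_add v := by
    ext; simp [proj_add]

/-- `V ⊗ W` is graded by the sum of the parities. -/
instance : Superspace k (V ⊗[k] W) where
  proj i := ∑ j : ZMod 2, TensorProduct.map (proj k j) (proj k (i - j))
  proj_proj i j v := by
    have h : ∀ f : ZMod 2 → (V ⊗[k] W) →ₗ[k] (V ⊗[k] W), ∑ i, f i = f 0 + f 1 :=
      fun f => Fin.sum_univ_two f
    have h1 : (0 : ZMod 2) - 1 = 1 := by decide
    simp only [h]
    induction v with
    | zero => simp
    | add x y hx hy =>
      simp only [map_add] at *
      rw [hx, hy]; split_ifs <;> simp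
    | tmul x y =>
      rcases zmod2 i with rfl | rfl <;> rcases zmod2 j with rfl | rfl <;>
        simp [h1, proj_proj]
  proj_add v := by
    have h : ∀ f : ZMod 2 → (V ⊗[k] W) →ₗ[k] (V ⊗[k] W), ∑ i, f i = f 0 + f 1 :=
      fun f => Fin.sum_univ_two f
    have h1 : (0 : ZMod 2) - 1 = 1 := by decide
    simp only [h]
    induction v with
    | zero => simp
    | add x y hx hy =>
      simp only [map_add] at *
      nth_rewrite 3 [← hx]
      nth_rewrite 3 [← hy]
      abel
    | tmul x y =>
      conv_rhs => rw [← proj_add (k := k) x, ← proj_add (k := k) y]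
      simp only [h1, LinearMap.add_apply, TensorProduct.map_tmul, TensorProduct.add_tmul,
        TensorProduct.tmul_add, sub_zero, sub_self]
      abel

/-- Linear endomorphisms: `f` has parity `i` if it maps `Vⱼ` to `Vᵢ₊ⱼ` for all `j`. -/
instance : Superspace k (Module.End k V) where
  proj i :=
    { toFun := fun f => ∑ j : ZMod 2, proj k (i + j) ∘ₗ f ∘ₗ proj k j
      map_add' := fun f g => by
        simp [LinearMap.comp_add, LinearMap.add_comp, Finset.sum_add_distrib]
      map_smul' := fun c f => by
        simp [LinearMap.comp_smul, LinearMap.smul_comp, Finset.smul_sum] }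
  proj_proj i j f := by
    have h : ∀ f : ZMod 2 → Module.End k V, ∑ i, f i = f 0 + f 1 :=
      fun f => Fin.sum_univ_two f
    have h1 : (1 : ZMod 2) + 1 = 0 := by decide
    ext v
    rcases zmod2 i with rfl | rfl <;> rcases zmod2 j with rfl | rfl <;>
      simp [h, h1, proj_proj]
  proj_add f := by
    have h : ∀ f : ZMod 2 → Module.End k V, ∑ i, f i = f 0 + f 1 :=
      fun f => Fin.sum_univ_two f
    have h1 : (1 : ZMod 2) + 1 = 0 := by decide
    ext v
    have e0 := proj_add (k := k) (f (proj k 0 v))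
    have e1 := proj_add (k := k) (f (proj k 1 v))
    have e2 : f v = f (proj k 0 v) + f (proj k 1 v) := by rw [← map_add, proj_add]
    simp only [LinearMap.coe_mk, AddHom.coe_mk, h, h1, LinearMap.add_apply, LinearMap.comp_apply,
      zero_add, add_zero]
    rw [e2]
    nth_rewrite 3 [← e0]
    nth_rewrite 3 [← e1]
    abel

/-- An endomorphism has parity `i` iff it shifts parities by `i`. -/
theorem mem_part_end {i : ZMod 2} {f : Module.End k V} :
    f ∈ part k (Module.End k V) i ↔ ∀ j, ∀ x ∈ part k V j, f x ∈ part k V (i + j) := by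
  have h : ∀ f : ZMod 2 → Module.End k V, ∑ i, f i = f 0 + f 1 :=
    fun f => Fin.sum_univ_two f
  have hf : proj k i f = ∑ j : ZMod 2, proj k (i + j) ∘ₗ f ∘ₗ proj k j := rfl
  rw [mem_part, hf, h]
  constructor
  · intro e j x hx
    rw [← e]
    simp only [LinearMap.add_apply, LinearMap.comp_apply, proj_of_mem hx]
    rcases zmod2 j with rfl | rfl <;> simp [proj_mem]
  · intro e
    ext x
    have e0 := e 0 _ (proj_mem (k := k) 0 x)
    have e1 := e 1 _ (proj_mem (k := k) 1 x)
    rw [mem_part] at e0 e1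
    simp only [LinearMap.add_apply, LinearMap.comp_apply]
    rw [e0, e1, ← map_add, proj_add]

/-- A graded subspace. -/
structure SuperSubspace (k : Type*) (V : Type*) [Field k] [AddCommGroup V] [Module k V]
    [Superspace k V] extends Submodule k V where
  proj_mem' : ∀ (i : ZMod 2) {x : V}, x ∈ carrier → proj k i x ∈ carrier

instance (N : SuperSubspace k V) : Superspace k N.toSubmodule where
  proj i := (proj k i).restrict fun _ hx => N.proj_mem' i hx
  proj_proj i j v := by
    by_cases h : i = j <;> ext <;> simp [proj_proj, h]
  proj_add v := by
    ext; simp [proj_add]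

theorem coe_proj (N : SuperSubspace k V) (i : ZMod 2) (x : N.toSubmodule) :
    ((proj k i x : N.toSubmodule) : V) = proj k i (x : V) := rfl

theorem mem_part_sub (N : SuperSubspace k V) {i : ZMod 2} {x : N.toSubmodule} :
    x ∈ part k N.toSubmodule i ↔ (x : V) ∈ part k V i := by
  rw [mem_part, mem_part, ← coe_proj]
  exact Subtype.ext_iff

instance (N : SuperSubspace k V) : Superspace k (V ⧸ N.toSubmodule) where
  proj i := N.toSubmodule.mapQ N.toSubmodule (proj k i) fun _ hx => N.proj_mem' i hx
  proj_proj i j v := by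
    obtain ⟨v, rfl⟩ := N.toSubmodule.mkQ_surjective v
    by_cases h : i = j <;> simp [proj_proj, h]
  proj_add v := by
    obtain ⟨v, rfl⟩ := N.toSubmodule.mkQ_surjective v
    simp [← Submodule.Quotient.mk_add, proj_add]

end Constructions

/-! Superalgebras. -/

/-- A (not necessarily associative) superalgebra structure on a superspace: an even bilinear
product. -/
structure Superalgebra (k : Type*) (V : Type*) [Field k] [AddCommGroup V] [Module k V]
    [Superspace k V] where
  mul : V →ₗ[k] V →ₗ[k] V
  mul_even : IsEven mul

namespace Superalgebra

variable {k : Type*} [Field k]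
variable {V : Type*} [AddCommGroup V] [Module k V] [Superspace k V]
variable {W : Type*} [AddCommGroup W] [Module k W] [Superspace k W]

/-- A Lie superalgebra: the product is superanticommutative and satisfies the super Jacobi
identity, and `[x, [x, x]] = 0` for odd `x` (which is automatic if the characteristic is
not `3`). The characteristic is meant to be different from `2`. -/
structure IsLie (A : Superalgebra k V) : Prop where
  anticomm : ∀ ⦃i j : ZMod 2⦄ ⦃x y : V⦄, x ∈ part k V i → y ∈ part k V j →
    A.mul x y = -(sgn k (i * j) • A.mul y x)
  jacobi : ∀ ⦃i j : ZMod 2⦄ ⦃x y : V⦄, x ∈ part k V i → y ∈ part k V j → ∀ z : V,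
    A.mul x (A.mul y z) = A.mul (A.mul x y) z + sgn k (i * j) • A.mul y (A.mul x z)
  cube : ∀ ⦃x : V⦄, x ∈ part k V 1 → A.mul x (A.mul x x) = 0

/-- Two superalgebras are isomorphic if there is an even bijective linear map between them that
preserves the products. -/
def Isomorphic (A : Superalgebra k V) (B : Superalgebra k W) : Prop :=
  ∃ e : V ≃ₗ[k] W, (∀ (i : ZMod 2) (x : V), e (proj k i x) = proj k i (e x)) ∧
    ∀ x y : V, e (A.mul x y) = B.mul (e x) (e y)

theorem proj_mul_of_mem (A : Superalgebra k V) {i j : ZMod 2} {x y : V} (l : ZMod 2)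
    (hx : x ∈ part k V i) (hy : y ∈ part k V j) :
    proj k l (A.mul x y) = if l = i + j then A.mul x y else 0 :=
  proj_of_mem (A.mul_even hx hy)

/-- A graded subalgebra. -/
structure Sub (A : Superalgebra k V) extends SuperSubspace k V where
  mul_mem' : ∀ {x y : V}, x ∈ carrier → y ∈ carrier → A.mul x y ∈ carrier

/-- A graded subalgebra is a superalgebra. -/
def Sub.alg {A : Superalgebra k V} (N : A.Sub) : Superalgebra k N.toSubmodule where
  mul := LinearMap.mk₂ k (fun x y => ⟨A.mul x y, N.mul_mem' x.2 y.2⟩)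
    (fun _ _ _ => Subtype.ext (by simp)) (fun _ _ _ => Subtype.ext (by simp))
    (fun _ _ _ => Subtype.ext (by simp)) (fun _ _ _ => Subtype.ext (by simp))
  mul_even := by
    intro i j x y hx hy
    rw [mem_part_sub] at hx hy ⊢
    exact A.mul_even hx hy

/-- The (two-sided) annihilator of a superalgebra; for a Lie superalgebra this is its center. -/
def center (A : Superalgebra k V) : SuperSubspace k V where
  carrier := {z | ∀ x, A.mul z x = 0 ∧ A.mul x z = 0}
  zero_mem' := by simp
  add_mem' := by
    intro a b ha hb x
    simp [(ha x).1, (ha x).2, (hb x).1, (hb x).2]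
  smul_mem' := by
    intro c a ha x
    simp [(ha x).1, (ha x).2]
  proj_mem' := by
    intro i z hz
    have key : ∀ i j x, A.mul (proj k i z) (proj k j x) = 0 ∧
        A.mul (proj k j x) (proj k i z) = 0 := by
      intro i j x
      have h1 := congrArg (proj k (i + j)) (hz (proj k j x)).1
      have h2 := congrArg (proj k (i + j)) (hz (proj k j x)).2
      have e := fun a b => A.proj_mul_of_mem (i + j) (proj_mem (k := k) a z) (proj_mem (k := k) b x)
      have e' := fun a b => A.proj_mul_of_mem (i + j) (proj_mem (k := k) b x) (proj_mem (k := k) a z)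
      rw [← proj_add (k := k) z] at h1 h2
      simp only [map_add, LinearMap.add_apply, e, e', map_zero] at h1 h2
      rcases zmod2 i with rfl | rfl <;> rcases zmod2 j with rfl | rfl <;>
        simpa using And.intro h1 h2
    intro x
    rw [← proj_add (k := k) x]
    simp [key]

/-- The quotient of a superalgebra modulo its center. -/
def modCenter (A : Superalgebra k V) : Superalgebra k (V ⧸ A.center.toSubmodule) where
  mul := (A.mul.compr₂ A.center.toSubmodule.mkQ).liftQ₂ A.center.toSubmodule A.center.toSubmodule
    (fun z hz => LinearMap.ext fun x => by
      rw [LinearMap.compr₂_apply, (hz x).1, map_zero, LinearMap.zero_apply])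
    (fun z hz => LinearMap.ext fun x => by
      rw [LinearMap.flip_apply, LinearMap.compr₂_apply, (hz x).2, map_zero, LinearMap.zero_apply])
  mul_even := by
    intro i j x y hx hy
    obtain ⟨x, rfl⟩ := A.center.toSubmodule.mkQ_surjective x
    obtain ⟨y, rfl⟩ := A.center.toSubmodule.mkQ_surjective y
    have h := A.mul_even (proj_mem (k := k) i x) (proj_mem (k := k) j y)
    rw [mem_part] at hx hy h
    have ex : A.center.toSubmodule.mkQ (proj k i x) = A.center.toSubmodule.mkQ x := hx
    have ey : A.center.toSubmodule.mkQ (proj k j y) = A.center.toSubmodule.mkQ y := hy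
    rw [← ex, ← ey]
    exact congrArg A.center.toSubmodule.mkQ h

end Superalgebra

/-! The general linear Lie superalgebra, derivations and the structure superalgebra. -/

section Endomorphisms

variable {k : Type*} [Field k]
variable {V : Type*} [AddCommGroup V] [Module k V] [Superspace k V]

theorem isEven_comp : IsEven (LinearMap.mul k (Module.End k V)) := by
  intro i j f g hf hg
  rw [mem_part_end] at hf hg ⊢
  intro l x hx
  rw [add_assoc]
  exact hf _ _ (hg _ _ hx)

variable (k V) in
/-- The general linear Lie superalgebra: `[f, g] = fg - (-1)^{fg} gf`. -/
def gl : Superalgebra k (Module.End k V) where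
  mul := LinearMap.mul k (Module.End k V) - superSwap (LinearMap.mul k (Module.End k V))
  mul_even := isEven_comp.sub isEven_comp.superSwap

theorem gl_mul {i j : ZMod 2} {f g : Module.End k V} (hf : f ∈ part k (Module.End k V) i)
    (hg : g ∈ part k (Module.End k V) j) (x : V) :
    (gl k V).mul f g x = f (g x) - sgn k (i * j) • g (f x) := by
  simp [gl, superSwap_apply _ hf hg]

/-- The superderivations: each homogeneous component `dᵢ` of `d` satisfies
`dᵢ(xy) = dᵢ(x)y + (-1)^{ix} x dᵢ(y)`. -/
def der (A : Superalgebra k V) : Submodule k (Module.End k V) where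
  carrier := {d | ∀ i j : ZMod 2, ∀ x ∈ part k V j, ∀ y : V,
    proj k i d (A.mul x y) = A.mul (proj k i d x) y + sgn k (i * j) • A.mul x (proj k i d y)}
  zero_mem' := by simp
  add_mem' := by
    intro a b ha hb i j x hx y
    simp only [map_add, LinearMap.add_apply, ha i j x hx y, hb i j x hx y, smul_add]
    abel
  smul_mem' := by
    intro c a ha i j x hx y
    simp only [map_smul, LinearMap.smul_apply, ha i j x hx y, smul_add]
    rw [smul_comm]

theorem proj_mem_der (A : Superalgebra k V) (i : ZMod 2) {d : Module.End k V} (hd : d ∈ der A) :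
    proj k i d ∈ der A := by
  intro l j x hx y
  rw [proj_proj]
  split_ifs with h
  · exact hd i j x hx y |> fun e => h ▸ e
  · simp

theorem proj_leftMul (A : Superalgebra k V) (i : ZMod 2) (x : V) :
    proj k i (A.mul x) = A.mul (proj k i x) := by
  have h : ∀ j, A.mul (proj k j x) ∈ part k (Module.End k V) j := by
    intro j
    rw [mem_part_end]
    exact fun l y hy => A.mul_even (proj_mem j x) hy
  conv_lhs => rw [← proj_add (k := k) x]
  rw [map_add, map_add, proj_of_mem (h 0), proj_of_mem (h 1)]
  rcases zmod2 i with rfl | rfl <;> simp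

/-- The structure (or Lie multiplication) superalgebra of `A`: the subalgebra of the general linear
Lie superalgebra of `V` spanned by the superderivations and the left multiplications
of `A`, that is, the smallest subspace containing them and closed under the bracket. -/
def str (A : Superalgebra k V) : (gl k V).Sub where
  toSubmodule := sInf {N | der A ≤ N ∧ (∀ x, A.mul x ∈ N) ∧
    ∀ f ∈ N, ∀ g ∈ N, (gl k V).mul f g ∈ N}
  proj_mem' := by
    intro i f hf
    refine Submodule.mem_sInf.2 fun N hN => ?_
    obtain ⟨h1, h2, h3⟩ := hN
    let N' : Submodule k (Module.End k V) := ⨅ i, N.comap (proj k i)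
    have hN' : ∀ g, g ∈ N' ↔ ∀ i, proj k i g ∈ N := by simp [N']
    refine (hN' f).1 (Submodule.mem_sInf.1 hf N' ⟨?_, ?_, ?_⟩) i
    · exact fun d hd => (hN' d).2 fun i => h1 (proj_mem_der A i hd)
    · intro x
      refine (hN' _).2 fun i => ?_
      rw [proj_leftMul]
      exact h2 _
    · intro f hf g hg
      refine mem_of_hom (gl k V).mul N' f g fun a b => (hN' _).2 fun l => ?_
      rw [(gl k V).proj_mul_of_mem l (proj_mem a f) (proj_mem b g)]
      split_ifs
      · exact h3 _ ((hN' f).1 hf a) _ ((hN' g).1 hg b)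
      · exact N.zero_mem
  mul_mem' := by
    intro f g hf hg
    refine Submodule.mem_sInf.2 fun N hN => ?_
    exact hN.2.2 f (Submodule.mem_sInf.1 hf N hN) g (Submodule.mem_sInf.1 hg N hN)

/-- The projective structure Lie superalgebra: the quotient of the structure superalgebra modulo
its center. -/
def pstr (A : Superalgebra k V) :
    Superalgebra k ((str A).toSubmodule ⧸ (str A).alg.center.toSubmodule) :=
  (str A).alg.modCenter

end Endomorphisms
/-! Composition superalgebras. -/

section Composition

/-- A composition superalgebra over a field of characteristic different from `2`: a superalgebra
with a nondegenerate even supersymmetric bilinear form `b` (the polar form of the norm, so the norm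
of an even element `x` is `b x x / 2`) satisfying the linearized composition identity. -/
structure CompositionSuperalgebra (k : Type*) (C : Type*) [Field k] [AddCommGroup C] [Module k C]
    [Superspace k C] extends Superalgebra k C where
  b : C →ₗ[k] C →ₗ[k] k
  b_even : ∀ {i j : ZMod 2} {x y : C}, x ∈ part k C i → y ∈ part k C j → i ≠ j → b x y = 0
  b_symm : ∀ {i j : ZMod 2} {x y : C}, x ∈ part k C i → y ∈ part k C j →
    b x y = sgn k (i * j) * b y x
  b_nondeg : ∀ x : C, (∀ y, b x y = 0) → x = 0
  b_comp : ∀ {i j l m : ZMod 2} {x y z t : C}, x ∈ part k C i → y ∈ part k C j →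
    z ∈ part k C l → t ∈ part k C m →
    b (mul x y) (mul z t) + sgn k (i * j + i * l + j * l) * b (mul z y) (mul x t)
      = sgn k (j * l) * (b x z * b y t)

/-- A symmetric composition superalgebra: the bilinear form is associative. -/
structure SymmetricCompositionSuperalgebra (k : Type*) (C : Type*) [Field k] [AddCommGroup C]
    [Module k C] [Superspace k C] extends CompositionSuperalgebra k C where
  b_assoc : ∀ x y z : C, b (mul x y) z = b x (mul y z)

/-- A Hurwitz superalgebra: a unital composition superalgebra. -/
structure HurwitzSuperalgebra (k : Type*) (C : Type*) [Field k] [AddCommGroup C]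
    [Module k C] [Superspace k C] extends CompositionSuperalgebra k C where
  one : C
  one_mem : one ∈ part k C 0
  one_mul' : ∀ x : C, mul one x = x
  mul_one' : ∀ x : C, mul x one = x

variable {k : Type*} [Field k]
variable {C : Type*} [AddCommGroup C] [Module k C] [Superspace k C]

/-- Induction on homogeneous components for equalities of linear functionals. -/
theorem eq_of_hom {P : Type*} [AddCommGroup P] [Module k P] (f g : C →ₗ[k] P)
    (h : ∀ i, ∀ x ∈ part k C i, f x = g x) (x : C) : f x = g x := by
  rw [← proj_add (k := k) x, map_add, map_add, h 0 _ (proj_mem 0 x), h 1 _ (proj_mem 1 x)]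

theorem CompositionSuperalgebra.eq_of_b (A : CompositionSuperalgebra k C) {x y : C}
    (h : ∀ i, ∀ z ∈ part k C i, A.b x z = A.b y z) : x = y := by
  rw [← sub_eq_zero]
  refine A.b_nondeg _ fun z => ?_
  rw [map_sub, LinearMap.sub_apply, sub_eq_zero]
  exact eq_of_hom (A.b x) (A.b y) h z

namespace HurwitzSuperalgebra

variable (A : HurwitzSuperalgebra k C)

/-- The standard involution `x ↦ b(x, 1) 1 - x`. -/
def conj : C →ₗ[k] C := (A.b.flip A.one).smulRight A.one - LinearMap.id

theorem conj_apply (x : C) : A.conj x = A.b x A.one • A.one - x := by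
  simp [conj]

theorem conj_mem {i : ZMod 2} {x : C} (hx : x ∈ part k C i) : A.conj x ∈ part k C i := by
  rw [conj_apply]
  refine Submodule.sub_mem _ ?_ hx
  rcases zmod2 i with rfl | rfl
  · exact Submodule.smul_mem _ _ A.one_mem
  · rw [A.b_even hx A.one_mem (by decide), zero_smul]
    exact Submodule.zero_mem _

/-- `b(xy, t) + (-1)^{xy} b(y, xt) = b(x, 1) b(y, t)` -/
theorem b_left {i j m : ZMod 2} {x y t : C} (hx : x ∈ part k C i) (hy : y ∈ part k C j)
    (ht : t ∈ part k C m) :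
    A.b (A.mul x y) t + sgn k (i * j) * A.b y (A.mul x t) = A.b x A.one * A.b y t := by
  have h := A.b_comp hx hy A.one_mem ht
  simpa [A.one_mul', sgn_zero] using h

/-- `b(x, zt) + (-1)^{xz} b(z, xt) = b(x, z) b(1, t)` -/
theorem b_mid {i l m : ZMod 2} {x z t : C} (hx : x ∈ part k C i) (hz : z ∈ part k C l)
    (ht : t ∈ part k C m) :
    A.b x (A.mul z t) + sgn k (i * l) * A.b z (A.mul x t) = A.b x z * A.b A.one t := by
  have h := A.b_comp hx A.one_mem hz ht
  simpa [A.mul_one', sgn_zero] using h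

/-- `b(xy, z) + (-1)^{xy + xz + yz} b(zy, x) = (-1)^{yz} b(x, z) b(y, 1)` -/
theorem b_right {i j l : ZMod 2} {x y z : C} (hx : x ∈ part k C i) (hy : y ∈ part k C j)
    (hz : z ∈ part k C l) :
    A.b (A.mul x y) z + sgn k (i * j + i * l + j * l) * A.b (A.mul z y) x
      = sgn k (j * l) * (A.b x z * A.b y A.one) := by
  have h := A.b_comp hx hy hz A.one_mem
  simpa [A.mul_one'] using h

theorem b_one_symm {i : ZMod 2} {x : C} (hx : x ∈ part k C i) :
    A.b x A.one = A.b A.one x := by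
  have h := A.b_symm hx A.one_mem
  simpa [sgn_zero] using h

theorem b_one_odd {x : C} (hx : x ∈ part k C 1) : A.b x A.one = 0 :=
  A.b_even hx A.one_mem (by decide)

theorem b_one_mul {i : ZMod 2} {t : C} (ht : t ∈ part k C i) :
    A.b A.one A.one * A.b A.one t = 2 * A.b A.one t := by
  have h := A.b_left A.one_mem A.one_mem ht
  simp only [A.one_mul', mul_zero, sgn_zero] at h
  linear_combination -h

/-- `xy + (-1)^{xy} yx = b(x, 1) y + b(y, 1) x - b(x, y) 1` -/
theorem mul_add_mul {i j : ZMod 2} {x y : C} (hx : x ∈ part k C i) (hy : y ∈ part k C j) :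
    A.mul x y + sgn k (i * j) • A.mul y x
      = A.b x A.one • y + A.b y A.one • x - A.b x y • A.one := by
  refine A.eq_of_b fun m t ht => ?_
  have h1 := A.b_left hx hy ht
  have h2 := A.b_mid hy hx ht
  have h3 := A.b_left hy hx ht
  have h4 := A.b_symm hx hy
  have h5 := A.b_one_odd (x := y)
  simp only [map_add, map_sub, map_smul, LinearMap.add_apply, LinearMap.sub_apply,
    LinearMap.smul_apply, smul_eq_mul]
  rcases zmod2 i with rfl | rfl <;> rcases zmod2 j with rfl | rfl <;>
    simp only [mul_zero, mul_one, sgn_zero, sgn_one, one_mul] at h1 h2 h3 h4 ⊢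
  · linear_combination h1 + h3 - h2 + h4 * A.b A.one t
  · linear_combination h1 + h3 - h2 + h4 * A.b A.one t
  · linear_combination h1 + h3 - h2 + h4 * A.b A.one t
  · linear_combination h1 - h3 + h2 + h4 * A.b A.one t - 2 * h5 hy * A.b x t

/-- The standard involution is an isometry. -/
theorem b_conj (x y : C) : A.b (A.conj x) (A.conj y) = A.b x y := by
  have key : ∀ i, ∀ x ∈ part k C i, ∀ j, ∀ y ∈ part k C j,
      A.b (A.conj x) (A.conj y) = A.b x y := by
    intro i x hx j y hy
    have h1 := A.b_one_mul hy
    have h2 := A.b_one_symm hx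
    have h3 := A.b_one_symm hy
    simp only [conj_apply, map_sub, map_smul, LinearMap.sub_apply, LinearMap.smul_apply,
      smul_eq_mul]
    rw [h3]
    linear_combination A.b x A.one * h1
  refine eq_of_hom (((A.b.compl₁₂ A.conj A.conj).flip y)) (A.b.flip y) (fun i x hx => ?_) x
  exact eq_of_hom ((A.b.compl₁₂ A.conj A.conj) x) (A.b x) (fun j y hy => key i x hx j y hy) y

/-- The standard involution is a superinvolution. -/
theorem conj_mul {i j : ZMod 2} {x y : C} (hx : x ∈ part k C i) (hy : y ∈ part k C j) :
    A.conj (A.mul x y) = sgn k (i * j) • A.mul (A.conj y) (A.conj x) := by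
  have h1 := A.b_left hx hy A.one_mem
  have h2 := A.mul_add_mul hx hy
  have h3 := A.b_symm hx hy
  have h4 := A.b_one_odd (x := y)
  have h5 := A.b_one_odd (x := x)
  simp only [A.mul_one'] at h1
  have h6 := eq_sub_of_add_eq h1
  have h7 := eq_sub_of_add_eq h2
  simp only [conj_apply, map_sub, map_smul, LinearMap.sub_apply, LinearMap.smul_apply,
    A.mul_one', A.one_mul']
  rw [h6, h7]
  rcases zmod2 i with rfl | rfl <;> rcases zmod2 j with rfl | rfl <;>
    simp only [mul_zero, mul_one, sgn_zero, sgn_one, one_mul] at h3 ⊢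
  · rw [h3]; module
  · rw [h3]; module
  · rw [h3]; module
  · rw [h3, h4 hy, h5 hx]; module

theorem conj_conj (x : C) : A.conj (A.conj x) = x := by
  have key : (A.b A.one A.one - 2) * A.b x A.one = 0 := by
    refine eq_of_hom ((A.b A.one A.one - 2) • A.b.flip A.one) 0 (fun i x hx => ?_) x
    have h1 := A.b_one_mul hx
    have h2 := A.b_one_symm hx
    simp only [LinearMap.smul_apply, LinearMap.flip_apply, smul_eq_mul, LinearMap.zero_apply]
    rw [h2]
    linear_combination h1
  simp only [conj_apply, map_sub, map_smul]
  have h : A.b x A.one * A.b A.one A.one = 2 * A.b x A.one := by linear_combination key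
  rw [smul_sub, smul_smul, h]
  module

/-- The para-Hurwitz superalgebra: the product `x • y = conj x * conj y` with the same norm. -/
def para : SymmetricCompositionSuperalgebra k C where
  mul := A.mul.compl₁₂ A.conj A.conj
  mul_even := fun _ _ _ _ hx hy => A.mul_even (A.conj_mem hx) (A.conj_mem hy)
  b := A.b
  b_even := A.b_even
  b_symm := A.b_symm
  b_nondeg := A.b_nondeg
  b_comp := by
    intro i j l m x y z t hx hy hz ht
    have h := A.b_comp (A.conj_mem hx) (A.conj_mem hy) (A.conj_mem hz) (A.conj_mem ht)
    simpa only [b_conj, LinearMap.compl₁₂_apply] using h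
  b_assoc := by
    have key : ∀ i, ∀ x ∈ part k C i, ∀ j, ∀ y ∈ part k C j, ∀ l, ∀ z ∈ part k C l,
        A.b (A.mul (A.conj x) (A.conj y)) z = A.b x (A.mul (A.conj y) (A.conj z)) := by
      intro i x hx j y hy l z hz
      have h1 := A.b_conj x (A.mul (A.conj y) (A.conj z))
      rw [A.conj_mul (A.conj_mem hy) (A.conj_mem hz), conj_conj, conj_conj] at h1
      have h2 := A.b_right (A.conj_mem hx) hy hz
      have h3 := A.b_symm (A.conj_mem hx) (A.mul_even hz hy)
      have h4 := A.b_one_odd (x := y)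
      rw [← h1, A.conj_apply y]
      simp only [map_sub, map_smul, LinearMap.sub_apply, LinearMap.smul_apply,
        smul_eq_mul, A.mul_one']
      rw [h3]
      have h11 : (1 : ZMod 2) + 1 = 0 := by decide
      rcases zmod2 i with rfl | rfl <;> rcases zmod2 j with rfl | rfl <;>
        rcases zmod2 l with rfl | rfl <;>
        simp only [mul_zero, mul_one, sgn_zero, sgn_one, one_mul, h11, add_zero, zero_add]
          at h2 h3 ⊢ <;>
        first
        | linear_combination -h2
        | linear_combination -h2 + h4 hy * A.b (A.conj x) z
        | linear_combination -h2 + 2 * h4 hy * A.b (A.conj x) z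
    intro x y z
    change A.b (A.mul (A.conj x) (A.conj y)) z = A.b x (A.mul (A.conj y) (A.conj z))
    let f : C →ₗ[k] C →ₗ[k] C := A.mul.compl₁₂ A.conj A.conj
    refine eq_of_hom (A.b.flip z ∘ₗ f.flip y) (A.b.flip (f y z)) (fun i x hx => ?_) x
    refine eq_of_hom (A.b.flip z ∘ₗ f x) (A.b x ∘ₗ f.flip z) (fun j y hy => ?_) y
    exact eq_of_hom (A.b (f x y)) (A.b x ∘ₗ f y) (fun l z hz => key i x hx j y hy l z hz) z

end HurwitzSuperalgebra

/-! The orthosymplectic Lie superalgebra, the triality Lie superalgebra and its elements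
`t_{x,y}`. -/

namespace SymmetricCompositionSuperalgebra

variable (S : SymmetricCompositionSuperalgebra k C)

/-- The orthosymplectic Lie superalgebra: the homogeneous components `fₚ` of `f` satisfy
`b(fₚ x, y) + (-1)^{px} b(x, fₚ y) = 0`. -/
def osp : Submodule k (Module.End k C) where
  carrier := {f | ∀ p j : ZMod 2, ∀ x ∈ part k C j, ∀ y : C,
    S.b (proj k p f x) y + sgn k (p * j) * S.b x (proj k p f y) = 0}
  zero_mem' := by simp
  add_mem' := by
    intro f g hf hg p j x hx y
    simp only [map_add, LinearMap.add_apply]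
    linear_combination hf p j x hx y + hg p j x hx y
  smul_mem' := by
    intro c f hf p j x hx y
    simp only [map_smul, LinearMap.smul_apply, smul_eq_mul]
    linear_combination c * hf p j x hx y

/-- The conditions defining the triality Lie superalgebra, for all homogeneous components. -/
def triSubmodule : Submodule k (Fin 3 → Module.End k C) where
  carrier := {d | (∀ a, d a ∈ S.osp) ∧ ∀ p j : ZMod 2, ∀ x ∈ part k C j, ∀ y : C,
    proj k p (d 0) (S.mul x y)
      = S.mul (proj k p (d 1) x) y + sgn k (p * j) • S.mul x (proj k p (d 2) y)}
  zero_mem' := ⟨fun _ => Submodule.zero_mem _, by simp⟩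
  add_mem' := by
    intro d e hd he
    refine ⟨fun a => Submodule.add_mem _ (hd.1 a) (he.1 a), fun p j x hx y => ?_⟩
    simp only [Pi.add_apply, map_add, LinearMap.add_apply, hd.2 p j x hx y, he.2 p j x hx y]
    module
  smul_mem' := by
    intro c d hd
    refine ⟨fun a => Submodule.smul_mem _ c (hd.1 a), fun p j x hx y => ?_⟩
    simp only [Pi.smul_apply, map_smul, LinearMap.smul_apply, hd.2 p j x hx y]
    module

variable {S}

theorem osp_hom {p j : ZMod 2} {f : Module.End k C} (hf : f ∈ S.osp)
    (hp : f ∈ part k (Module.End k C) p) {x : C} (hx : x ∈ part k C j) (y : C) :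
    S.b (f x) y = -(sgn k (p * j) * S.b x (f y)) := by
  have h := hf p j x hx y
  rw [proj_of_mem hp, if_pos rfl] at h
  linear_combination h

theorem mem_osp {p : ZMod 2} {f : Module.End k C} (hp : f ∈ part k (Module.End k C) p)
    (h : ∀ j l : ZMod 2, ∀ x ∈ part k C j, ∀ y ∈ part k C l,
      S.b (f x) y + sgn k (p * j) * S.b x (f y) = 0) : f ∈ S.osp := by
  intro q j x hx y
  rw [proj_of_mem hp]
  split_ifs with e
  · subst e
    exact eq_of_hom (S.b (f x) + sgn k (q * j) • (S.b x ∘ₗ f)) 0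
      (fun l y hy => h j l x hx y hy) y
  · simp

theorem tri_hom {p j : ZMod 2} {d : Fin 3 → Module.End k C} (hd : d ∈ S.triSubmodule)
    (hp : ∀ a, d a ∈ part k (Module.End k C) p) {x : C} (hx : x ∈ part k C j) (y : C) :
    d 0 (S.mul x y) = S.mul (d 1 x) y + sgn k (p * j) • S.mul x (d 2 y) := by
  have h := hd.2 p j x hx y
  simpa only [proj_of_mem (hp _), if_true] using h

theorem mem_tri {p : ZMod 2} {d : Fin 3 → Module.End k C}
    (hp : ∀ a, d a ∈ part k (Module.End k C) p) (h1 : ∀ a, d a ∈ S.osp)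
    (h2 : ∀ j l : ZMod 2, ∀ x ∈ part k C j, ∀ y ∈ part k C l,
      d 0 (S.mul x y) = S.mul (d 1 x) y + sgn k (p * j) • S.mul x (d 2 y)) :
    d ∈ S.triSubmodule := by
  refine ⟨h1, fun q j x hx y => ?_⟩
  simp only [proj_of_mem (hp _)]
  split_ifs with e
  · subst e
    exact eq_of_hom (d 0 ∘ₗ S.mul x) (S.mul (d 1 x) + sgn k (q * j) • (S.mul x ∘ₗ d 2))
      (fun l y hy => h2 j l x hx y hy) y
  · simp

theorem proj_mem_osp (i : ZMod 2) {f : Module.End k C} (hf : f ∈ S.osp) :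
    proj k i f ∈ S.osp := by
  intro p j x hx y
  rw [proj_proj]
  split_ifs with h
  · subst h; exact hf p j x hx y
  · simp

theorem proj_mem_tri (i : ZMod 2) {d : Fin 3 → Module.End k C} (hd : d ∈ S.triSubmodule) :
    proj k i d ∈ S.triSubmodule := by
  refine ⟨fun a => proj_mem_osp i (hd.1 a), fun p j x hx y => ?_⟩
  have e : ∀ a, proj k i d a = proj k i (d a) := fun _ => rfl
  simp only [e, proj_proj]
  split_ifs with h
  · subst h; exact hd.2 p j x hx y
  · simp

theorem bracket_mem_osp {p q : ZMod 2} {f g : Module.End k C} (hf : f ∈ S.osp) (hg : g ∈ S.osp)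
    (hp : f ∈ part k (Module.End k C) p) (hq : g ∈ part k (Module.End k C) q) :
    (gl k C).mul f g ∈ S.osp := by
  refine mem_osp ((gl k C).mul_even hp hq) fun j l x hx y hy => ?_
  have hgx := mem_part_end.1 hq j x hx
  have hfx := mem_part_end.1 hp j x hx
  simp only [gl_mul hp hq, map_sub, map_smul, LinearMap.sub_apply, LinearMap.smul_apply,
    smul_eq_mul, osp_hom hf hp hgx, osp_hom hg hq hfx, osp_hom hf hp hx, osp_hom hg hq hx]
  have h11 : (1 : ZMod 2) + 1 = 0 := by decide
  rcases zmod2 p with rfl | rfl <;> rcases zmod2 q with rfl | rfl <;>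
    rcases zmod2 j with rfl | rfl <;>
    simp only [mul_zero, mul_one, sgn_zero, sgn_one, one_mul, h11, add_zero, zero_add] <;> ring

theorem bracket_mem_tri {d e : Fin 3 → Module.End k C} (hd : d ∈ S.triSubmodule)
    (he : e ∈ S.triSubmodule) : (fun a => (gl k C).mul (d a) (e a)) ∈ S.triSubmodule := by
  let β : (Fin 3 → Module.End k C) →ₗ[k] (Fin 3 → Module.End k C) →ₗ[k]
      (Fin 3 → Module.End k C) :=
    LinearMap.mk₂ k (fun d e a => (gl k C).mul (d a) (e a))
      (fun _ _ _ => by ext; simp) (fun _ _ _ => by ext; simp)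
      (fun _ _ _ => by ext; simp) (fun _ _ _ => by ext; simp)
  refine mem_of_hom β S.triSubmodule d e fun p q => ?_
  have hd' := proj_mem_tri p hd
  have he' := proj_mem_tri q he
  have hp : ∀ a, proj k p d a ∈ part k (Module.End k C) p := fun a => proj_mem p (d a)
  have hq : ∀ a, proj k q e a ∈ part k (Module.End k C) q := fun a => proj_mem q (e a)
  generalize proj k p d = d at *
  generalize proj k q e = e at *
  refine mem_tri (p := p + q) (fun a => (gl k C).mul_even (hp a) (hq a))
    (fun a => bracket_mem_osp (hd'.1 a) (he'.1 a) (hp a) (hq a)) fun j l x hx y hy => ?_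
  have hgx := mem_part_end.1 (hq 1) j x hx
  have hfx := mem_part_end.1 (hp 1) j x hx
  simp only [β, LinearMap.mk₂_apply, gl_mul (hp _) (hq _), tri_hom hd' hp hx, tri_hom he' hq hx,
    map_add, map_sub, map_smul, LinearMap.sub_apply, LinearMap.smul_apply,
    tri_hom hd' hp hgx, tri_hom he' hq hfx]
  have h11 : (1 : ZMod 2) + 1 = 0 := by decide
  rcases zmod2 p with rfl | rfl <;> rcases zmod2 q with rfl | rfl <;>
    rcases zmod2 j with rfl | rfl <;>
    simp only [mul_zero, mul_one, sgn_zero, sgn_one, h11, add_zero, zero_add] <;> module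

theorem b_ext_right {x y : C} (h : ∀ i, ∀ z ∈ part k C i, S.b z x = S.b z y) : x = y := by
  rw [← sub_eq_zero]
  refine S.b_nondeg _ fun z => ?_
  refine eq_of_hom (S.b (x - y)) 0 (fun i z hz => ?_) z
  have key : ∀ j, S.b (proj k j (x - y)) z = 0 := by
    intro j
    rw [S.b_symm (proj_mem j _) hz]
    have e : S.b z (proj k j (x - y)) = S.b (proj k j z) (x - y) := by
      conv_rhs => rw [← proj_add (k := k) (x - y)]
      rw [proj_of_mem hz]
      rcases zmod2 i with rfl | rfl <;> rcases zmod2 j with rfl | rfl <;>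
        simp [S.b_even hz (proj_mem _ (x - y))] <;>
        simp [← map_sub, S.b_even hz (proj_mem _ (x - y))]
    rw [e, map_sub, proj_of_mem hz]
    split_ifs <;> simp [h i z hz]
  rw [← proj_add (k := k) (x - y), map_add, LinearMap.add_apply, key, key, add_zero,
    LinearMap.zero_apply]

/-- `(xy)z + (-1)^{xy + xz + yz} (zy)x = (-1)^{yz} b(x, z) y` -/
theorem comp_left {i j l : ZMod 2} {x y z : C} (hx : x ∈ part k C i) (hy : y ∈ part k C j)
    (hz : z ∈ part k C l) :
    S.mul (S.mul x y) z + sgn k (i * j + i * l + j * l) • S.mul (S.mul z y) x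
      = (sgn k (j * l) * S.b x z) • y := by
  refine S.eq_of_b fun m t ht => ?_
  have h := S.b_comp hx hy hz ht
  simp only [map_add, map_smul, LinearMap.add_apply, LinearMap.smul_apply, smul_eq_mul,
    S.b_assoc] at h ⊢
  linear_combination h

/-- `x(yz) + (-1)^{xy + xz + yz} z(yx) = (-1)^{xy} b(x, z) y` -/
theorem comp_right {i j l : ZMod 2} {x y z : C} (hx : x ∈ part k C i) (hy : y ∈ part k C j)
    (hz : z ∈ part k C l) :
    S.mul x (S.mul y z) + sgn k (i * j + i * l + j * l) • S.mul z (S.mul y x)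
      = (sgn k (i * j) * S.b x z) • y := by
  refine b_ext_right (S := S) fun m t ht => ?_
  have h := S.b_comp ht hx hy hz
  have h2 := S.b_symm (S.mul_even hy hx) (S.mul_even ht hz)
  rw [h2] at h
  simp only [map_add, map_smul, smul_eq_mul, S.b_assoc] at h ⊢
  have h11 : (1 : ZMod 2) + 1 = 0 := by decide
  rcases zmod2 i with rfl | rfl <;> rcases zmod2 j with rfl | rfl <;>
    rcases zmod2 l with rfl | rfl <;> rcases zmod2 m with rfl | rfl <;>
    simp only [mul_zero, mul_one, sgn_zero, sgn_one, h11, add_zero, zero_add] at h ⊢ <;>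
    linear_combination h

variable (k C) in
/-- Triples of endomorphisms with the componentwise bracket. -/
def piGl : Superalgebra k (Fin 3 → Module.End k C) where
  mul := LinearMap.mk₂ k (fun d e a => (gl k C).mul (d a) (e a))
    (fun _ _ _ => by ext; simp) (fun _ _ _ => by ext; simp)
    (fun _ _ _ => by ext; simp) (fun _ _ _ => by ext; simp)
  mul_even := fun _ _ _ _ hd he => funext fun a =>
    (gl k C).mul_even (congrFun hd a) (congrFun he a)

variable (S) in
/-- The triality Lie superalgebra of a symmetric composition superalgebra. -/
def tri : (piGl k C).Sub where
  toSubmodule := S.triSubmodule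
  proj_mem' := fun i _ hd => proj_mem_tri i hd
  mul_mem' := fun hd he => bracket_mem_tri hd he

/-- If `(d₀, d₁, d₂)` is in the triality Lie superalgebra, so is `(d₂, d₀, d₁)`. -/
theorem rot_mem_tri {d : Fin 3 → Module.End k C} (hd : d ∈ S.triSubmodule) :
    (fun a => d (a - 1)) ∈ S.triSubmodule := by
  let ρ : (Fin 3 → Module.End k C) →ₗ[k] (Fin 3 → Module.End k C) :=
    LinearMap.funLeft k _ fun a => a - 1
  have hρ : ∀ p, ρ (proj k p d) ∈ S.triSubmodule := by
    intro p
    have hd' := proj_mem_tri p hd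
    have hp : ∀ a, proj k p d a ∈ part k (Module.End k C) p := fun a => proj_mem p (d a)
    generalize proj k p d = d at *
    refine mem_tri (p := p) (fun a => hp _) (fun a => hd'.1 _) fun j l x hx y hy => ?_
    have e0 : ρ d 0 = d 2 := rfl
    have e1 : ρ d 1 = d 0 := rfl
    have e2 : ρ d 2 = d 1 := rfl
    rw [e0, e1, e2]
    refine S.eq_of_b fun m z hz => ?_
    have h1 := osp_hom (hd'.1 2) (hp 2) (S.mul_even hx hy) z
    have h2 := tri_hom hd' (hp) hy z
    have h3 := osp_hom (hd'.1 0) (hp 0) hx (S.mul y z)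
    have h4 := congrArg (S.b x) h2
    simp only [map_add, map_smul, LinearMap.add_apply, LinearMap.smul_apply, smul_eq_mul,
      S.b_assoc] at h1 h4 ⊢
    rw [h1, h3, h4]
    have h11 : (1 : ZMod 2) + 1 = 0 := by decide
    rcases zmod2 p with rfl | rfl <;> rcases zmod2 j with rfl | rfl <;>
      rcases zmod2 l with rfl | rfl <;>
      simp only [mul_zero, mul_one, sgn_zero, sgn_one, h11, add_zero, zero_add] <;> ring
  have h := S.triSubmodule.add_mem (hρ 0) (hρ 1)
  rwa [← map_add, proj_add] at h

theorem rot_mem_tri' {d : Fin 3 → Module.End k C} (hd : d ∈ S.triSubmodule) (i : Fin 3) :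
    (fun a => d (a - i)) ∈ S.triSubmodule := by
  have h1 := rot_mem_tri hd
  have h2 := rot_mem_tri h1
  fin_cases i
  · simpa using hd
  · exact h1
  · convert h2 using 3 with a
    fin_cases a <;> rfl

variable (S) in
/-- The automorphism `θⁱ` of the triality Lie superalgebra, where
`θ(d₀, d₁, d₂) = (d₂, d₀, d₁)`; the indices are modulo `3`. -/
def theta (i : Fin 3) : S.tri.toSubmodule →ₗ[k] S.tri.toSubmodule :=
  (LinearMap.funLeft k (Module.End k C) fun a : Fin 3 => a - i).restrict
    fun _ hd => rot_mem_tri' hd i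

theorem theta_apply (i : Fin 3) (d : S.tri.toSubmodule) (a : Fin 3) :
    (S.theta i d : Fin 3 → Module.End k C) a = (d : Fin 3 → Module.End k C) (a - i) := rfl

variable (S) in
/-- `σ_{x,y}(z) = (-1)^{yz} b(x, z) y - (-1)^{x(y+z)} b(y, z) x`: the first summand is the
bilinear map `β` below and the second one is `(-1)^{xy} β(y, x)`. -/
def sigma : C →ₗ[k] C →ₗ[k] Module.End k C :=
  let β : C →ₗ[k] C →ₗ[k] Module.End k C :=
    LinearMap.mk₂ k (fun x y => superSwap (LinearMap.lsmul k C ∘ₗ S.b x) y)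
      (fun _ _ _ => by rw [map_add, LinearMap.comp_add, superSwap_add, LinearMap.add_apply])
      (fun _ _ _ => by rw [map_smul, LinearMap.comp_smul, superSwap_smul, LinearMap.smul_apply])
      (fun _ _ _ => by rw [map_add])
      (fun _ _ _ => by rw [map_smul])
  β - superSwap β

theorem sigma_apply {i j l : ZMod 2} {x y z : C} (hx : x ∈ part k C i) (hy : y ∈ part k C j)
    (hz : z ∈ part k C l) :
    S.sigma x y z = (sgn k (j * l) * S.b x z) • y - (sgn k (i * (j + l)) * S.b y z) • x := by
  simp only [sigma, LinearMap.sub_apply, superSwap_apply _ hx hy, LinearMap.mk₂_apply,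
    LinearMap.smul_apply, superSwap_apply _ hx hz, superSwap_apply _ hy hz, LinearMap.comp_apply,
    LinearMap.lsmul_apply]
  have h11 : (1 : ZMod 2) + 1 = 0 := by decide
  rcases zmod2 i with rfl | rfl <;> rcases zmod2 j with rfl | rfl <;>
    rcases zmod2 l with rfl | rfl <;>
    simp only [mul_zero, mul_one, sgn_zero, sgn_one, h11, add_zero, zero_add] <;> module

variable (S) in
/-- The triple `(σ_{x,y}, b(x,y)/2 - r_x l_y, b(x,y)/2 - l_x r_y)` with `l_x(y) = xy` and
`r_x(y) = (-1)^{xy} yx`. -/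
def tTriple : C →ₗ[k] C →ₗ[k] (Fin 3 → Module.End k C) :=
  let l : C →ₗ[k] Module.End k C := S.mul
  let r : C →ₗ[k] Module.End k C := superSwap S.mul
  LinearMap.mk₂ k
    (fun x y => ![S.sigma x y, (2⁻¹ * S.b x y) • 1 - r x * l y, (2⁻¹ * S.b x y) • 1 - l x * r y])
    (fun x x' y => by
      funext a; fin_cases a <;> ext <;> simp [mul_add] <;> module)
    (fun c x y => by
      funext a; fin_cases a <;> ext <;> simp [smul_sub, smul_smul, mul_left_comm])
    (fun x y y' => by
      funext a; fin_cases a <;> ext <;> simp [add_mul, mul_add] <;> module)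
    (fun c x y => by
      funext a; fin_cases a <;> ext <;> simp [smul_sub, smul_smul, mul_left_comm])

theorem tTriple_apply_one {i j l : ZMod 2} {x y z : C} (hx : x ∈ part k C i)
    (hy : y ∈ part k C j) (hz : z ∈ part k C l) :
    S.tTriple x y 1 z
      = (2⁻¹ * S.b x y) • z - sgn k (i * (j + l)) • S.mul (S.mul y z) x := by
  simp [tTriple, superSwap_apply _ hx (S.mul_even hy hz)]

theorem tTriple_apply_two {j l : ZMod 2} {x y z : C}
    (hy : y ∈ part k C j) (hz : z ∈ part k C l) :
    S.tTriple x y 2 z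
      = (2⁻¹ * S.b x y) • z - sgn k (j * l) • S.mul x (S.mul z y) := by
  simp [tTriple, superSwap_apply _ hy hz]

theorem tTriple_even (a : Fin 3) {i j : ZMod 2} {x y : C} (hx : x ∈ part k C i)
    (hy : y ∈ part k C j) : S.tTriple x y a ∈ part k (Module.End k C) (i + j) := by
  rw [mem_part_end]
  intro l z hz
  have h11 : (1 : ZMod 2) + 1 = 0 := by decide
  have hb : ∀ {i j l : ZMod 2} {x y z : C}, x ∈ part k C i → y ∈ part k C j → z ∈ part k C l →
      ∀ c : k, (c * S.b x y) • z ∈ part k C (i + j + l) := by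
    intro i j l x y z hx hy hz c
    by_cases h : i = j
    · subst h
      have h0 : i + i = 0 := by rcases zmod2 i with rfl | rfl <;> simp [h11]
      rw [h0, zero_add]
      exact Submodule.smul_mem _ _ hz
    · rw [S.b_even hx hy h, mul_zero, zero_smul]
      exact Submodule.zero_mem _
  fin_cases a
  · change S.sigma x y z ∈ _
    rw [sigma_apply hx hy hz]
    refine Submodule.sub_mem _ ?_ ?_
    · have h := hb hx hz hy (sgn k (j * l))
      rwa [add_right_comm] at h
    · have h := hb hy hz hx (sgn k (i * (j + l)))
      rwa [add_comm, ← add_assoc] at h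
  · change S.tTriple x y 1 z ∈ _
    rw [tTriple_apply_one hx hy hz]
    refine Submodule.sub_mem _ (hb hx hy hz _) (Submodule.smul_mem _ _ ?_)
    have h := S.mul_even (S.mul_even hy hz) hx
    rwa [add_comm, ← add_assoc] at h
  · change S.tTriple x y 2 z ∈ _
    rw [tTriple_apply_two hy hz]
    refine Submodule.sub_mem _ (hb hx hy hz _) (Submodule.smul_mem _ _ ?_)
    have h := S.mul_even hx (S.mul_even hz hy)
    rwa [add_comm l j, ← add_assoc] at h

set_option maxHeartbeats 2000000 in
theorem tTriple_mem [NeZero (2 : k)] (x y : C) : S.tTriple x y ∈ S.triSubmodule := by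
  have h2 : (2 : k) * 2⁻¹ = 1 := mul_inv_cancel₀ (NeZero.ne _)
  have h11 : (1 : ZMod 2) + 1 = 0 := by decide
  refine mem_of_hom S.tTriple S.triSubmodule x y fun i j => ?_
  have hx := proj_mem (k := k) i x
  have hy := proj_mem (k := k) j y
  generalize proj k i x = x at *
  generalize proj k j y = y at *
  have hbxy : i ≠ j → S.b x y = 0 := S.b_even hx hy
  have syx := S.b_symm hy hx
  refine mem_tri (p := i + j) (fun a => tTriple_even a hx hy) (fun a => ?_)
    fun l m z hz w hw => ?_
  · refine mem_osp (tTriple_even a hx hy) fun l m z hz w hw => ?_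
    fin_cases a
    · change S.b (S.sigma x y z) w + _ * S.b z (S.sigma x y w) = 0
      have s1 := S.b_symm hz hx
      have s2 := S.b_symm hz hy
      have e1 := S.b_even hx hz
      have e2 := S.b_even hy hz
      have e3 := S.b_even hx hw
      have e4 := S.b_even hy hw
      simp only [sigma_apply hx hy hz, sigma_apply hx hy hw, map_sub, map_smul,
        LinearMap.sub_apply, LinearMap.smul_apply, smul_eq_mul, s1, s2]
      rcases zmod2 i with rfl | rfl <;> rcases zmod2 j with rfl | rfl <;>
        rcases zmod2 l with rfl | rfl <;> rcases zmod2 m with rfl | rfl <;>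
        simp [sgn_zero, sgn_one, h11] at e1 e2 e3 e4 ⊢ <;>
        (try simp [*]) <;> ring
    · change S.b (S.tTriple x y 1 z) w + _ * S.b z (S.tTriple x y 1 w) = 0
      have c := S.b_comp hy hz hx hw
      have s1 := S.b_symm hz (S.mul_even (S.mul_even hy hw) hx)
      have s2 := S.b_symm (S.mul_even hy hw) (S.mul_even hx hz)
      have e1 := S.b_even (S.mul_even hx hz) (S.mul_even hy hw)
      have e2 := S.b_even (S.mul_even hy hz) (S.mul_even hx hw)
      rw [S.b_assoc, s2] at s1
      rw [syx] at c
      simp only [tTriple_apply_one hx hy hz, tTriple_apply_one hx hy hw, map_sub, map_smul,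
        LinearMap.sub_apply, LinearMap.smul_apply, smul_eq_mul, s1, S.b_assoc (S.mul y z)]
      clear s1 s2 syx
      generalize S.b x y = u at *
      generalize S.b z w = v at *
      generalize S.b (S.mul x z) (S.mul y w) = f at *
      generalize S.b (S.mul y z) (S.mul x w) = g at *
      have h2' : u * v * (2 * 2⁻¹ - 1) = 0 := by rw [h2]; ring
      rcases zmod2 i with rfl | rfl <;> rcases zmod2 j with rfl | rfl <;>
        rcases zmod2 l with rfl | rfl <;> rcases zmod2 m with rfl | rfl <;>
        simp only [h11, mul_zero, mul_one, add_zero, zero_add, sgn_zero, sgn_one, ne_eq,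
          not_true_eq_false, one_ne_zero, zero_ne_one, not_false_eq_true, false_imp_iff,
          true_imp_iff] at hbxy e1 e2 c ⊢ <;>
        grind
    · change S.b (S.tTriple x y 2 z) w + _ * S.b z (S.tTriple x y 2 w) = 0
      have c := S.b_comp hz hx hw hy
      have s1 := S.b_symm (S.mul_even hx (S.mul_even hz hy)) hw
      have s2 := S.b_symm (S.mul_even hw hx) (S.mul_even hz hy)
      have e1 := S.b_even (S.mul_even hz hx) (S.mul_even hw hy)
      have e2 := S.b_even (S.mul_even hz hy) (S.mul_even hw hx)
      rw [← S.b_assoc, s2] at s1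
      rw [s2] at c
      simp only [tTriple_apply_two hy hz, tTriple_apply_two hy hw, map_sub, map_smul,
        LinearMap.sub_apply, LinearMap.smul_apply, smul_eq_mul, s1, ← S.b_assoc z]
      clear s1 s2 syx
      generalize S.b x y = u at *
      generalize S.b z w = v at *
      generalize S.b (S.mul z x) (S.mul w y) = f at *
      generalize S.b (S.mul z y) (S.mul w x) = g at *
      have h2' : u * v * (2 * 2⁻¹ - 1) = 0 := by rw [h2]; ring
      rcases zmod2 i with rfl | rfl <;> rcases zmod2 j with rfl | rfl <;>
        rcases zmod2 l with rfl | rfl <;> rcases zmod2 m with rfl | rfl <;>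
        simp only [h11, mul_zero, mul_one, add_zero, zero_add, sgn_zero, sgn_one, ne_eq,
          not_true_eq_false, one_ne_zero, zero_ne_one, not_false_eq_true, false_imp_iff,
          true_imp_iff] at hbxy e1 e2 c ⊢ <;>
        grind
  · change S.sigma x y (S.mul z w) = S.mul (S.tTriple x y 1 z) w
      + _ • S.mul z (S.tTriple x y 2 w)
    rw [sigma_apply hx hy (S.mul_even hz hw), tTriple_apply_one hx hy hz,
      tTriple_apply_two hy hw]
    have c1 := congrArg (fun v => S.mul v w) (S.comp_left hy hz hx)
    have c2 := S.comp_left (S.mul_even hx hz) hy hw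
    have c3 := S.comp_right hz hx (S.mul_even hw hy)
    have e1 := S.b_even hx (S.mul_even hz hw)
    have e2 := S.b_even hy (S.mul_even hz hw)
    have s1 := S.b_symm (S.mul_even hz hw) hy
    rw [S.b_assoc x z w] at c2
    rw [← S.b_assoc z w y, s1] at c3
    simp only [map_add, map_sub, map_smul, LinearMap.add_apply, LinearMap.sub_apply,
      LinearMap.smul_apply, syx] at c1 ⊢
    clear s1 syx
    generalize S.b x y = u at *
    generalize S.b x (S.mul z w) = f at *
    generalize S.b y (S.mul z w) = g at *
    have hh : (2⁻¹ * u) • S.mul z w + (2⁻¹ * u) • S.mul z w = u • S.mul z w := by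
      rw [← add_smul]
      congr 1
      linear_combination u * h2
    rcases zmod2 i with rfl | rfl <;> rcases zmod2 j with rfl | rfl <;>
      rcases zmod2 l with rfl | rfl <;> rcases zmod2 m with rfl | rfl <;>
      simp only [h11, mul_zero, mul_one, add_zero, zero_add, sgn_zero, sgn_one, ne_eq,
        not_true_eq_false, one_ne_zero, zero_ne_one, not_false_eq_true, false_imp_iff,
        true_imp_iff] at hbxy e1 e2 c1 c2 c3 ⊢ <;>
      (try subst hbxy) <;> (try subst e1) <;> (try subst e2) <;>
      first
      | linear_combination (norm := module) c1 - c2 + c3 - hh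
      | linear_combination (norm := module) c1 - c2 - c3 - hh
      | linear_combination (norm := module) c1 + c2 + c3 - hh
      | linear_combination (norm := module) c1 + c2 - c3 - hh
      | linear_combination (norm := module) -c1 - c2 + c3 - hh
      | linear_combination (norm := module) -c1 - c2 - c3 - hh

variable (S) in
/-- The element `t_{x,y}` of the triality Lie superalgebra. -/
def tElem [NeZero (2 : k)] : C →ₗ[k] C →ₗ[k] S.tri.toSubmodule :=
  LinearMap.mk₂ k (fun x y => ⟨S.tTriple x y, tTriple_mem x y⟩)
    (fun _ _ _ => Subtype.ext (by simp)) (fun _ _ _ => Subtype.ext (by simp))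
    (fun _ _ _ => Subtype.ext (by simp)) (fun _ _ _ => Subtype.ext (by simp))

theorem mem_part_tri {p : ZMod 2} {d : S.tri.toSubmodule} :
    d ∈ part k S.tri.toSubmodule p ↔
      ∀ a, (d : Fin 3 → Module.End k C) a ∈ part k (Module.End k C) p := by
  refine (mem_part_sub S.tri.toSuperSubspace).trans ?_
  rw [mem_part]
  exact funext_iff

theorem theta_mem {p : ZMod 2} {d : S.tri.toSubmodule} (i : Fin 3)
    (hd : d ∈ part k S.tri.toSubmodule p) : S.theta i d ∈ part k S.tri.toSubmodule p := by
  rw [mem_part_tri] at hd ⊢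
  exact fun a => hd (a - i)

theorem tElem_even [NeZero (2 : k)] : IsEven S.tElem := fun _ _ _ _ hx hy =>
  mem_part_tri.2 fun a => tTriple_even a hx hy

end SymmetricCompositionSuperalgebra

end Composition

/-! The Lie superalgebra `g(S, S')` of two symmetric composition superalgebras. -/

section MagicSquare

variable {k : Type*} [Field k]

section Tensor

variable {V : Type*} [AddCommGroup V] [Module k V] [Superspace k V]
variable {V' : Type*} [AddCommGroup V'] [Module k V'] [Superspace k V']
variable {W : Type*} [AddCommGroup W] [Module k W] [Superspace k W]
variable {W' : Type*} [AddCommGroup W'] [Module k W'] [Superspace k W']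
variable {P : Type*} [AddCommGroup P] [Module k P]
variable {P' : Type*} [AddCommGroup P'] [Module k P']

theorem tmul_mem {i j : ZMod 2} {x : V} {y : W} (hx : x ∈ part k V i) (hy : y ∈ part k W j) :
    x ⊗ₜ[k] y ∈ part k (V ⊗[k] W) (i + j) := by
  have h : ∀ f : ZMod 2 → (V ⊗[k] W) →ₗ[k] (V ⊗[k] W), ∑ i, f i = f 0 + f 1 :=
    fun f => Fin.sum_univ_two f
  have h1 : (1 : ZMod 2) + 1 = 0 := by decide
  have h2 : (0 : ZMod 2) - 1 = 1 := by decide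
  rw [mem_part]
  change (∑ a : ZMod 2, TensorProduct.map (proj k a) (proj k (i + j - a))) (x ⊗ₜ[k] y) = _
  simp only [h, LinearMap.add_apply, TensorProduct.map_tmul, proj_of_mem hx, proj_of_mem hy]
  rcases zmod2 i with rfl | rfl <;> rcases zmod2 j with rfl | rfl <;> simp [h1, h2]

/-- The homogeneous components of `V ⊗ W` are spanned by the products of homogeneous elements. -/
theorem tensor_induction (N : Submodule k (V ⊗[k] W)) {l : ZMod 2}
    (h : ∀ i j, i + j = l → ∀ x ∈ part k V i, ∀ y ∈ part k W j, x ⊗ₜ[k] y ∈ N)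
    {u : V ⊗[k] W} (hu : u ∈ part k (V ⊗[k] W) l) : u ∈ N := by
  rw [mem_part] at hu
  rw [← hu]
  clear hu
  change (∑ a : ZMod 2, TensorProduct.map (proj k a) (proj k (l - a))) u ∈ N
  induction u with
  | zero => simp
  | add x y hx hy => rw [map_add]; exact N.add_mem hx hy
  | tmul x y =>
    rw [LinearMap.sum_apply]
    refine N.sum_mem fun a _ => ?_
    rw [TensorProduct.map_tmul]
    exact h _ _ (add_sub_cancel a l) _ (proj_mem _ _) _ (proj_mem _ _)

theorem isEven_of_tmul_right {U : Type*} [AddCommGroup U] [Module k U] [Superspace k U]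
    (β : P →ₗ[k] (V ⊗[k] W) →ₗ[k] U) (i : ZMod 2) (p : P)
    (h : ∀ a b, ∀ x ∈ part k V a, ∀ y ∈ part k W b, β p (x ⊗ₜ[k] y) ∈ part k U (i + (a + b)))
    {j : ZMod 2} {u : V ⊗[k] W} (hu : u ∈ part k (V ⊗[k] W) j) : β p u ∈ part k U (i + j) :=
  tensor_induction ((part k U (i + j)).comap (β p))
    (fun a b e x hx y hy => by subst e; exact h a b x hx y hy) hu

theorem isEven_of_tmul {U : Type*} [AddCommGroup U] [Module k U] [Superspace k U]
    (β : (V ⊗[k] V') →ₗ[k] (W ⊗[k] W') →ₗ[k] U)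
    (h : ∀ a a' c c', ∀ x ∈ part k V a, ∀ x' ∈ part k V' a', ∀ y ∈ part k W c,
      ∀ y' ∈ part k W' c',
      β (x ⊗ₜ[k] x') (y ⊗ₜ[k] y') ∈ part k U (a + a' + (c + c'))) : IsEven β := by
  intro i j u v hu hv
  refine tensor_induction ((part k U (i + j)).comap (β.flip v)) (fun a a' e x hx x' hx' => ?_) hu
  subst e
  exact isEven_of_tmul_right β _ _ (fun c c' y hy y' hy' => h a a' c c' x hx x' hx' y hy y' hy') hv

/-- For bilinear maps `f` and `g`, the bilinear map given on homogeneous elements by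
`(x ⊗ x', y ⊗ y') ↦ (-1)^{s(x, x', y, y')} f(x, y) ⊗ g(x', y')`, where `s` is a function of the
parities. -/
def signedTensor (s : ZMod 2 → ZMod 2 → ZMod 2 → ZMod 2 → ZMod 2)
    (f : V →ₗ[k] W →ₗ[k] P) (g : V' →ₗ[k] W' →ₗ[k] P') :
    (V ⊗[k] V') →ₗ[k] (W ⊗[k] W') →ₗ[k] (P ⊗[k] P') :=
  ∑ a : ZMod 2, ∑ a' : ZMod 2, ∑ c : ZMod 2, ∑ c' : ZMod 2, sgn k (s a a' c c') •
    TensorProduct.map₂ (f.compl₁₂ (proj k a) (proj k c)) (g.compl₁₂ (proj k a') (proj k c'))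

theorem signedTensor_apply (s : ZMod 2 → ZMod 2 → ZMod 2 → ZMod 2 → ZMod 2)
    (f : V →ₗ[k] W →ₗ[k] P) (g : V' →ₗ[k] W' →ₗ[k] P') {a a' c c' : ZMod 2}
    {x : V} {x' : V'} {y : W} {y' : W'} (hx : x ∈ part k V a) (hx' : x' ∈ part k V' a')
    (hy : y ∈ part k W c) (hy' : y' ∈ part k W' c') :
    signedTensor s f g (x ⊗ₜ x') (y ⊗ₜ y') = sgn k (s a a' c c') • (f x y ⊗ₜ[k] g x' y') := by
  simp only [signedTensor, LinearMap.sum_apply, LinearMap.smul_apply,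
    TensorProduct.map₂_apply_tmul, TensorProduct.map_tmul, LinearMap.compl₁₂_apply,
    proj_of_mem hx, proj_of_mem hx', proj_of_mem hy, proj_of_mem hy']
  rw [Finset.sum_eq_single a, Finset.sum_eq_single a', Finset.sum_eq_single c,
    Finset.sum_eq_single c']
  · simp
  all_goals first
    | (intro b _ hb; simp [hb])
    | simp

end Tensor

variable {C : Type*} [AddCommGroup C] [Module k C] [Superspace k C]
variable {C' : Type*} [AddCommGroup C'] [Module k C'] [Superspace k C']
variable (S : SymmetricCompositionSuperalgebra k C) (S' : SymmetricCompositionSuperalgebra k C')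

/-- `[(d₀, d₁, d₂), ιᵢ(x ⊗ x')] = ιᵢ(dᵢ(x) ⊗ x')` -/
def leftAct (i : Fin 3) : S.tri.toSubmodule →ₗ[k] (C ⊗[k] C') →ₗ[k] (C ⊗[k] C') :=
  LinearMap.rTensorHom C' ∘ₗ LinearMap.proj i ∘ₗ S.tri.toSubmodule.subtype

/-- `[(d'₀, d'₁, d'₂), ιᵢ(x ⊗ x')] = (-1)^{d'x} ιᵢ(x ⊗ d'ᵢ(x'))` -/
def rightAct (i : Fin 3) : S'.tri.toSubmodule →ₗ[k] (C ⊗[k] C') →ₗ[k] (C ⊗[k] C') :=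
  ∑ a : ZMod 2, ∑ p : ZMod 2, sgn k (p * a) •
    (TensorProduct.mapBilinear (.id k) C C' C C' (proj k a) ∘ₗ proj k p ∘ₗ LinearMap.proj i ∘ₗ
      S'.tri.toSubmodule.subtype)

theorem rightAct_apply (i : Fin 3) {p a : ZMod 2} {d : S'.tri.toSubmodule}
    (hd : d ∈ part k S'.tri.toSubmodule p) {x : C} (hx : x ∈ part k C a) (x' : C') :
    rightAct S' i d (x ⊗ₜ x')
      = sgn k (p * a) • (x ⊗ₜ[k] (d : Fin 3 → Module.End k C') i x') := by
  have hd' := SymmetricCompositionSuperalgebra.mem_part_tri.1 hd i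
  simp only [rightAct, LinearMap.sum_apply, LinearMap.smul_apply, LinearMap.comp_apply,
    Submodule.subtype_apply, LinearMap.proj_apply, proj_of_mem hd',
    TensorProduct.mapBilinear_apply, TensorProduct.map_tmul, proj_of_mem hx]
  rw [Finset.sum_eq_single a, Finset.sum_eq_single p]
  · simp
  all_goals first
    | (intro b _ hb; simp [hb])
    | simp

/-- `[ιᵢ(x ⊗ x'), ιᵢ₊₁(y ⊗ y')] = (-1)^{x'y} ιᵢ₊₂(xy ⊗ x'y')` -/
def tensorMul : (C ⊗[k] C') →ₗ[k] (C ⊗[k] C') →ₗ[k] (C ⊗[k] C') :=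
  signedTensor (fun _ a' c _ => a' * c) S.mul S'.mul

/-- The component in `tri(S)` of `[ιᵢ(x ⊗ x'), ιᵢ(y ⊗ y')]`, that is,
`(-1)^{xx' + xy' + yy'} b'(x', y') θⁱ(t_{x,y})`. -/
def toTri [NeZero (2 : k)] (i : Fin 3) :
    (C ⊗[k] C') →ₗ[k] (C ⊗[k] C') →ₗ[k] S.tri.toSubmodule :=
  (signedTensor (fun a a' c c' => a * a' + a * c' + c * c')
    (S.tElem.compr₂ (S.theta i)) S'.b).compr₂ (TensorProduct.rid k S.tri.toSubmodule).toLinearMap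

/-- The component in `tri(S')` of `[ιᵢ(x ⊗ x'), ιᵢ(y ⊗ y')]`, that is,
`(-1)^{yx'} b(x, y) θ'ⁱ(t'_{x',y'})`. -/
def toTri' [NeZero (2 : k)] (i : Fin 3) :
    (C ⊗[k] C') →ₗ[k] (C ⊗[k] C') →ₗ[k] S'.tri.toSubmodule :=
  (signedTensor (fun _ a' c _ => c * a')
    S.b (S'.tElem.compr₂ (S'.theta i))).compr₂ (TensorProduct.lid k S'.tri.toSubmodule).toLinearMap

theorem leftAct_even (i : Fin 3) : IsEven (leftAct (C' := C') S i) := by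
  intro p q d u hd hu
  refine isEven_of_tmul_right _ p d (fun a a' x hx x' hx' => ?_) hu
  change (d : Fin 3 → Module.End k C) i x ⊗ₜ[k] x' ∈ _
  rw [← add_assoc]
  have hd' := SymmetricCompositionSuperalgebra.mem_part_tri.1 hd i
  exact tmul_mem (mem_part_end.1 hd' a x hx) hx'

theorem rightAct_even (i : Fin 3) : IsEven (rightAct (C := C) S' i) := by
  intro p q d u hd hu
  refine isEven_of_tmul_right _ p d (fun a a' x hx x' hx' => ?_) hu
  rw [rightAct_apply S' i hd hx, add_left_comm]
  have hd' := SymmetricCompositionSuperalgebra.mem_part_tri.1 hd i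
  exact Submodule.smul_mem _ _ (tmul_mem hx (mem_part_end.1 hd' a' x' hx'))

theorem tensorMul_even : IsEven (tensorMul S S') := by
  refine isEven_of_tmul _ fun a a' c c' x hx x' hx' y hy y' hy' => ?_
  rw [tensorMul, signedTensor_apply _ _ _ hx hx' hy hy', add_add_add_comm]
  exact Submodule.smul_mem _ _ (tmul_mem (S.mul_even hx hy) (S'.mul_even hx' hy'))

theorem toTri_even [NeZero (2 : k)] (i : Fin 3) : IsEven (toTri S S' i) := by
  refine isEven_of_tmul _ fun a a' c c' x hx x' hx' y hy y' hy' => ?_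
  rw [toTri, LinearMap.compr₂_apply, signedTensor_apply _ _ _ hx hx' hy hy', map_smul]
  refine Submodule.smul_mem _ _ ?_
  change S'.b x' y' • S.theta i (S.tElem x y) ∈ _
  by_cases h : a' = c'
  · subst h
    have h0 : a' + a' = 0 := by rcases zmod2 a' with rfl | rfl <;> decide
    rw [add_add_add_comm, h0, add_zero]
    exact Submodule.smul_mem _ _
      (S.theta_mem i (SymmetricCompositionSuperalgebra.tElem_even hx hy))
  · rw [S'.b_even hx' hy' h, zero_smul]
    exact Submodule.zero_mem _

theorem toTri'_even [NeZero (2 : k)] (i : Fin 3) : IsEven (toTri' S S' i) := by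
  refine isEven_of_tmul _ fun a a' c c' x hx x' hx' y hy y' hy' => ?_
  rw [toTri', LinearMap.compr₂_apply, signedTensor_apply _ _ _ hx hx' hy hy', map_smul]
  refine Submodule.smul_mem _ _ ?_
  change S.b x y • S'.theta i (S'.tElem x' y') ∈ _
  by_cases h : a = c
  · subst h
    have h0 : a + a = 0 := by rcases zmod2 a with rfl | rfl <;> decide
    rw [add_add_add_comm, h0, zero_add]
    exact Submodule.smul_mem _ _
      (S'.theta_mem i (SymmetricCompositionSuperalgebra.tElem_even hx' hy'))
  · rw [S.b_even hx hy h, zero_smul]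
    exact Submodule.zero_mem _

/-- The superspace `(tri(S) ⊕ tri(S')) ⊕ (ι₀(S ⊗ S') ⊕ ι₁(S ⊗ S') ⊕ ι₂(S ⊗ S'))`; the second
component of an element is the triple of its coordinates in the three copies of `S ⊗ S'`. -/
abbrev MagicSpace : Type _ :=
  (S.tri.toSubmodule × S'.tri.toSubmodule) × (Fin 3 → C ⊗[k] C')

/-- The superalgebra `g(S, S')`. The brackets `[ιᵢ(x ⊗ x'), d]` and
`[ιᵢ₊₁(x ⊗ x'), ιᵢ(y ⊗ y')]` are determined by superanticommutativity (the terms with `superSwap`).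
Indices are modulo `3`. -/
def magic [NeZero (2 : k)] : Superalgebra k (MagicSpace S S') where
  mul := LinearMap.mk₂ k (fun X Y =>
      ((S.tri.alg.mul X.1.1 Y.1.1 + ∑ i, toTri S S' i (X.2 i) (Y.2 i),
        S'.tri.alg.mul X.1.2 Y.1.2 + ∑ i, toTri' S S' i (X.2 i) (Y.2 i)),
      fun i =>
        leftAct S i X.1.1 (Y.2 i) + rightAct S' i X.1.2 (Y.2 i)
        - superSwap (leftAct S i) (X.2 i) Y.1.1 - superSwap (rightAct S' i) (X.2 i) Y.1.2
        + tensorMul S S' (X.2 (i + 1)) (Y.2 (i + 2))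
        - superSwap (tensorMul S S') (X.2 (i + 2)) (Y.2 (i + 1))))
    (fun X X' Y => by
      refine Prod.ext (Prod.ext ?_ ?_) (funext fun i => ?_) <;>
        simp only [Prod.fst_add, Prod.snd_add, Pi.add_apply, map_add, LinearMap.add_apply,
          Finset.sum_add_distrib] <;> abel)
    (fun c X Y => by
      refine Prod.ext (Prod.ext ?_ ?_) (funext fun i => ?_) <;>
        simp only [Prod.smul_fst, Prod.smul_snd, Pi.smul_apply, map_smul, LinearMap.smul_apply,
          ← Finset.smul_sum, smul_add, smul_sub])
    (fun X Y Y' => by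
      refine Prod.ext (Prod.ext ?_ ?_) (funext fun i => ?_) <;>
        simp only [Prod.fst_add, Prod.snd_add, Pi.add_apply, map_add,
          Finset.sum_add_distrib] <;> abel)
    (fun c X Y => by
      refine Prod.ext (Prod.ext ?_ ?_) (funext fun i => ?_) <;>
        simp only [Prod.smul_fst, Prod.smul_snd, Pi.smul_apply, map_smul,
          ← Finset.smul_sum, smul_add, smul_sub])
  mul_even := by
    intro p q X Y hX hY
    have hX1 : X.1.1 ∈ part k _ p := congrArg (fun Z : MagicSpace S S' => Z.1.1) hX
    have hX2 : X.1.2 ∈ part k _ p := congrArg (fun Z : MagicSpace S S' => Z.1.2) hX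
    have hX3 : ∀ i, X.2 i ∈ part k _ p := fun i => congrArg (fun Z : MagicSpace S S' => Z.2 i) hX
    have hY1 : Y.1.1 ∈ part k _ q := congrArg (fun Z : MagicSpace S S' => Z.1.1) hY
    have hY2 : Y.1.2 ∈ part k _ q := congrArg (fun Z : MagicSpace S S' => Z.1.2) hY
    have hY3 : ∀ i, Y.2 i ∈ part k _ q := fun i => congrArg (fun Z : MagicSpace S S' => Z.2 i) hY
    refine Prod.ext (Prod.ext ?_ ?_) (funext fun i => ?_)
    · exact Submodule.add_mem _ (S.tri.alg.mul_even hX1 hY1)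
        (Submodule.sum_mem _ fun i _ => toTri_even S S' i (hX3 i) (hY3 i))
    · exact Submodule.add_mem _ (S'.tri.alg.mul_even hX2 hY2)
        (Submodule.sum_mem _ fun i _ => toTri'_even S S' i (hX3 i) (hY3 i))
    · exact Submodule.sub_mem _ (Submodule.add_mem _ (Submodule.sub_mem _ (Submodule.sub_mem _
        (Submodule.add_mem _ (leftAct_even S i hX1 (hY3 i)) (rightAct_even S' i hX2 (hY3 i)))
        ((leftAct_even S i).superSwap (hX3 i) hY1)) ((rightAct_even S' i).superSwap (hX3 i) hY2))
        (tensorMul_even S S' (hX3 _) (hY3 _)))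
        ((tensorMul_even S S').superSwap (hX3 _) (hY3 _))

end MagicSquare

/-! Hermitian `3 × 3` matrices over a Hurwitz superalgebra. -/

section Hermitian

variable {k : Type*} [Field k]
variable {C : Type*} [AddCommGroup C] [Module k C] [Superspace k C]

namespace HurwitzSuperalgebra

variable (A : HurwitzSuperalgebra k C)

/-- The usual product of `3 × 3` matrices over `C`. -/
def matMul : Matrix (Fin 3) (Fin 3) C →ₗ[k] Matrix (Fin 3) (Fin 3) C →ₗ[k]
    Matrix (Fin 3) (Fin 3) C :=
  LinearMap.mk₂ k (fun X Y => Matrix.of fun i j => ∑ l, A.mul (X i l) (Y l j))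
    (fun _ _ _ => by ext; simp [Finset.sum_add_distrib])
    (fun _ _ _ => by ext; simp [Finset.smul_sum])
    (fun _ _ _ => by ext; simp [Finset.sum_add_distrib])
    (fun _ _ _ => by ext; simp [Finset.smul_sum])

theorem matMul_apply (X Y : Matrix (Fin 3) (Fin 3) C) (i j : Fin 3) :
    A.matMul X Y i j = ∑ l, A.mul (X i l) (Y l j) := rfl

theorem matMul_even : IsEven A.matMul := by
  intro p q X Y hX hY
  refine Matrix.ext fun i j => ?_
  have h : A.matMul X Y i j ∈ part k C (p + q) := by
    rw [matMul_apply]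
    exact Submodule.sum_mem _ fun l _ => A.mul_even (congrFun (congrFun hX i) l)
      (congrFun (congrFun hY l) j)
  exact h

/-- The superalgebra of `3 × 3` matrices over `C` with the symmetrized product
`X ∘ Y = (XY + (-1)^{XY} YX) / 2`. -/
def matJordan : Superalgebra k (Matrix (Fin 3) (Fin 3) C) where
  mul := (2⁻¹ : k) • (A.matMul + superSwap A.matMul)
  mul_even := (A.matMul_even.add A.matMul_even.superSwap).smul _

/-- The matrices fixed by the superinvolution `(a_{ij})* = (conj a_{ji})`. -/
def hermitian : Submodule k (Matrix (Fin 3) (Fin 3) C) where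
  carrier := {X | ∀ i j, A.conj (X j i) = X i j}
  zero_mem' := by simp
  add_mem' := by
    intro X Y hX hY i j
    simp [hX i j, hY i j]
  smul_mem' := by
    intro c X hX i j
    simp [hX i j]

theorem conj_proj (i : ZMod 2) (x : C) : A.conj (proj k i x) = proj k i (A.conj x) := by
  conv_rhs => rw [← proj_add (k := k) x]
  rw [map_add, map_add, proj_of_mem (A.conj_mem (proj_mem 0 x)),
    proj_of_mem (A.conj_mem (proj_mem 1 x))]
  rcases zmod2 i with rfl | rfl <;> simp

/-- The Jordan superalgebra `H₃(C)` of hermitian `3 × 3` matrices over a Hurwitz superalgebra. -/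
def H3 : A.matJordan.Sub where
  toSubmodule := A.hermitian
  proj_mem' := by
    intro p X hX i j
    change A.conj (proj k p (X j i)) = proj k p (X i j)
    rw [conj_proj, hX i j]
  mul_mem' := by
    intro X Y hX hY
    refine mem_of_hom A.matJordan.mul A.hermitian X Y fun p q => ?_
    have hX' : ∀ i j, A.conj (proj k p X j i) = proj k p X i j := fun i j =>
      (A.conj_proj p (X j i)).trans (congrArg _ (hX i j))
    have hY' : ∀ i j, A.conj (proj k q Y j i) = proj k q Y i j := fun i j =>
      (A.conj_proj q (Y j i)).trans (congrArg _ (hY i j))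
    have hXp := proj_mem (k := k) p X
    have hYq := proj_mem (k := k) q Y
    generalize proj k p X = X at *
    generalize proj k q Y = Y at *
    have hXij : ∀ i j, X i j ∈ part k C p := fun i j => congrFun (congrFun hXp i) j
    have hYij : ∀ i j, Y i j ∈ part k C q := fun i j => congrFun (congrFun hYq i) j
    have hs : sgn k (p * q) * sgn k (p * q) = 1 := by
      rcases zmod2 p with rfl | rfl <;> rcases zmod2 q with rfl | rfl <;> simp [sgn]
    have h1 : ∀ i j, A.conj (A.matMul X Y j i) = sgn k (p * q) • A.matMul Y X i j := by
      intro i j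
      simp only [matMul_apply, map_sum, Finset.smul_sum]
      refine Finset.sum_congr rfl fun l _ => ?_
      rw [A.conj_mul (hXij _ _) (hYij _ _), hX', hY']
    have h2 : ∀ i j, A.conj (A.matMul Y X j i) = sgn k (p * q) • A.matMul X Y i j := by
      intro i j
      simp only [matMul_apply, map_sum, Finset.smul_sum]
      refine Finset.sum_congr rfl fun l _ => ?_
      rw [A.conj_mul (hYij _ _) (hXij _ _), hX', hY', mul_comm]
    intro i j
    simp only [matJordan, LinearMap.smul_apply, LinearMap.add_apply, Matrix.smul_apply,
      Matrix.add_apply, superSwap_apply _ hXp hYq, map_smul, map_add, h1, h2, smul_smul, hs,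
      one_smul]
    rw [add_comm]

end HurwitzSuperalgebra

end Hermitian

/-! The split two-dimensional Hurwitz algebra and the Hurwitz superalgebras `B(1,2)`
and `B(4,2)`. -/

section Examples

variable {k : Type*} [Field k]

theorem two_eq_neg_one [CharP k 3] : (2 : k) = -1 := by
  have h3 : ((3 : ℕ) : k) = 0 := CharP.cast_eq_zero k 3
  push_cast at h3
  linear_combination h3

instance [CharP k 3] : NeZero (2 : k) where
  out := by simp [two_eq_neg_one]

/-- `k × k` with the componentwise product and the norm `q(α, β) = αβ`, so that
`b((α, β), (γ, δ)) = αδ + βγ`, as a superalgebra with zero odd part. -/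
def splitK (k : Type*) [Field k] : HurwitzSuperalgebra k (EvenOdd (k × k) Unit) where
  mul := LinearMap.mk₂ k (fun x y => ⟨x.even * y.even, 0⟩)
    (fun _ _ _ => by ext <;> simp [add_mul]) (fun _ _ _ => by ext <;> simp)
    (fun _ _ _ => by ext <;> simp [mul_add]) (fun _ _ _ => by ext <;> simp)
  mul_even := by
    intro i j x y hx hy
    have h11 : (1 : ZMod 2) + 1 = 0 := by decide
    obtain ⟨rfl, a, rfl⟩ | ⟨rfl, a, rfl⟩ := EvenOdd.hom_cases hx <;>
      obtain ⟨rfl, c, rfl⟩ | ⟨rfl, c, rfl⟩ := EvenOdd.hom_cases hy <;>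
      simp [EvenOdd.mem_zero, EvenOdd.mem_one, h11]
  b := LinearMap.mk₂ k (fun x y => x.even.1 * y.even.2 + x.even.2 * y.even.1)
    (fun _ _ _ => by simp; ring) (fun _ _ _ => by simp; ring)
    (fun _ _ _ => by simp; ring) (fun _ _ _ => by simp; ring)
  b_even := by
    intro i j x y hx hy hij
    obtain ⟨rfl, a, rfl⟩ | ⟨rfl, a, rfl⟩ := EvenOdd.hom_cases hx <;>
      obtain ⟨rfl, c, rfl⟩ | ⟨rfl, c, rfl⟩ := EvenOdd.hom_cases hy <;> simp at hij ⊢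
  b_symm := by
    intro i j x y hx hy
    obtain ⟨rfl, a, rfl⟩ | ⟨rfl, a, rfl⟩ := EvenOdd.hom_cases hx <;>
      obtain ⟨rfl, c, rfl⟩ | ⟨rfl, c, rfl⟩ := EvenOdd.hom_cases hy <;> simp [sgn_zero] <;> ring
  b_nondeg := by
    intro x h
    have h1 := h ⟨(0, 1), 0⟩
    have h2 := h ⟨(1, 0), 0⟩
    simp at h1 h2
    ext <;> simp [h1, h2]
  b_comp := by
    intro i j l m x y z t hx hy hz ht
    obtain ⟨rfl, x, rfl⟩ | ⟨rfl, x, rfl⟩ := EvenOdd.hom_cases hx <;>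
    obtain ⟨rfl, y, rfl⟩ | ⟨rfl, y, rfl⟩ := EvenOdd.hom_cases hy <;>
    obtain ⟨rfl, z, rfl⟩ | ⟨rfl, z, rfl⟩ := EvenOdd.hom_cases hz <;>
    simp [sgn_zero]
    ring
  one := ⟨1, 0⟩
  one_mem := rfl
  one_mul' := fun x => by ext <;> simp
  mul_one' := fun x => by ext <;> simp

section Symplectic

variable {V : Type*} [AddCommGroup V] [Module k V]

/-- Coordinates on a two-dimensional space with a nonzero alternating form. -/
theorem exists_coord {ω : LinearMap.BilinForm k V} (hV : Module.finrank k V = 2)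
    (hω : ω.IsAlt) (hω0 : ω ≠ 0) :
    ∃ (e : Module.Basis (Fin 2) k V) (c : k), c ≠ 0 ∧
      (∀ u v, ω u v = c * (e.repr u 0 * e.repr v 1 - e.repr u 1 * e.repr v 0)) := by
  have : Module.Finite k V := Module.finite_of_finrank_eq_succ hV
  let e : Module.Basis (Fin 2) k V := Module.finBasisOfFinrankEq k V hV
  have key : ∀ u v, ω u v = ω (e 0) (e 1) * (e.repr u 0 * e.repr v 1 - e.repr u 1 * e.repr v 0) := by
    intro u v
    have h10 : ω (e 1) (e 0) = -ω (e 0) (e 1) := by rw [hω.neg_eq]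
    conv_lhs => rw [← e.sum_repr u, ← e.sum_repr v]
    simp only [Fin.sum_univ_two, map_add, map_smul, LinearMap.add_apply, LinearMap.smul_apply,
      smul_eq_mul, hω.self_eq_zero, h10]
    ring
  refine ⟨e, ω (e 0) (e 1), fun h => hω0 ?_, key⟩
  ext u v
  rw [key, h, zero_mul]
  rfl

theorem form_nondeg {ω : LinearMap.BilinForm k V} (hV : Module.finrank k V = 2)
    (hω : ω.IsAlt) (hω0 : ω ≠ 0) (u : V) (h : ∀ v, ω u v = 0) : u = 0 := by
  obtain ⟨e, c, hc, he⟩ := exists_coord hV hω hω0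
  have h0 := h (e 0)
  have h1 := h (e 1)
  rw [he] at h0 h1
  simp [hc] at h0 h1
  refine e.ext_elem fun i => ?_
  fin_cases i <;> simp [h0, h1]

/-- The product of `B(1,2)`: the unit is `1` and `uv = ω(u, v) 1` for `u, v ∈ V`. -/
def b12Mul (ω : LinearMap.BilinForm k V) : EvenOdd k V →ₗ[k] EvenOdd k V →ₗ[k] EvenOdd k V :=
  LinearMap.mk₂ k
    (fun x y => ⟨x.even * y.even + ω x.odd y.odd, x.even • y.odd + y.even • x.odd⟩)
    (fun _ _ _ => by ext <;> simp <;> [ring; module])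
    (fun _ _ _ => by ext <;> simp <;> [ring; module])
    (fun _ _ _ => by ext <;> simp <;> [ring; module])
    (fun _ _ _ => by ext <;> simp <;> [ring; module])

theorem b12Mul_apply (ω : LinearMap.BilinForm k V) (x y : EvenOdd k V) :
    b12Mul ω x y = ⟨x.even * y.even + ω x.odd y.odd, x.even • y.odd + y.even • x.odd⟩ := rfl

/-- The bilinear form of `B(1,2)`: `q(1) = 1`, so that `b(1, 1) = 2`, and `b(u, v) = ω(u, v)`. -/
def b12Form (ω : LinearMap.BilinForm k V) : EvenOdd k V →ₗ[k] EvenOdd k V →ₗ[k] k :=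
  LinearMap.mk₂ k (fun x y => 2 * (x.even * y.even) + ω x.odd y.odd)
    (fun _ _ _ => by simp; ring) (fun _ _ _ => by simp; ring)
    (fun _ _ _ => by simp; ring) (fun _ _ _ => by simp; ring)

theorem b12Form_apply (ω : LinearMap.BilinForm k V) (x y : EvenOdd k V) :
    b12Form ω x y = 2 * (x.even * y.even) + ω x.odd y.odd := rfl

theorem b12_comp [CharP k 3] {ω : LinearMap.BilinForm k V} (hV : Module.finrank k V = 2)
    (hω : ω.IsAlt) (hω0 : ω ≠ 0) {i j l m : ZMod 2} {x y z t : EvenOdd k V}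
    (hx : x ∈ part k (EvenOdd k V) i) (hy : y ∈ part k (EvenOdd k V) j)
    (hz : z ∈ part k (EvenOdd k V) l) (ht : t ∈ part k (EvenOdd k V) m) :
    b12Form ω (b12Mul ω x y) (b12Mul ω z t)
      + sgn k (i * j + i * l + j * l) * b12Form ω (b12Mul ω z y) (b12Mul ω x t)
      = sgn k (j * l) * (b12Form ω x z * b12Form ω y t) := by
  have h11 : (1 : ZMod 2) + 1 = 0 := by decide
  have h2 := two_eq_neg_one (k := k)
  obtain ⟨e, c, hc, he⟩ := exists_coord hV hω hω0
  refine EvenOdd.hom_ind (fun x => ?_) (fun x => ?_) i x hx <;>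
  refine EvenOdd.hom_ind (fun y => ?_) (fun y => ?_) j y hy <;>
  refine EvenOdd.hom_ind (fun z => ?_) (fun z => ?_) l z hz <;>
  refine EvenOdd.hom_ind (fun t => ?_) (fun t => ?_) m t ht <;>
  simp only [b12Mul_apply, b12Form_apply, map_smul, LinearMap.smul_apply, smul_eq_mul, mul_zero,
    zero_mul, mul_one, add_zero, zero_add, smul_zero, zero_smul, map_zero, LinearMap.zero_apply,
    sgn_zero, sgn_one, h11] <;>
  (try simp only [he]) <;> first | ring1 | (simp only [h2]; ring1)

/-- The Hurwitz superalgebra `B(1,2) = k1 ⊕ V` (even part `k1`, odd part `V`) of a two-dimensional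
space `V` with a nonzero alternating form `ω`, in characteristic `3`. -/
def B12 [CharP k 3] (ω : LinearMap.BilinForm k V) (hV : Module.finrank k V = 2)
    (hω : ω.IsAlt) (hω0 : ω ≠ 0) : HurwitzSuperalgebra k (EvenOdd k V) where
  mul := b12Mul ω
  mul_even := by
    intro i j x y hx hy
    have h11 : (1 : ZMod 2) + 1 = 0 := by decide
    obtain ⟨rfl, a, rfl⟩ | ⟨rfl, a, rfl⟩ := EvenOdd.hom_cases hx <;>
      obtain ⟨rfl, c, rfl⟩ | ⟨rfl, c, rfl⟩ := EvenOdd.hom_cases hy <;>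
      simp [EvenOdd.mem_zero, EvenOdd.mem_one, h11, b12Mul_apply]
  b := b12Form ω
  b_even := by
    intro i j x y hx hy hij
    obtain ⟨rfl, a, rfl⟩ | ⟨rfl, a, rfl⟩ := EvenOdd.hom_cases hx <;>
      obtain ⟨rfl, c, rfl⟩ | ⟨rfl, c, rfl⟩ := EvenOdd.hom_cases hy <;>
      simp [b12Form_apply] at hij ⊢
  b_symm := by
    intro i j x y hx hy
    obtain ⟨rfl, a, rfl⟩ | ⟨rfl, a, rfl⟩ := EvenOdd.hom_cases hx <;>
      obtain ⟨rfl, c, rfl⟩ | ⟨rfl, c, rfl⟩ := EvenOdd.hom_cases hy <;>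
      simp [sgn_zero, sgn_one, mul_comm, hω.neg_eq, b12Form_apply]
  b_nondeg := by
    intro x h
    have h1 := h ⟨1, 0⟩
    have h2 := fun v => h ⟨0, v⟩
    simp [NeZero.ne, b12Form_apply] at h1 h2
    ext
    · exact h1
    · exact form_nondeg hV hω hω0 _ h2
  b_comp := b12_comp hV hω hω0
  one := ⟨1, 0⟩
  one_mem := rfl
  one_mul' := fun x => by ext <;> simp [b12Mul_apply]
  mul_one' := fun x => by ext <;> simp [b12Mul_apply]

/-- The symplectic involution `f ↦ tr(f) - f` of `End(V)`, for a two-dimensional space `V`. -/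
def sympConj : Module.End k V →ₗ[k] Module.End k V :=
  (LinearMap.trace k V).smulRight 1 - LinearMap.id

theorem sympConj_apply (f : Module.End k V) :
    sympConj f = LinearMap.trace k V f • (1 : Module.End k V) - f := rfl

/-- `[f u]ᵢ = ∑ⱼ fᵢⱼ uⱼ` in coordinates. -/
theorem repr_apply (e : Module.Basis (Fin 2) k V) (f : Module.End k V) (u : V) (i : Fin 2) :
    e.repr (f u) i = LinearMap.toMatrix e e f i 0 * e.repr u 0
      + LinearMap.toMatrix e e f i 1 * e.repr u 1 := by
  rw [← LinearMap.toMatrix_mulVec_repr e e f u]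
  simp [Matrix.mulVec, dotProduct, Fin.sum_univ_two]

theorem trace_coord (e : Module.Basis (Fin 2) k V) (f : Module.End k V) :
    LinearMap.trace k V f = LinearMap.toMatrix e e f 0 0 + LinearMap.toMatrix e e f 1 1 := by
  rw [LinearMap.trace_eq_matrix_trace k e f, Matrix.trace_fin_two]

/-- `f ↦ tr(f) - f` is the adjoint with respect to any alternating form. -/
theorem form_sympConj {ω : LinearMap.BilinForm k V} (hV : Module.finrank k V = 2)
    (hω : ω.IsAlt) (hω0 : ω ≠ 0) (f : Module.End k V) (u v : V) :
    ω (f u) v = ω u (sympConj f v) := by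
  obtain ⟨e, c, hc, he⟩ := exists_coord hV hω hω0
  simp only [sympConj_apply, he, LinearMap.sub_apply, LinearMap.smul_apply, Module.End.one_apply,
    map_sub, map_smul, Finsupp.sub_apply, Finsupp.smul_apply, smul_eq_mul, repr_apply,
    trace_coord e]
  ring

/-- The endomorphism `w ↦ ω(w, u) v`. -/
def rankOne (ω : LinearMap.BilinForm k V) : V →ₗ[k] V →ₗ[k] Module.End k V :=
  LinearMap.smulRightₗ ∘ₗ ω.flip

theorem rankOne_apply (ω : LinearMap.BilinForm k V) (u v w : V) :
    rankOne ω u v w = ω w u • v := rfl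

/-- The product of `B(4,2)`: composition on `End(V)`, and `v f = f(v) = (conj f) v`,
`u v = ω(·, u) v`, where `conj f` is the symplectic involution. -/
def b42Mul (ω : LinearMap.BilinForm k V) :
    EvenOdd (Module.End k V) V →ₗ[k] EvenOdd (Module.End k V) V →ₗ[k]
      EvenOdd (Module.End k V) V :=
  LinearMap.mk₂ k
    (fun x y => ⟨x.even * y.even + rankOne ω x.odd y.odd, sympConj x.even y.odd + y.even x.odd⟩)
    (fun _ _ _ => by ext <;> simp [add_mul] <;> module)
    (fun _ _ _ => by ext <;> simp)
    (fun _ _ _ => by ext <;> simp [mul_add] <;> module)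
    (fun _ _ _ => by ext <;> simp)

theorem b42Mul_apply (ω : LinearMap.BilinForm k V) (x y : EvenOdd (Module.End k V) V) :
    b42Mul ω x y = ⟨x.even * y.even + rankOne ω x.odd y.odd,
      sympConj x.even y.odd + y.even x.odd⟩ := rfl

/-- The bilinear form of `B(4,2)`: the polar form of `q = det` on `End(V)`, which is
`b(f, g) = tr(f (conj g))`, and `b(u, v) = ω(u, v)`. -/
def b42Form (ω : LinearMap.BilinForm k V) :
    EvenOdd (Module.End k V) V →ₗ[k] EvenOdd (Module.End k V) V →ₗ[k] k :=
  LinearMap.mk₂ k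
    (fun x y => LinearMap.trace k V (x.even * sympConj y.even) + ω x.odd y.odd)
    (fun _ _ _ => by simp [add_mul]; ring) (fun _ _ _ => by simp [mul_add])
    (fun _ _ _ => by simp [mul_add]; ring) (fun _ _ _ => by simp [mul_add])

theorem b42Form_apply (ω : LinearMap.BilinForm k V) (x y : EvenOdd (Module.End k V) V) :
    b42Form ω x y = LinearMap.trace k V (x.even * sympConj y.even) + ω x.odd y.odd := rfl

/-- On even elements the form is the polar form of the determinant. -/
theorem b42Form_even (ω : LinearMap.BilinForm k V) (hV : Module.finrank k V = 2)
    (f g : Module.End k V) :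
    b42Form ω ⟨f, 0⟩ ⟨g, 0⟩
      = LinearMap.det (f + g) - LinearMap.det f - LinearMap.det g := by
  have : Module.Finite k V := Module.finite_of_finrank_eq_succ hV
  let e : Module.Basis (Fin 2) k V := Module.finBasisOfFinrankEq k V hV
  simp only [b42Form_apply, sympConj_apply, mul_sub, mul_smul_comm, mul_one, map_sub, map_smul,
    map_zero, add_zero, smul_eq_mul, trace_coord e, ← LinearMap.det_toMatrix e, map_add,
    LinearMap.toMatrix_mul, Matrix.det_fin_two, Matrix.mul_apply, Fin.sum_univ_two,
    Matrix.add_apply, Matrix.sub_apply, Matrix.smul_apply]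
  ring

set_option maxHeartbeats 2000000 in
theorem b42_comp [CharP k 3] {ω : LinearMap.BilinForm k V} (hV : Module.finrank k V = 2)
    (hω : ω.IsAlt) (hω0 : ω ≠ 0) {i j l m : ZMod 2} {x y z t : EvenOdd (Module.End k V) V}
    (hx : x ∈ part k (EvenOdd (Module.End k V) V) i)
    (hy : y ∈ part k (EvenOdd (Module.End k V) V) j)
    (hz : z ∈ part k (EvenOdd (Module.End k V) V) l)
    (ht : t ∈ part k (EvenOdd (Module.End k V) V) m) :
    b42Form ω (b42Mul ω x y) (b42Mul ω z t)
      + sgn k (i * j + i * l + j * l) * b42Form ω (b42Mul ω z y) (b42Mul ω x t)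
      = sgn k (j * l) * (b42Form ω x z * b42Form ω y t) := by
  have h11 : (1 : ZMod 2) + 1 = 0 := by decide
  have h2 := two_eq_neg_one (k := k)
  obtain ⟨e, c, hc, he⟩ := exists_coord hV hω hω0
  have hr : ∀ (u v : V) (i j : Fin 2), LinearMap.toMatrix e e (rankOne ω u v) i j
      = ω (e j) u * e.repr v i := by
    intro u v i j
    simp [LinearMap.toMatrix_apply, rankOne_apply]
  have h00 : e.repr (e 0) 0 = 1 := by simp
  have h01 : e.repr (e 0) 1 = 0 := by simp
  have h10 : e.repr (e 1) 0 = 0 := by simp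
  have h111 : e.repr (e 1) 1 = 1 := by simp
  refine EvenOdd.hom_ind (fun x => ?_) (fun x => ?_) i x hx <;>
  refine EvenOdd.hom_ind (fun y => ?_) (fun y => ?_) j y hy <;>
  refine EvenOdd.hom_ind (fun z => ?_) (fun z => ?_) l z hz <;>
  refine EvenOdd.hom_ind (fun t => ?_) (fun t => ?_) m t ht <;>
  simp only [b42Mul_apply, b42Form_apply, map_smul, LinearMap.smul_apply, smul_eq_mul, mul_zero,
    zero_mul, mul_one, add_zero, zero_add, smul_zero, map_zero, LinearMap.zero_apply,
    sgn_zero, sgn_one, h11, sympConj_apply, mul_sub, mul_smul_comm, map_sub, trace_coord e,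
    LinearMap.toMatrix_mul, Matrix.mul_apply, Fin.sum_univ_two, he, repr_apply, hr,
    LinearMap.sub_apply, Module.End.one_apply, Finsupp.sub_apply, Finsupp.smul_apply,
    h00, h01, h10, h111, sub_zero, Matrix.sub_apply, Matrix.smul_apply, Matrix.zero_apply,
    Finsupp.zero_apply] <;>
  first | ring1 | (ring_nf; simp only [h2]; ring1)

/-- The Hurwitz superalgebra `B(4,2)` (even part `End(V)`, odd part `V`) of a two-dimensional
space `V` with a nonzero alternating form `ω`, in characteristic `3`. -/
def B42 [CharP k 3] (ω : LinearMap.BilinForm k V) (hV : Module.finrank k V = 2)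
    (hω : ω.IsAlt) (hω0 : ω ≠ 0) : HurwitzSuperalgebra k (EvenOdd (Module.End k V) V) where
  mul := b42Mul ω
  mul_even := by
    intro i j x y hx hy
    have h11 : (1 : ZMod 2) + 1 = 0 := by decide
    obtain ⟨rfl, a, rfl⟩ | ⟨rfl, a, rfl⟩ := EvenOdd.hom_cases hx <;>
      obtain ⟨rfl, c, rfl⟩ | ⟨rfl, c, rfl⟩ := EvenOdd.hom_cases hy <;>
      simp [EvenOdd.mem_zero, EvenOdd.mem_one, h11, b42Mul_apply]
  b := b42Form ω
  b_even := by
    intro i j x y hx hy hij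
    obtain ⟨rfl, a, rfl⟩ | ⟨rfl, a, rfl⟩ := EvenOdd.hom_cases hx <;>
      obtain ⟨rfl, c, rfl⟩ | ⟨rfl, c, rfl⟩ := EvenOdd.hom_cases hy <;>
      simp [b42Form_apply] at hij ⊢
  b_symm := by
    intro i j x y hx hy
    obtain ⟨rfl, a, rfl⟩ | ⟨rfl, a, rfl⟩ := EvenOdd.hom_cases hx <;>
      obtain ⟨rfl, c, rfl⟩ | ⟨rfl, c, rfl⟩ := EvenOdd.hom_cases hy
    · simp only [b42Form_even ω hV, mul_zero, sgn_zero, one_mul, add_comm a c]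
      ring
    all_goals simp [sgn_zero, sgn_one, hω.neg_eq, b42Form_apply]
  b_nondeg := by
    intro x h
    have : Module.Finite k V := Module.finite_of_finrank_eq_succ hV
    let e : Module.Basis (Fin 2) k V := Module.finBasisOfFinrankEq k V hV
    have h2 := fun v => h ⟨0, v⟩
    simp only [b42Form_apply, map_zero, mul_zero, zero_add] at h2
    ext1
    · refine (LinearMap.toMatrix e e).injective ?_
      have h1 : ∀ M : Matrix (Fin 2) (Fin 2) k,
          b42Form ω x ⟨(LinearMap.toMatrix e e).symm M, 0⟩ = 0 := fun M => h _
      simp only [b42Form_apply, map_zero, add_zero, sympConj_apply, mul_sub, mul_smul_comm,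
        mul_one, map_sub, map_smul, trace_coord e, LinearMap.toMatrix_mul,
        LinearEquiv.apply_symm_apply] at h1
      have a := h1 (Matrix.of ![![1, 0], ![0, 0]])
      have b := h1 (Matrix.of ![![0, 1], ![0, 0]])
      have c := h1 (Matrix.of ![![0, 0], ![1, 0]])
      have d := h1 (Matrix.of ![![0, 0], ![0, 1]])
      simp [Matrix.mul_apply, Fin.sum_univ_two] at a b c d
      ext i j
      fin_cases i <;> fin_cases j <;> simp [a, b, c, d]
    · exact form_nondeg hV hω hω0 _ h2
  b_comp := b42_comp hV hω hω0
  one := ⟨1, 0⟩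
  one_mem := rfl
  one_mul' := fun x => by
    have : Module.Finite k V := Module.finite_of_finrank_eq_succ hV
    ext <;> simp [b42Mul_apply, sympConj_apply, LinearMap.trace_one, hV]
    module
  mul_one' := fun x => by ext <;> simp [b42Mul_apply]

end Symplectic

end Examples

end

end Supermagic

/-!
# The isomorphism of `𝔤(S₂, S)` with `𝔭𝔰𝔱𝔯 H₃(A)`

Both isomorphisms are instances of one theorem: if `S` is the para-Hurwitz superalgebra of a
nonzero Hurwitz superalgebra `A` over a field in which `2 ≠ 0`, then `𝔤(S₂, S)` is isomorphic to
`𝔭𝔰𝔱𝔯 H₃(A)` (`HurwitzSuperalgebra.magic_isomorphic_pstr`). The characteristic `3` is only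
needed for `B(1,2)` and `B(4,2)` to exist.

The only information used about `J = H₃(A)` is its Peirce decomposition
`J = ke₀ ⊕ ke₁ ⊕ ke₂ ⊕ ι₀(A) ⊕ ι₁(A) ⊕ ι₂(A)`, in which the products are cyclically symmetric when they are written
in terms of the product of `S` (`PeirceFrame`). The multiplication `L` by `ιᵢ(a)` and its
commutator with the multiplication by `eᵢ₊₁` combine to two opposite root operators `up i a` and
`down i a`. Together with the multiplications by diagonal elements (`diag`) and with the
superderivations that come from `𝔱𝔯𝔦(S)` (`derOf`), they satisfy the relations of the generators
`ιᵢ(u ⊗ a)`, `ιᵢ(v ⊗ a)`, `𝔱𝔯𝔦(S₂)` and `𝔱𝔯𝔦(S)` of `𝔤(S₂, S)`, where `u = (1, 0)` and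
`v = (0, 1)` in `k × k` satisfy `u • u = v`, `v • v = u`, `u • v = 0`. The relations hold only up to
multiples of the identity, since an element of `𝔱𝔯𝔦(S₂)` has eigenvalues `cᵢ₊₁ - cᵢ₊₂` that
determine the diagonal `c` only up to a constant. So there is a linear map `PeirceFrame.rep`
from `𝔤(S₂, S)` to the structure superalgebra `𝔰𝔱𝔯 J` that preserves brackets modulo scalars
(`PeirceFrame.defect_mem`).

It is injective modulo scalars (`PeirceFrame.rep_injective`). Every superderivation of `J`
is the sum of one that comes from `𝔱𝔯𝔦(S)` and of operators `up i y + down i y`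
(`PeirceFrame.exists_der_eq`), so that the image and the scalars together are all of `𝔰𝔱𝔯 J`
(`PeirceFrame.str_le_sup`). Finally the center of `𝔰𝔱𝔯 J` consists of the scalars
(`PeirceFrame.mem_center_str_iff`), and `rep` induces the isomorphism. `𝔭𝔰𝔱𝔯 J` is a Lie
superalgebra as a subquotient of `𝔤𝔩(J)`, and `𝔤(S₂, S)` is one by transport of structure.
-/

namespace Supermagic

noncomputable section

open TensorProduct

set_option linter.unusedSectionVars false

/-! ### Lie superalgebras, subalgebras and quotients -/

section Lie

variable {k : Type*} [Field k]
variable {V : Type*} [AddCommGroup V] [Module k V] [Superspace k V]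
variable {W : Type*} [AddCommGroup W] [Module k W] [Superspace k W]

theorem sgn_mul_self (i : ZMod 2) : sgn k i * sgn k i = 1 := by
  rcases zmod2 i with rfl | rfl <;> simp [sgn]

theorem sgn_add (i j : ZMod 2) : sgn k (i + j) = sgn k i * sgn k j := by
  have h11 : (1 : ZMod 2) + 1 = 0 := by decide
  rcases zmod2 i with rfl | rfl <;> rcases zmod2 j with rfl | rfl <;>
    simp [sgn_zero, sgn_one, h11]

theorem gl_mul_even_left {f g : Module.End k V} (hf : f ∈ part k (Module.End k V) 0) :
    (gl k V).mul f g = f * g - g * f := by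
  refine eq_of_hom ((gl k V).mul f) (LinearMap.mulLeft k f - LinearMap.mulRight k f)
    (fun i g hg => ?_) g
  ext x
  simp [gl_mul hf hg, sgn_zero]

theorem gl_mul_even_right {f g : Module.End k V} (hg : g ∈ part k (Module.End k V) 0) :
    (gl k V).mul f g = f * g - g * f := by
  refine eq_of_hom ((gl k V).mul.flip g) (LinearMap.mulRight k g - LinearMap.mulLeft k g)
    (fun i f hf => ?_) f
  ext x
  simp [gl_mul hf hg, sgn_zero]

theorem gl_anticomm {i j : ZMod 2} {f g : Module.End k V} (hf : f ∈ part k (Module.End k V) i)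
    (hg : g ∈ part k (Module.End k V) j) :
    (gl k V).mul f g = -(sgn k (i * j) • (gl k V).mul g f) := by
  ext x
  have h := sgn_mul_self (k := k) (i * j)
  simp only [gl_mul hf hg, gl_mul hg hf, LinearMap.neg_apply, LinearMap.smul_apply, mul_comm j i,
    smul_sub, smul_smul, h]
  module

theorem gl_isLie : (gl k V).IsLie where
  anticomm _ _ _ _ hf hg := gl_anticomm hf hg
  jacobi i j f g hf hg := by
    refine eq_of_hom ((gl k V).mul f ∘ₗ (gl k V).mul g)
      ((gl k V).mul ((gl k V).mul f g) + sgn k (i * j) • ((gl k V).mul g ∘ₗ (gl k V).mul f))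
      fun l h hh => ?_
    ext x
    simp only [LinearMap.comp_apply, LinearMap.add_apply, LinearMap.smul_apply,
      gl_mul hf ((gl k V).mul_even hg hh), gl_mul hg hh, gl_mul ((gl k V).mul_even hf hg) hh,
      gl_mul hf hg, gl_mul hg ((gl k V).mul_even hf hh), gl_mul hf hh, map_sub, map_smul,
      add_mul, mul_add, sgn_add, mul_comm j i, smul_sub]
    have h := sgn_mul_self (k := k) (i * j)
    simp only [smul_smul, ← mul_assoc, h]
    module
  cube f hf := by
    have h11 : (1 : ZMod 2) + 1 = 0 := by decide
    ext x
    rw [gl_mul_even_right (by simpa [h11] using (gl k V).mul_even hf hf)]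
    simp [gl_mul hf hf, sgn_one]

namespace Superalgebra

variable {A : Superalgebra k V} {B : Superalgebra k W}

theorem Sub.coe_mul (N : A.Sub) (x y : N.toSubmodule) : (N.alg.mul x y : V) = A.mul x y := rfl

theorem Sub.isLie (N : A.Sub) (hA : A.IsLie) : N.alg.IsLie where
  anticomm _ _ _ _ hx hy := Subtype.ext <|
    hA.anticomm ((mem_part_sub _).1 hx) ((mem_part_sub _).1 hy)
  jacobi _ _ _ _ hx hy z := Subtype.ext <|
    hA.jacobi ((mem_part_sub _).1 hx) ((mem_part_sub _).1 hy) z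
  cube _ hx := Subtype.ext <| hA.cube ((mem_part_sub _).1 hx)

theorem exists_lift_mem_part (N : SuperSubspace k V) {i : ZMod 2} {x : V ⧸ N.toSubmodule}
    (hx : x ∈ part k (V ⧸ N.toSubmodule) i) :
    ∃ y ∈ part k V i, N.toSubmodule.mkQ y = x := by
  obtain ⟨y, rfl⟩ := N.toSubmodule.mkQ_surjective x
  exact ⟨proj k i y, proj_mem i y, hx⟩

theorem modCenter_mul (A : Superalgebra k V) (x y : V) :
    A.modCenter.mul (A.center.toSubmodule.mkQ x) (A.center.toSubmodule.mkQ y)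
      = A.center.toSubmodule.mkQ (A.mul x y) := rfl

theorem modCenter_isLie (hA : A.IsLie) : A.modCenter.IsLie where
  anticomm i j x y hx hy := by
    obtain ⟨x, hx', rfl⟩ := exists_lift_mem_part _ hx
    obtain ⟨y, hy', rfl⟩ := exists_lift_mem_part _ hy
    rw [modCenter_mul, modCenter_mul, hA.anticomm hx' hy', map_neg, map_smul]
  jacobi i j x y hx hy z := by
    obtain ⟨x, hx', rfl⟩ := exists_lift_mem_part _ hx
    obtain ⟨y, hy', rfl⟩ := exists_lift_mem_part _ hy
    obtain ⟨z, rfl⟩ := A.center.toSubmodule.mkQ_surjective z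
    simp only [modCenter_mul]
    rw [hA.jacobi hx' hy', map_add, map_smul]
  cube x hx := by
    obtain ⟨x, hx', rfl⟩ := exists_lift_mem_part _ hx
    rw [modCenter_mul, modCenter_mul, hA.cube hx', map_zero]

theorem Isomorphic.isLie (h : A.Isomorphic B) (hB : B.IsLie) : A.IsLie := by
  obtain ⟨e, he, hm⟩ := h
  have hp : ∀ {i x}, x ∈ part k V i → e x ∈ part k W i := fun {i x} hx => by
    rw [mem_part, ← he, mem_part.1 hx]
  refine ⟨fun i j x y hx hy => e.injective ?_, fun i j x y hx hy z => e.injective ?_,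
    fun x hx => e.injective ?_⟩
  · rw [hm, hB.anticomm (hp hx) (hp hy), map_neg, map_smul, hm]
  · simp only [hm, map_add, map_smul]
    exact hB.jacobi (hp hx) (hp hy) _
  · rw [hm, hm, hB.cube (hp hx), map_zero]

end Superalgebra

theorem pstr_isLie (A : Superalgebra k V) : (pstr A).IsLie :=
  Superalgebra.modCenter_isLie ((str A).isLie gl_isLie)

end Lie

/-! ### Peirce frames -/

section Frame

theorem fin3_cases (i j : Fin 3) : j = i ∨ j = i + 1 ∨ j = i + 2 := by
  revert i j; decide

theorem fin3_add (i : Fin 3) : i + 1 + 1 = i + 2 ∧ i + 1 + 2 = i ∧ i + 2 + 1 = i ∧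
    i + 2 + 2 = i + 1 := by
  revert i; decide

theorem fin3_ne (i : Fin 3) : i ≠ i + 1 ∧ i ≠ i + 2 ∧ i + 1 ≠ i ∧ i + 1 ≠ i + 2 ∧ i + 2 ≠ i ∧
    i + 2 ≠ i + 1 := by
  revert i; decide

theorem sum_fin3 {M : Type*} [AddCommMonoid M] (i : Fin 3) (f : Fin 3 → M) :
    ∑ j, f j = f i + f (i + 1) + f (i + 2) := by
  rw [← Equiv.sum_comp (Equiv.addLeft i) f, Fin.sum_univ_three]
  simp

variable {k : Type*} [Field k]
variable {C : Type*} [AddCommGroup C] [Module k C] [Superspace k C]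
variable {W : Type*} [AddCommGroup W] [Module k W] [Superspace k W]

theorem leftMul_mem (J : Superalgebra k W) {p : ZMod 2} {x : W} (hx : x ∈ part k W p) :
    J.mul x ∈ part k (Module.End k W) p :=
  mem_part_end.2 fun _ _ hy => J.mul_even hx hy

/-- A Peirce decomposition `W = ke₀ ⊕ ke₁ ⊕ ke₂ ⊕ ι₀(C) ⊕ ι₁(C) ⊕ ι₂(C)` of a supercommutative
superalgebra `J`, in which the product is that of `H₃(C)` expressed by the symmetric composition
superalgebra `S`; indices are modulo `3`. The coordinates are `α i` (of `eᵢ`) and `γ i` (of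
`ιᵢ`). The products not listed follow from supercommutativity. -/
structure PeirceFrame (S : SymmetricCompositionSuperalgebra k C) (J : Superalgebra k W) where
  e : Fin 3 → W
  ι : Fin 3 → C →ₗ[k] W
  α : Fin 3 → W →ₗ[k] k
  γ : Fin 3 → W →ₗ[k] C
  sum_eq : ∀ X, (∑ i, α i X • e i) + ∑ i, ι i (γ i X) = X
  α_e : ∀ i j, α i (e j) = if i = j then 1 else 0
  α_ι : ∀ i j a, α i (ι j a) = 0
  γ_e : ∀ i j, γ i (e j) = 0
  γ_ι : ∀ i j a, γ i (ι j a) = if i = j then a else 0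
  e_mem : ∀ i, e i ∈ part k W 0
  ι_mem : ∀ i {p : ZMod 2} {a : C}, a ∈ part k C p → ι i a ∈ part k W p
  comm : ∀ {p q : ZMod 2} {x y : W}, x ∈ part k W p → y ∈ part k W q →
    J.mul x y = sgn k (p * q) • J.mul y x
  e_mul_e : ∀ i j, J.mul (e i) (e j) = if i = j then e i else 0
  e_mul_ι : ∀ i a, J.mul (e i) (ι i a) = 0
  e_mul_ι_one : ∀ i a, J.mul (e (i + 1)) (ι i a) = (2⁻¹ : k) • ι i a
  e_mul_ι_two : ∀ i a, J.mul (e (i + 2)) (ι i a) = (2⁻¹ : k) • ι i a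
  ι_mul_ι : ∀ i a b, J.mul (ι i a) (ι i b) = (2⁻¹ * S.b a b) • (e (i + 1) + e (i + 2))
  ι_mul_ι_one : ∀ i a b, J.mul (ι i a) (ι (i + 1) b) = (2⁻¹ : k) • ι (i + 2) (S.mul a b)

namespace PeirceFrame

variable {S : SymmetricCompositionSuperalgebra k C} {J : Superalgebra k W} (F : PeirceFrame S J)

/-- A linear map on `W` is determined by its values on the `eⱼ` and on the `ιⱼ(a)` with `a`
homogeneous. The indices are listed starting from an arbitrary `i`, so that computations stay
cyclically symmetric. -/
theorem ext {M : Type*} [AddCommGroup M] [Module k M] (i : Fin 3) {f g : W →ₗ[k] M}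
    (h0 : f (F.e i) = g (F.e i)) (h1 : f (F.e (i + 1)) = g (F.e (i + 1)))
    (h2 : f (F.e (i + 2)) = g (F.e (i + 2)))
    (h3 : ∀ p, ∀ a ∈ part k C p, f (F.ι i a) = g (F.ι i a))
    (h4 : ∀ p, ∀ a ∈ part k C p, f (F.ι (i + 1) a) = g (F.ι (i + 1) a))
    (h5 : ∀ p, ∀ a ∈ part k C p, f (F.ι (i + 2) a) = g (F.ι (i + 2) a)) : f = g := by
  have he : ∀ j, f (F.e j) = g (F.e j) := by
    intro j
    obtain rfl | rfl | rfl := fin3_cases i j <;> assumption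
  have hι : ∀ j a, f (F.ι j a) = g (F.ι j a) := by
    intro j a
    refine eq_of_hom (f ∘ₗ F.ι j) (g ∘ₗ F.ι j) (fun p a ha => ?_) a
    obtain rfl | rfl | rfl := fin3_cases i j
    exacts [h3 p a ha, h4 p a ha, h5 p a ha]
  ext X
  rw [← F.sum_eq X]
  simp only [map_add, map_sum, map_smul, he, hι]

theorem ι_mul_e (i j : Fin 3) (a : C) : J.mul (F.ι i a) (F.e j) = J.mul (F.e j) (F.ι i a) := by
  refine eq_of_hom (J.mul.flip (F.e j) ∘ₗ F.ι i) (J.mul (F.e j) ∘ₗ F.ι i) (fun p a ha => ?_) a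
  have h := F.comm (F.ι_mem i ha) (F.e_mem j)
  rwa [mul_zero, sgn_zero, one_smul] at h

theorem ι_mul_ι_two (i : Fin 3) {p q : ZMod 2} {a b : C} (ha : a ∈ part k C p)
    (hb : b ∈ part k C q) : J.mul (F.ι i a) (F.ι (i + 2) b)
      = (2⁻¹ * sgn k (p * q) : k) • F.ι (i + 1) (S.mul b a) := by
  have h := F.ι_mul_ι_one (i + 2) b a
  simp only [fin3_add] at h
  rw [F.comm (F.ι_mem i ha) (F.ι_mem _ hb), h, smul_smul, mul_comm]

theorem γ_mem (i : Fin 3) {p : ZMod 2} {X : W} (hX : X ∈ part k W p) : F.γ i X ∈ part k C p := by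
  have h : F.γ i ∘ₗ proj k p = proj k p ∘ₗ F.γ i := by
    have he : ∀ j, F.γ i (proj k p (F.e j)) = proj k p (F.γ i (F.e j)) := by
      intro j
      rw [proj_of_mem (F.e_mem j), F.γ_e, map_zero]
      split_ifs
      · exact F.γ_e i j
      · exact map_zero _
    have hι : ∀ j q, ∀ a ∈ part k C q,
        F.γ i (proj k p (F.ι j a)) = proj k p (F.γ i (F.ι j a)) := by
      intro j q a ha
      rw [proj_of_mem (F.ι_mem j ha), F.γ_ι, apply_ite (F.γ i), F.γ_ι, apply_ite (proj k p),
        proj_of_mem ha, map_zero, map_zero]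
      split_ifs <;> rfl
    exact F.ext 0 (he _) (he _) (he _) (hι _) (hι _) (hι _)
  have h' := LinearMap.congr_fun h X
  rw [LinearMap.comp_apply, LinearMap.comp_apply, mem_part.1 hX] at h'
  exact h'.symm

/-! ### Root operators -/

/-- The commutator of the multiplications by `eᵢ₊₁` and by `ιᵢ(a)`. -/
def comm1 (i : Fin 3) : C →ₗ[k] Module.End k W :=
  (LinearMap.mulLeft k (J.mul (F.e (i + 1))) - LinearMap.mulRight k (J.mul (F.e (i + 1)))) ∘ₗ
    J.mul ∘ₗ F.ι i

/-- The root operator `-(L + 2[L', L])` for the multiplications `L` by `ιᵢ(a)` and `L'` by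
`eᵢ₊₁`. It sends `eᵢ₊₂` to `-ιᵢ(a)` and `ιᵢ(C)` to `keᵢ₊₁`, and it represents `ιᵢ(u ⊗ a)`. -/
def up (i : Fin 3) : C →ₗ[k] Module.End k W :=
  -(J.mul ∘ₗ F.ι i + (2 : k) • F.comm1 i)

/-- The root operator `L - 2[L', L]`, opposite to `up`, which sends `eᵢ₊₁` to `ιᵢ(a)` and
`ιᵢ(C)` to `keᵢ₊₂`. It represents `ιᵢ(v ⊗ a)`. -/
def down (i : Fin 3) : C →ₗ[k] Module.End k W :=
  J.mul ∘ₗ F.ι i - (2 : k) • F.comm1 i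

theorem up_apply (i : Fin 3) (a : C) (X : W) : F.up i a X = -(J.mul (F.ι i a) X
    + (2 : k) • (J.mul (F.e (i + 1)) (J.mul (F.ι i a) X)
      - J.mul (F.ι i a) (J.mul (F.e (i + 1)) X))) := by
  simp [up, comm1]

theorem down_apply (i : Fin 3) (a : C) (X : W) : F.down i a X = J.mul (F.ι i a) X
    - (2 : k) • (J.mul (F.e (i + 1)) (J.mul (F.ι i a) X)
      - J.mul (F.ι i a) (J.mul (F.e (i + 1)) X)) := by
  simp [down, comm1]

theorem e_mul_ι_ite (i j : Fin 3) (a : C) :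
    J.mul (F.e j) (F.ι i a) = if j = i then 0 else (2⁻¹ : k) • F.ι i a := by
  obtain rfl | rfl | rfl := fin3_cases i j
  · simp [F.e_mul_ι]
  · simp [F.e_mul_ι_one]
  · simp [F.e_mul_ι_two]

theorem up_e_self (i : Fin 3) (a : C) : F.up i a (F.e i) = 0 := by
  simp [up_apply, F.ι_mul_e, F.e_mul_ι, F.e_mul_e]

variable [NeZero (2 : k)]

theorem two_mul_half : (2 : k) * 2⁻¹ = 1 := mul_inv_cancel₀ (NeZero.ne _)

theorem up_e_one (i : Fin 3) (a : C) : F.up i a (F.e (i + 1)) = 0 := by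
  have h := two_mul_half (k := k)
  simp only [up_apply, F.ι_mul_e, F.e_mul_ι_one, F.e_mul_e, map_smul, smul_smul, if_true]
  -- as an atom with `2 * t = 1`, the scalar `2⁻¹` is left alone by the normalization of fields,
  -- which would need to know that `2 ≠ 0`
  generalize (2⁻¹ : k) = t at *
  match_scalars
  grind

theorem up_e_two (i : Fin 3) (a : C) : F.up i a (F.e (i + 2)) = -F.ι i a := by
  have h := two_mul_half (k := k)
  simp only [up_apply, F.ι_mul_e, F.e_mul_ι_one, F.e_mul_ι_two, F.e_mul_e, map_smul, fin3_ne,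
    if_false, map_zero]
  generalize (2⁻¹ : k) = t at *
  match_scalars
  grind

theorem up_ι_self (i : Fin 3) (a b : C) : F.up i a (F.ι i b) = -(S.b a b • F.e (i + 1)) := by
  have h := two_mul_half (k := k)
  simp only [up_apply, F.e_mul_ι_one, F.ι_mul_ι, F.e_mul_e, map_smul, fin3_ne, if_true,
    if_false, map_add]
  generalize (2⁻¹ : k) = t at *
  match_scalars <;> grind

theorem up_ι_one (i : Fin 3) (a b : C) :
    F.up i a (F.ι (i + 1) b) = -F.ι (i + 2) (S.mul a b) := by
  have h := two_mul_half (k := k)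
  simp only [up_apply, F.e_mul_ι_ite, F.ι_mul_ι_one, map_smul, fin3_ne, if_true, if_false, map_zero]
  generalize (2⁻¹ : k) = t at *
  match_scalars
  grind

theorem up_ι_two (i : Fin 3) (a b : C) : F.up i a (F.ι (i + 2) b) = 0 := by
  have h := two_mul_half (k := k)
  refine eq_of_hom ((F.up i).flip (F.ι (i + 2) b)) 0 (fun p a ha => ?_) a
  refine eq_of_hom (F.up i a ∘ₗ F.ι (i + 2)) 0 (fun q b hb => ?_) b
  simp only [LinearMap.comp_apply, LinearMap.zero_apply, up_apply, F.e_mul_ι_ite,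
    F.ι_mul_ι_two _ ha hb, map_smul, fin3_ne, if_true, if_false]
  generalize (2⁻¹ : k) = t at *
  match_scalars
  grind

theorem down_e_self (i : Fin 3) (a : C) : F.down i a (F.e i) = 0 := by
  simp [down_apply, F.ι_mul_e, F.e_mul_ι, F.e_mul_e]

theorem down_e_one (i : Fin 3) (a : C) : F.down i a (F.e (i + 1)) = F.ι i a := by
  have h := two_mul_half (k := k)
  simp only [down_apply, F.ι_mul_e, F.e_mul_ι_one, F.e_mul_e, map_smul, smul_smul, if_true]
  generalize (2⁻¹ : k) = t at *
  match_scalars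
  grind

theorem down_e_two (i : Fin 3) (a : C) : F.down i a (F.e (i + 2)) = 0 := by
  have h := two_mul_half (k := k)
  simp only [down_apply, F.ι_mul_e, F.e_mul_ι_one, F.e_mul_ι_two, F.e_mul_e, map_smul, fin3_ne,
    if_false, map_zero]
  generalize (2⁻¹ : k) = t at *
  match_scalars
  grind

theorem down_ι_self (i : Fin 3) (a b : C) : F.down i a (F.ι i b) = S.b a b • F.e (i + 2) := by
  have h := two_mul_half (k := k)
  simp only [down_apply, F.e_mul_ι_one, F.ι_mul_ι, F.e_mul_e, map_smul, fin3_ne, if_true,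
    if_false, map_add]
  generalize (2⁻¹ : k) = t at *
  match_scalars <;> grind

theorem down_ι_one (i : Fin 3) (a b : C) : F.down i a (F.ι (i + 1) b) = 0 := by
  have h := two_mul_half (k := k)
  simp only [down_apply, F.e_mul_ι_ite, F.ι_mul_ι_one, map_smul, fin3_ne, if_true, if_false,
    map_zero]
  generalize (2⁻¹ : k) = t at *
  match_scalars
  grind

theorem down_ι_two (i : Fin 3) {p q : ZMod 2} {a b : C} (ha : a ∈ part k C p)
    (hb : b ∈ part k C q) :
    F.down i a (F.ι (i + 2) b) = sgn k (p * q) • F.ι (i + 1) (S.mul b a) := by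
  have h := two_mul_half (k := k)
  simp only [down_apply, F.e_mul_ι_ite, F.ι_mul_ι_two _ ha hb, map_smul, fin3_ne, if_true, if_false]
  generalize (2⁻¹ : k) = t at *
  match_scalars
  grind

theorem comm1_mem (i : Fin 3) {p : ZMod 2} {a : C} (ha : a ∈ part k C p) :
    F.comm1 i a ∈ part k (Module.End k W) p := by
  have h1 := leftMul_mem J (F.e_mem (i + 1))
  have h2 := leftMul_mem J (F.ι_mem i ha)
  have h3 := isEven_comp h1 h2
  have h4 := isEven_comp h2 h1
  rw [zero_add] at h3
  rw [add_zero] at h4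
  exact Submodule.sub_mem _ h3 h4

theorem up_mem (i : Fin 3) {p : ZMod 2} {a : C} (ha : a ∈ part k C p) :
    F.up i a ∈ part k (Module.End k W) p :=
  Submodule.neg_mem _ (Submodule.add_mem _ (leftMul_mem J (F.ι_mem i ha))
    (Submodule.smul_mem _ _ (F.comm1_mem i ha)))

theorem down_mem (i : Fin 3) {p : ZMod 2} {a : C} (ha : a ∈ part k C p) :
    F.down i a ∈ part k (Module.End k W) p :=
  Submodule.sub_mem _ (leftMul_mem J (F.ι_mem i ha))
    (Submodule.smul_mem _ _ (F.comm1_mem i ha))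

theorem leftMul_mem_str (x : W) : J.mul x ∈ (str J).toSubmodule :=
  Submodule.mem_sInf.2 fun _ hN => hN.2.1 x

theorem der_le_str : der J ≤ (str J).toSubmodule := fun _ hd =>
  Submodule.mem_sInf.2 fun _ hN => hN.1 hd

theorem comm1_mem_str (i : Fin 3) (a : C) : F.comm1 i a ∈ (str J).toSubmodule := by
  have h := (str J).mul_mem' (leftMul_mem_str (J := J) (F.e (i + 1)))
    (leftMul_mem_str (J := J) (F.ι i a))
  rwa [gl_mul_even_left (leftMul_mem J (F.e_mem _))] at h

theorem up_mem_str (i : Fin 3) (a : C) : F.up i a ∈ (str J).toSubmodule :=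
  Submodule.neg_mem _ (Submodule.add_mem _ (leftMul_mem_str _)
    (Submodule.smul_mem _ _ (F.comm1_mem_str i a)))

theorem down_mem_str (i : Fin 3) (a : C) : F.down i a ∈ (str J).toSubmodule :=
  Submodule.sub_mem _ (leftMul_mem_str _) (Submodule.smul_mem _ _ (F.comm1_mem_str i a))

theorem down_sub_up (i : Fin 3) (a : C) : F.down i a - F.up i a = (2 : k) • J.mul (F.ι i a) := by
  simp only [up, down, LinearMap.sub_apply, LinearMap.neg_apply, LinearMap.add_apply,
    LinearMap.smul_apply, LinearMap.comp_apply]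
  module

/-! ### Diagonal operators -/

/-- The multiplication by `2 ∑ᵢ cᵢ eᵢ`, which acts as `2cᵢ` on `eᵢ` and as `cᵢ₊₁ + cᵢ₊₂` on
`ιᵢ(C)`. -/
def diag : (Fin 3 → k) →ₗ[k] Module.End k W :=
  (2 : k) • (J.mul ∘ₗ Fintype.linearCombination k F.e)

theorem diag_apply (c : Fin 3 → k) (X : W) :
    F.diag c X = (2 : k) • ∑ i, c i • J.mul (F.e i) X := by
  simp [diag, Fintype.linearCombination_apply]

theorem diag_e (c : Fin 3 → k) (j : Fin 3) : F.diag c (F.e j) = (2 * c j) • F.e j := by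
  simp [diag_apply, F.e_mul_e, smul_smul]

theorem diag_ι (c : Fin 3 → k) (j : Fin 3) (a : C) :
    F.diag c (F.ι j a) = (c (j + 1) + c (j + 2)) • F.ι j a := by
  have h := two_mul_half (k := k)
  simp only [diag_apply, F.e_mul_ι_ite, sum_fin3 j, fin3_ne, if_true, if_false]
  generalize (2⁻¹ : k) = t at *
  match_scalars
  grind

theorem diag_mem (c : Fin 3 → k) : F.diag c ∈ part k (Module.End k W) 0 := by
  refine Submodule.smul_mem _ _ (leftMul_mem J ?_)
  rw [Fintype.linearCombination_apply]
  exact Submodule.sum_mem _ fun i _ => Submodule.smul_mem _ _ (F.e_mem i)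

theorem diag_mem_str (c : Fin 3 → k) : F.diag c ∈ (str J).toSubmodule :=
  Submodule.smul_mem _ _ (leftMul_mem_str _)

theorem diag_eq_one {c : Fin 3 → k} (i : Fin 3) (h1 : c (i + 1) = c i) (h2 : c (i + 2) = c i) :
    F.diag c = (2 * c i) • 1 := by
  refine F.ext i ?_ ?_ ?_ ?_ ?_ ?_ <;> intros <;>
    simp only [diag_e, diag_ι, fin3_add, h1, h2, LinearMap.smul_apply, Module.End.one_apply,
      two_mul]

/-! ### Derivations from triality triples -/

/-- The operator that kills the `eᵢ` and acts as `dᵢ` on `ιᵢ(C)`. -/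
def derOf : (Fin 3 → Module.End k C) →ₗ[k] Module.End k W where
  toFun d := ∑ i, F.ι i ∘ₗ d i ∘ₗ F.γ i
  map_add' d d' := by
    simp [LinearMap.comp_add, LinearMap.add_comp, Finset.sum_add_distrib]
  map_smul' c d := by
    simp [LinearMap.comp_smul, LinearMap.smul_comp, Finset.smul_sum]

theorem derOf_apply (d : Fin 3 → Module.End k C) (X : W) :
    F.derOf d X = ∑ i, F.ι i (d i (F.γ i X)) := by
  simp [derOf]

theorem derOf_e (d : Fin 3 → Module.End k C) (j : Fin 3) : F.derOf d (F.e j) = 0 := by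
  simp [derOf_apply, F.γ_e]

theorem derOf_ι (d : Fin 3 → Module.End k C) (j : Fin 3) (a : C) :
    F.derOf d (F.ι j a) = F.ι j (d j a) := by
  rw [derOf_apply, Finset.sum_eq_single j]
  · simp [F.γ_ι]
  · intro i _ hi
    simp [F.γ_ι, hi]
  · simp

theorem derOf_mem {p : ZMod 2} {d : Fin 3 → Module.End k C}
    (hd : ∀ i, d i ∈ part k (Module.End k C) p) : F.derOf d ∈ part k (Module.End k W) p := by
  refine mem_part_end.2 fun q X hX => ?_
  rw [derOf_apply]
  exact Submodule.sum_mem _ fun i _ => F.ι_mem i (mem_part_end.1 (hd i) q _ (F.γ_mem i hX))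

/-- The triality relation, rotated to an arbitrary index. -/
theorem tri_mul {d : Fin 3 → Module.End k C} (hd : d ∈ S.triSubmodule) {p q : ZMod 2}
    (hp : ∀ i, d i ∈ part k (Module.End k C) p) (i : Fin 3) {a : C} (ha : a ∈ part k C q)
    (b : C) :
    d (i + 2) (S.mul a b) = S.mul (d i a) b + sgn k (p * q) • S.mul a (d (i + 1) b) := by
  have h := S.tri_hom (S.rot_mem_tri' hd (1 - i)) (fun _ => hp _) ha b
  have e : (0 : Fin 3) - (1 - i) = i + 2 ∧ (1 : Fin 3) - (1 - i) = i ∧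
      (2 : Fin 3) - (1 - i) = i + 1 := by clear h; revert i; decide
  simpa only [e] using h

/-- Triality triples give superderivations. -/
theorem derOf_mem_der {d : Fin 3 → Module.End k C} (hd : d ∈ S.triSubmodule) :
    F.derOf d ∈ der J := by
  suffices h : ∀ p, F.derOf (proj k p d) ∈ der J by
    rw [← proj_add (k := k) d, map_add]
    exact Submodule.add_mem _ (h 0) (h 1)
  intro p
  have hd' := S.proj_mem_tri p hd
  have hp : ∀ a, proj k p d a ∈ part k (Module.End k C) p := fun a => proj_mem p (d a)
  generalize proj k p d = d at *
  have hD := F.derOf_mem hp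
  -- the sign `(-1)^{px}` is absorbed in the linear map `ε`
  let ε : W →ₗ[k] W := proj k 0 + sgn k p • proj k 1
  have hε : ∀ {q : ZMod 2} {x : W}, x ∈ part k W q → ε x = sgn k (p * q) • x := by
    intro q x hx
    simp only [ε, LinearMap.add_apply, LinearMap.smul_apply, proj_of_mem hx]
    rcases zmod2 q with rfl | rfl <;> simp [sgn_zero]
  have hεe : ∀ j, ε (F.e j) = F.e j := fun j => by
    rw [hε (F.e_mem j), mul_zero, sgn_zero, one_smul]
  have hsι : ∀ j {q : ZMod 2} {a : C}, a ∈ part k C q → ε (F.ι j a) = sgn k (p * q) • F.ι j a :=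
    fun j _ _ ha => hε (F.ι_mem j ha)
  have key : ∀ x y, F.derOf d (J.mul x y) = J.mul (F.derOf d x) y + J.mul (ε x) (F.derOf d y) := by
    have heι : ∀ j i a, F.derOf d (J.mul (F.e j) (F.ι i a)) = J.mul (F.e j) (F.ι i (d i a)) := by
      intro j i a
      rw [F.e_mul_ι_ite, F.e_mul_ι_ite, apply_ite (F.derOf d), map_smul, derOf_ι, map_zero]
    have hee : ∀ i j, F.derOf d (J.mul (F.e i) (F.e j)) = 0 := by
      intro i j
      rw [F.e_mul_e, apply_ite (F.derOf d), derOf_e, map_zero, ite_self]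
    have he : ∀ i y, F.derOf d (J.mul (F.e i) y)
        = J.mul (F.derOf d (F.e i)) y + J.mul (ε (F.e i)) (F.derOf d y) := by
      intro i y
      rw [derOf_e, map_zero, LinearMap.zero_apply, zero_add, hεe]
      refine LinearMap.congr_fun (f := F.derOf d ∘ₗ J.mul (F.e i))
        (g := J.mul (F.e i) ∘ₗ F.derOf d) ?_ y
      refine F.ext 0 ?_ ?_ ?_ ?_ ?_ ?_ <;> intros <;>
        simp only [LinearMap.comp_apply, derOf_e, derOf_ι, hee, heι, map_zero]
    have hι : ∀ i q, ∀ a ∈ part k C q, ∀ y, F.derOf d (J.mul (F.ι i a) y)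
        = J.mul (F.derOf d (F.ι i a)) y + J.mul (ε (F.ι i a)) (F.derOf d y) := by
      intro i q a ha y
      refine LinearMap.congr_fun (f := F.derOf d ∘ₗ J.mul (F.ι i a))
        (g := J.mul (F.derOf d (F.ι i a)) + J.mul (ε (F.ι i a)) ∘ₗ F.derOf d) ?_ y
      refine F.ext i ?_ ?_ ?_ (fun r b hb => ?_) (fun r b hb => ?_) (fun r b hb => ?_) <;>
        simp only [LinearMap.comp_apply, LinearMap.add_apply, derOf_e, derOf_ι, hsι i ha,
          LinearMap.smul_apply, map_smul, map_zero, add_zero, F.ι_mul_e, heι]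
      · have h := hd'.1 i p q a ha b
        rw [proj_of_mem (hp i), if_pos rfl] at h
        simp only [F.ι_mul_ι, map_smul, map_add, derOf_e]
        have h' := congrArg (fun c : k => (2⁻¹ * c) • (F.e (i + 1) + F.e (i + 2))) h
        simp only [mul_zero, zero_smul] at h'
        linear_combination (norm := module) -h'
      · simp only [F.ι_mul_ι_one, map_smul, derOf_ι, tri_mul hd' hp i ha, map_add]
        module
      · have hda := mem_part_end.1 (hp i) q a ha
        have hdb := mem_part_end.1 (hp (i + 2)) r b hb
        have h := tri_mul hd' hp (i + 2) hb a
        simp only [fin3_add] at h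
        simp only [F.ι_mul_ι_two i ha hb, F.ι_mul_ι_two i hda hb, F.ι_mul_ι_two i ha hdb,
          map_smul, derOf_ι, h, map_add, smul_add, smul_smul]
        have h11 : (1 : ZMod 2) + 1 = 0 := by decide
        rcases zmod2 p with rfl | rfl <;> rcases zmod2 q with rfl | rfl <;>
          rcases zmod2 r with rfl | rfl <;>
          simp only [mul_zero, mul_one, sgn_zero, sgn_one, h11, add_zero, zero_add] <;> module
    intro x y
    refine LinearMap.congr_fun (f := F.derOf d ∘ₗ J.mul.flip y)
      (g := J.mul.flip y ∘ₗ F.derOf d + J.mul.flip (F.derOf d y) ∘ₗ ε) ?_ x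
    exact F.ext 0 (he _ _) (he _ _) (he _ _) (fun p a ha => hι _ p a ha _)
      (fun p a ha => hι _ p a ha _) (fun p a ha => hι _ p a ha _)
  intro r j x hx y
  rw [proj_of_mem hD]
  split_ifs with hr
  · subst hr
    rw [key, hε hx, map_smul, LinearMap.smul_apply]
  · simp

end PeirceFrame
end Frame

/-! ### Brackets of the operators of a Peirce frame -/

namespace PeirceFrame

variable {k : Type*} [Field k]
variable {C : Type*} [AddCommGroup C] [Module k C] [Superspace k C]
variable {W : Type*} [AddCommGroup W] [Module k W] [Superspace k W]
variable {S : SymmetricCompositionSuperalgebra k C} {J : Superalgebra k W} (F : PeirceFrame S J)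
variable [NeZero (2 : k)]

theorem diag_diag (c c' : Fin 3 → k) : (gl k W).mul (F.diag c) (F.diag c') = 0 := by
  refine F.ext 0 ?_ ?_ ?_ ?_ ?_ ?_ <;> intros <;>
    simp only [gl_mul (F.diag_mem _) (F.diag_mem _), diag_e, diag_ι, map_smul, mul_zero, sgn_zero,
      LinearMap.zero_apply] <;> module

theorem diag_derOf (c : Fin 3 → k) (d : Fin 3 → Module.End k C) :
    (gl k W).mul (F.diag c) (F.derOf d) = 0 := by
  rw [gl_mul_even_left (F.diag_mem _)]
  refine F.ext 0 ?_ ?_ ?_ ?_ ?_ ?_ <;> intros <;>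
    simp only [LinearMap.sub_apply, Module.End.mul_apply, derOf_e, derOf_ι, diag_e, diag_ι,
      map_smul, map_zero, smul_zero, LinearMap.zero_apply, sub_self]

theorem derOf_derOf {p q : ZMod 2} {d d' : Fin 3 → Module.End k C}
    (hd : ∀ i, d i ∈ part k (Module.End k C) p) (hd' : ∀ i, d' i ∈ part k (Module.End k C) q) :
    (gl k W).mul (F.derOf d) (F.derOf d') = F.derOf fun i => (gl k C).mul (d i) (d' i) := by
  refine F.ext 0 ?_ ?_ ?_ ?_ ?_ ?_ <;> intros <;>
    simp only [gl_mul (F.derOf_mem hd) (F.derOf_mem hd'), derOf_e, derOf_ι, map_zero, smul_zero,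
      sub_zero, gl_mul (hd _) (hd' _), map_sub, map_smul]

theorem diag_up (c : Fin 3 → k) (i : Fin 3) (a : C) :
    (gl k W).mul (F.diag c) (F.up i a) = (c (i + 1) - c (i + 2)) • F.up i a := by
  rw [gl_mul_even_left (F.diag_mem _)]
  refine F.ext i ?_ ?_ ?_ (fun q b hb => ?_) (fun q b hb => ?_) (fun q b hb => ?_) <;>
    simp only [LinearMap.sub_apply, Module.End.mul_apply, LinearMap.smul_apply, diag_e, diag_ι,
      map_smul, map_zero, up_e_self, up_e_one, up_e_two, up_ι_self, up_ι_one, up_ι_two, map_neg,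
      fin3_add, sub_self, smul_zero] <;> module

theorem diag_down (c : Fin 3 → k) (i : Fin 3) {p : ZMod 2} {a : C} (ha : a ∈ part k C p) :
    (gl k W).mul (F.diag c) (F.down i a) = -(c (i + 1) - c (i + 2)) • F.down i a := by
  rw [gl_mul_even_left (F.diag_mem _)]
  refine F.ext i ?_ ?_ ?_ (fun q b hb => ?_) (fun q b hb => ?_) (fun q b hb => ?_) <;>
    simp only [LinearMap.sub_apply, Module.End.mul_apply, LinearMap.smul_apply, diag_e, diag_ι,
      map_smul, map_zero, down_e_self, down_e_one, down_e_two, down_ι_self, down_ι_one,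
      fin3_add, sub_self, smul_zero] <;> try module
  simp only [F.down_ι_two i ha hb, diag_ι, map_smul, fin3_add]
  module

theorem derOf_up {d : Fin 3 → Module.End k C} (hd : d ∈ S.triSubmodule) {p q : ZMod 2}
    (hp : ∀ i, d i ∈ part k (Module.End k C) p) (i : Fin 3) {a : C} (ha : a ∈ part k C q) :
    (gl k W).mul (F.derOf d) (F.up i a) = F.up i (d i a) := by
  refine F.ext i ?_ ?_ ?_ (fun r b hb => ?_) (fun r b hb => ?_) (fun r b hb => ?_) <;>
    simp only [gl_mul (F.derOf_mem hp) (F.up_mem i ha), derOf_e, derOf_ι, up_e_self, up_e_one,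
      up_e_two, up_ι_self, up_ι_one, up_ι_two, map_neg, map_zero, map_smul, smul_zero, sub_zero]
  · rw [S.osp_hom (hd.1 i) (hp i) ha]
    module
  · rw [tri_mul hd hp i ha]
    simp only [map_add, map_smul]
    module

theorem derOf_down {d : Fin 3 → Module.End k C} (hd : d ∈ S.triSubmodule) {p q : ZMod 2}
    (hp : ∀ i, d i ∈ part k (Module.End k C) p) (i : Fin 3) {a : C} (ha : a ∈ part k C q) :
    (gl k W).mul (F.derOf d) (F.down i a) = F.down i (d i a) := by
  have hda := mem_part_end.1 (hp i) q a ha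
  refine F.ext i ?_ ?_ ?_ (fun r b hb => ?_) (fun r b hb => ?_) (fun r b hb => ?_) <;>
    simp only [gl_mul (F.derOf_mem hp) (F.down_mem i ha), derOf_e, derOf_ι, down_e_self,
      down_e_one, down_e_two, down_ι_self, down_ι_one, map_zero, map_smul, smul_zero, sub_zero]
  · rw [S.osp_hom (hd.1 i) (hp i) ha]
    module
  · rw [F.down_ι_two i ha hb, F.down_ι_two i ha (mem_part_end.1 (hp (i + 2)) r b hb),
      F.down_ι_two i hda hb, map_smul, derOf_ι]
    have h := tri_mul hd hp (i + 2) hb a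
    simp only [fin3_add] at h
    simp only [h, map_add, map_smul]
    have h11 : (1 : ZMod 2) + 1 = 0 := by decide
    rcases zmod2 p with rfl | rfl <;> rcases zmod2 q with rfl | rfl <;>
      rcases zmod2 r with rfl | rfl <;>
      simp only [mul_zero, mul_one, sgn_zero, sgn_one, h11, add_zero, zero_add] <;> module

theorem up_up_self (i : Fin 3) {p q : ZMod 2} {a b : C} (ha : a ∈ part k C p)
    (hb : b ∈ part k C q) : (gl k W).mul (F.up i a) (F.up i b) = 0 := by
  refine F.ext i ?_ ?_ ?_ (fun r c hc => ?_) (fun r c hc => ?_) (fun r c hc => ?_) <;>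
    simp only [gl_mul (F.up_mem i ha) (F.up_mem i hb), up_e_self, up_e_one, up_e_two, up_ι_self,
      up_ι_one, up_ι_two, map_neg, map_zero, map_smul, smul_zero, sub_zero, LinearMap.zero_apply,
      neg_zero]
  rw [S.b_symm ha hb]
  module

theorem down_down_self (i : Fin 3) {p q : ZMod 2} {a b : C} (ha : a ∈ part k C p)
    (hb : b ∈ part k C q) : (gl k W).mul (F.down i a) (F.down i b) = 0 := by
  refine F.ext i ?_ ?_ ?_ (fun r c hc => ?_) (fun r c hc => ?_) (fun r c hc => ?_) <;>
    simp only [gl_mul (F.down_mem i ha) (F.down_mem i hb), down_e_self, down_e_one, down_e_two,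
      down_ι_self, down_ι_one, map_zero, map_smul, smul_zero, sub_zero, LinearMap.zero_apply]
  · rw [S.b_symm ha hb]
    module
  · rw [F.down_ι_two i ha hc, F.down_ι_two i hb hc, map_smul, map_smul, down_ι_one, down_ι_one]
    simp

/-- The diagonal part of the bracket of the two opposite root operators of index `i`. -/
def weight (i : Fin 3) : Fin 3 → k := Pi.single (i + 2) 2⁻¹ - Pi.single (i + 1) 2⁻¹

theorem weight_apply (i : Fin 3) : weight (k := k) i i = 0 ∧ weight (k := k) i (i + 1) = -2⁻¹ ∧
    weight (k := k) i (i + 2) = 2⁻¹ := by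
  simp [weight]

theorem sigma_eq {p q r : ZMod 2} {a b c : C} (ha : a ∈ part k C p) (hb : b ∈ part k C q)
    (hc : c ∈ part k C r) :
    S.tTriple a b 0 c = (sgn k (p * q) * S.b a c) • b - S.b b c • a := by
  have e : S.tTriple a b 0 = S.sigma a b := rfl
  have ea : sgn k (q * r) * S.b a c = sgn k (p * q) * S.b a c := by
    rcases eq_or_ne p r with rfl | h
    · rw [mul_comm q]
    · rw [S.b_even ha hc h, mul_zero, mul_zero]
  have eb : sgn k (p * (q + r)) * S.b b c = S.b b c := by
    rcases eq_or_ne q r with rfl | h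
    · rw [CharTwo.add_self_eq_zero, mul_zero, sgn_zero, one_mul]
    · rw [S.b_even hb hc h, mul_zero]
  rw [e, S.sigma_apply ha hb hc, ea, eb]

/-- The bracket of opposite root operators. This is where the elements `t_{a,b}` of `𝔱𝔯𝔦(S)`,
rotated by `i`, come from. -/
theorem up_down_self (i : Fin 3) {p q : ZMod 2} {a b : C} (ha : a ∈ part k C p)
    (hb : b ∈ part k C q) : (gl k W).mul (F.up i a) (F.down i b)
      = S.b a b • F.diag (weight i) + F.derOf fun j => S.tTriple a b (j - i) := by
  have h := two_mul_half (k := k)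
  have hs := sgn_mul_self (k := k) (p * q)
  obtain ⟨w0, w1, w2⟩ := weight_apply (k := k) i
  refine F.ext i ?_ ?_ ?_ (fun r c hc => ?_) (fun r c hc => ?_) (fun r c hc => ?_) <;>
    simp only [gl_mul (F.up_mem i ha) (F.down_mem i hb), up_e_self, up_e_one, up_e_two, up_ι_self,
      up_ι_one, down_e_self, down_e_one, down_e_two, down_ι_self, down_ι_one, map_neg, map_zero,
      map_smul, smul_zero, sub_zero, zero_sub, LinearMap.add_apply, diag_e, diag_ι, derOf_e,
      derOf_ι, fin3_add, LinearMap.smul_apply, w0, w1, w2, mul_zero,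
      zero_smul, add_zero, zero_add, sub_self, add_sub_cancel_left, up_ι_two]
  · match_scalars
    linear_combination S.b a b * h
  · rw [S.b_symm ha hb]
    match_scalars
    linear_combination - sgn k (p * q) * S.b b a * h
  · simp only [sigma_eq ha hb hc, map_sub, map_smul]
    module
  · have hl := congrArg (F.ι (i + 1)) (S.comp_left hb hc ha)
    simp only [S.tTriple_apply_one ha hb hc, F.down_ι_two i hb (S.mul_even ha hc),
      S.b_symm hb ha, map_sub, map_smul, map_add] at hl ⊢
    generalize (2⁻¹ : k) = t at *
    have h' := congrArg (fun s => (s * S.b a b) • F.ι (i + 1) c) h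
    beta_reduce at h'
    have h11 : (1 : ZMod 2) + 1 = 0 := by decide
    rcases zmod2 p with rfl | rfl <;> rcases zmod2 q with rfl | rfl <;>
      rcases zmod2 r with rfl | rfl <;>
      simp only [mul_zero, mul_one, sgn_zero, sgn_one, h11, add_zero, zero_add] at hl ⊢ <;>
      first
      | linear_combination (norm := module) hl - h'
      | linear_combination (norm := module) -hl - h'
  · simp only [S.tTriple_apply_two hb hc, F.down_ι_two i hb hc, map_smul, up_ι_one, map_sub]
    match_scalars <;> ring

theorem down_up_self (i : Fin 3) {p q : ZMod 2} {a b : C} (ha : a ∈ part k C p)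
    (hb : b ∈ part k C q) : (gl k W).mul (F.down i a) (F.up i b)
      = -(S.b a b • F.diag (weight i)) + F.derOf fun j => S.tTriple a b (j - i) := by
  have h := two_mul_half (k := k)
  have hs := sgn_mul_self (k := k) (p * q)
  obtain ⟨w0, w1, w2⟩ := weight_apply (k := k) i
  refine F.ext i ?_ ?_ ?_ (fun r c hc => ?_) (fun r c hc => ?_) (fun r c hc => ?_) <;>
    simp only [gl_mul (F.down_mem i ha) (F.up_mem i hb), up_e_self, up_e_one, up_e_two, up_ι_self,
      up_ι_one, down_e_self, down_e_one, down_e_two, down_ι_self, down_ι_one, map_neg, map_zero,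
      map_smul, smul_zero, sub_zero, zero_sub, LinearMap.add_apply, diag_e, diag_ι, derOf_e,
      derOf_ι, fin3_add, LinearMap.smul_apply, w0, w1, w2, mul_zero,
      zero_smul, add_zero, zero_add, sub_self, add_sub_cancel_left, up_ι_two,
      LinearMap.neg_apply, neg_zero]
  · rw [S.b_symm ha hb]
    match_scalars
    linear_combination - sgn k (p * q) * S.b b a * h
  · match_scalars
    linear_combination S.b a b * h
  · simp only [sigma_eq ha hb hc, map_sub, map_smul]
    module
  · simp only [S.tTriple_apply_one ha hb hc, F.down_ι_two i ha (S.mul_even hb hc), map_smul,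
      map_sub]
    match_scalars <;> ring
  · have hl := congrArg (F.ι (i + 2)) (S.comp_right ha hc hb)
    have hz := S.b_even ha hb
    simp only [S.tTriple_apply_two hb hc, F.down_ι_two i ha hc, map_sub, map_smul, map_add,
      up_ι_one] at hl ⊢
    generalize (2⁻¹ : k) = t at *
    have h' := congrArg (fun s => (s * S.b a b) • F.ι (i + 2) c) h
    beta_reduce at h'
    have h11 : (1 : ZMod 2) + 1 = 0 := by decide
    rcases zmod2 p with rfl | rfl <;> rcases zmod2 q with rfl | rfl <;>
      rcases zmod2 r with rfl | rfl <;>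
      simp only [mul_zero, mul_one, sgn_zero, sgn_one, h11, add_zero, zero_add, ne_eq,
        not_true_eq_false, one_ne_zero, zero_ne_one, not_false_eq_true, false_imp_iff,
        true_imp_iff] at hz hl ⊢ <;>
      (try simp only [hz, mul_zero, zero_smul] at hl h' ⊢) <;>
      first
      | linear_combination (norm := module) hl - h'
      | linear_combination (norm := module) -hl - h'

theorem up_up_succ (i : Fin 3) {p q : ZMod 2} {a b : C} (ha : a ∈ part k C p)
    (hb : b ∈ part k C q) : (gl k W).mul (F.up i a) (F.up (i + 1) b)
      = F.down (i + 2) (S.mul a b) := by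
  have e0 := F.up_e_one (i + 1) b
  have e1 := F.up_e_self (i + 1) b
  have e2 := F.up_e_two (i + 1) b
  have e3 := F.up_ι_self (i + 1) b
  have e4 := F.up_ι_one (i + 1) b
  have e5 := F.up_ι_two (i + 1) b
  have f0 := F.down_e_one (i + 2) (S.mul a b)
  have f1 := F.down_e_two (i + 2) (S.mul a b)
  have f2 := F.down_e_self (i + 2) (S.mul a b)
  have f3 := F.down_ι_self (i + 2) (S.mul a b)
  have f4 := F.down_ι_one (i + 2) (S.mul a b)
  have f5 := fun {r : ZMod 2} {c : C} (hc : c ∈ part k C r) =>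
    F.down_ι_two (i + 2) (S.mul_even ha hb) hc
  simp only [fin3_add] at e0 e1 e2 e3 e4 e5 f0 f1 f2 f3 f4 f5
  refine F.ext i ?_ ?_ ?_ (fun r c hc => ?_) (fun r c hc => ?_) (fun r c hc => ?_) <;>
    simp only [gl_mul (F.up_mem i ha) (F.up_mem _ hb), up_e_self, up_e_one, up_e_two, up_ι_self,
      up_ι_one, up_ι_two, e0, e1, e2, e3, e4, e5, f0, f1, f2, f3, f4, map_neg, map_zero,
      map_smul, smul_zero, sub_zero, neg_neg, neg_zero, S.b_assoc]
  have hl := congrArg (F.ι i) (S.comp_right hc ha hb)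
  rw [f5 hc]
  simp only [S.b_symm hc hb, map_add, map_smul] at hl ⊢
  have h11 : (1 : ZMod 2) + 1 = 0 := by decide
  rcases zmod2 p with rfl | rfl <;> rcases zmod2 q with rfl | rfl <;>
    rcases zmod2 r with rfl | rfl <;>
    simp only [mul_zero, mul_one, sgn_zero, sgn_one, h11, add_zero, zero_add] at hl ⊢ <;>
    first
    | linear_combination (norm := module) hl
    | linear_combination (norm := module) -hl

theorem down_down_succ (i : Fin 3) {p q : ZMod 2} {a b : C} (ha : a ∈ part k C p)
    (hb : b ∈ part k C q) : (gl k W).mul (F.down i a) (F.down (i + 1) b)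
      = F.up (i + 2) (S.mul a b) := by
  have hs := sgn_mul_self (k := k) (p * q)
  have e0 := F.down_e_one (i + 1) b
  have e1 := F.down_e_self (i + 1) b
  have e2 := F.down_e_two (i + 1) b
  have e3 := F.down_ι_self (i + 1) b
  have e4 := F.down_ι_one (i + 1) b
  have e5 := fun {r : ZMod 2} {c : C} (hc : c ∈ part k C r) => F.down_ι_two (i + 1) hb hc
  have f0 := F.up_e_one (i + 2) (S.mul a b)
  have f1 := F.up_e_two (i + 2) (S.mul a b)
  have f2 := F.up_e_self (i + 2) (S.mul a b)
  have f3 := F.up_ι_self (i + 2) (S.mul a b)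
  have f4 := F.up_ι_one (i + 2) (S.mul a b)
  have f5 := F.up_ι_two (i + 2) (S.mul a b)
  simp only [fin3_add] at e0 e1 e2 e3 e4 e5 f0 f1 f2 f3 f4 f5
  refine F.ext i ?_ ?_ ?_ (fun r c hc => ?_) (fun r c hc => ?_) (fun r c hc => ?_) <;>
    simp only [gl_mul (F.down_mem i ha) (F.down_mem _ hb), down_e_self, down_e_one, down_e_two,
      down_ι_self, down_ι_one, e0, e1, e2, e3, e4, f0, f1, f2, f3, f4, f5, map_zero,
      map_smul, smul_zero, sub_zero, zero_sub]
  · rw [e5 ha, smul_smul, mul_comm q p, hs, one_smul]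
  · have hl := congrArg (F.ι (i + 1)) (S.comp_left ha hb hc)
    rw [e5 hc, map_smul, F.down_ι_two i ha (S.mul_even hc hb)]
    simp only [map_add, map_smul] at hl
    have hz : sgn k (q * r) * S.b a c = sgn k (p * q) * S.b a c := by
      rcases eq_or_ne p r with rfl | h
      · rw [mul_comm q]
      · rw [S.b_even ha hc h, mul_zero, mul_zero]
    rw [hz] at hl
    have h11 : (1 : ZMod 2) + 1 = 0 := by decide
    rcases zmod2 p with rfl | rfl <;> rcases zmod2 q with rfl | rfl <;>
      rcases zmod2 r with rfl | rfl <;>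
      simp only [mul_zero, mul_one, sgn_zero, sgn_one, h11, add_zero, zero_add] at hl ⊢ <;>
      linear_combination (norm := module) hl
  · rw [F.down_ι_two i ha hc, map_smul, e3, ← S.b_assoc, S.b_symm (S.mul_even hb hc) ha,
      ← S.b_assoc]
    have h11 : (1 : ZMod 2) + 1 = 0 := by decide
    rcases zmod2 p with rfl | rfl <;> rcases zmod2 q with rfl | rfl <;>
      rcases zmod2 r with rfl | rfl <;>
      simp only [mul_zero, mul_one, sgn_zero, sgn_one, h11, add_zero, zero_add] <;> module

theorem up_down_succ (i : Fin 3) {p q : ZMod 2} {a b : C} (ha : a ∈ part k C p)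
    (hb : b ∈ part k C q) : (gl k W).mul (F.up i a) (F.down (i + 1) b) = 0 := by
  have e0 := F.down_e_one (i + 1) b
  have e1 := F.down_e_self (i + 1) b
  have e2 := F.down_e_two (i + 1) b
  have e3 := F.down_ι_self (i + 1) b
  have e4 := F.down_ι_one (i + 1) b
  have e5 := fun {r : ZMod 2} {c : C} (hc : c ∈ part k C r) => F.down_ι_two (i + 1) hb hc
  simp only [fin3_add] at e0 e1 e2 e3 e4 e5
  refine F.ext i ?_ ?_ ?_ (fun r c hc => ?_) (fun r c hc => ?_) (fun r c hc => ?_) <;>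
    simp only [gl_mul (F.up_mem i ha) (F.down_mem _ hb), up_e_self, up_e_one, up_e_two, up_ι_self,
      up_ι_one, up_ι_two, e0, e1, e2, e3, e4, map_neg, map_zero,
      map_smul, smul_zero, sub_zero, neg_zero, LinearMap.zero_apply]
  · rw [e5 ha, smul_neg, smul_smul, mul_comm q p, sgn_mul_self]
    module
  · rw [e5 hc, map_smul, up_ι_two, smul_zero]

theorem down_up_succ (i : Fin 3) {p q : ZMod 2} {a b : C} (ha : a ∈ part k C p)
    (hb : b ∈ part k C q) : (gl k W).mul (F.down i a) (F.up (i + 1) b) = 0 := by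
  have e0 := F.up_e_one (i + 1) b
  have e1 := F.up_e_self (i + 1) b
  have e2 := F.up_e_two (i + 1) b
  have e3 := F.up_ι_self (i + 1) b
  have e4 := F.up_ι_one (i + 1) b
  have e5 := F.up_ι_two (i + 1) b
  simp only [fin3_add] at e0 e1 e2 e3 e4 e5
  refine F.ext i ?_ ?_ ?_ (fun r c hc => ?_) (fun r c hc => ?_) (fun r c hc => ?_) <;>
    simp only [gl_mul (F.down_mem i ha) (F.up_mem _ hb), down_e_self, down_e_one, down_e_two,
      down_ι_self, down_ι_one, e0, e1, e2, e3, e4, e5, map_neg, map_zero,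
      map_smul, smul_zero, sub_zero, neg_zero, LinearMap.zero_apply]
  rw [F.down_ι_two i ha hc, map_smul, e3, ← S.b_assoc b, S.b_symm (S.mul_even hb hc) ha]
  have h11 : (1 : ZMod 2) + 1 = 0 := by decide
  rcases zmod2 p with rfl | rfl <;> rcases zmod2 q with rfl | rfl <;>
    rcases zmod2 r with rfl | rfl <;>
    simp only [mul_zero, mul_one, sgn_zero, sgn_one, h11, add_zero, zero_add] <;> module

end PeirceFrame

/-! ### Superderivations and central elements -/

namespace PeirceFrame

variable {k : Type*} [Field k]
variable {C : Type*} [AddCommGroup C] [Module k C] [Superspace k C]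
variable {W : Type*} [AddCommGroup W] [Module k W] [Superspace k W]
variable {S : SymmetricCompositionSuperalgebra k C} {J : Superalgebra k W} (F : PeirceFrame S J)

theorem ext_all {M : Type*} [AddCommGroup M] [Module k M] {f g : W →ₗ[k] M}
    (he : ∀ i, f (F.e i) = g (F.e i))
    (hι : ∀ i p, ∀ a ∈ part k C p, f (F.ι i a) = g (F.ι i a)) : f = g :=
  F.ext 0 (he _) (he _) (he _) (hι _) (hι _) (hι _)

theorem coord_ext {X Y : W} (hα : ∀ i, F.α i X = F.α i Y) (hγ : ∀ i, F.γ i X = F.γ i Y) :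
    X = Y := by
  rw [← F.sum_eq X, ← F.sum_eq Y]
  simp only [hα, hγ]

theorem α_e_mul (i j : Fin 3) (X : W) :
    F.α j (J.mul (F.e i) X) = if j = i then F.α j X else 0 := by
  suffices h : F.α j ∘ₗ J.mul (F.e i) = if j = i then F.α j else 0 by
    have h' := LinearMap.congr_fun h X
    rw [LinearMap.comp_apply] at h'
    rw [h']
    split_ifs <;> rfl
  refine F.ext_all (fun l => ?_) (fun l p a _ => ?_)
  · simp only [LinearMap.comp_apply, F.e_mul_e, apply_ite (F.α j), F.α_e, map_zero,
      apply_ite (fun f : W →ₗ[k] k => f (F.e l)), LinearMap.zero_apply]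
    split_ifs <;> simp_all
  · simp only [LinearMap.comp_apply, F.e_mul_ι_ite, apply_ite (F.α j), F.α_ι, map_zero, map_smul,
      smul_zero, ite_self, apply_ite (fun f : W →ₗ[k] k => f (F.ι l a)), LinearMap.zero_apply]

theorem γ_e_mul (i j : Fin 3) (X : W) :
    F.γ j (J.mul (F.e i) X) = if j = i then 0 else (2⁻¹ : k) • F.γ j X := by
  suffices h : F.γ j ∘ₗ J.mul (F.e i) = if j = i then 0 else (2⁻¹ : k) • F.γ j by
    have h' := LinearMap.congr_fun h X
    rw [LinearMap.comp_apply] at h'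
    rw [h']
    split_ifs <;> rfl
  refine F.ext_all (fun l => ?_) (fun l p a _ => ?_)
  · simp only [LinearMap.comp_apply, F.e_mul_e, apply_ite (F.γ j), F.γ_e, map_zero,
      apply_ite (fun f : W →ₗ[k] C => f (F.e l)), LinearMap.zero_apply, LinearMap.smul_apply,
      smul_zero, ite_self]
  · simp only [LinearMap.comp_apply, F.e_mul_ι_ite, apply_ite (F.γ j), F.γ_ι, map_zero, map_smul,
      apply_ite (fun f : W →ₗ[k] C => f (F.ι l a)), LinearMap.zero_apply, LinearMap.smul_apply]
    split_ifs <;> simp_all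

theorem α_mul_ι (i : Fin 3) (X : W) {q : ZMod 2} {b : C} (hb : b ∈ part k C q) :
    F.α (i + 1) (J.mul X (F.ι i b)) = 2⁻¹ * S.b (F.γ i X) b ∧
      F.α (i + 2) (J.mul X (F.ι i b)) = 2⁻¹ * S.b (F.γ i X) b := by
  have h : ∀ j, (j = i + 1 ∨ j = i + 2) →
      F.α j ∘ₗ J.mul.flip (F.ι i b) = (2⁻¹ : k) • S.b.flip b ∘ₗ F.γ i := by
    intro j hj
    refine F.ext i ?_ ?_ ?_ (fun p a ha => ?_) (fun p a ha => ?_) (fun p a ha => ?_)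
    · simp [F.γ_e, F.e_mul_ι_ite]
    · simp [F.γ_e, F.e_mul_ι_ite, F.α_ι]
    · simp [F.γ_e, F.e_mul_ι_ite, F.α_ι]
    · rcases hj with rfl | rfl <;>
      simp [F.γ_ι, F.ι_mul_ι, F.α_e]
    · have h := F.ι_mul_ι_two (i + 1) ha hb
      simp only [fin3_add] at h
      simp [F.γ_ι, h, F.α_ι]
    · have h := F.ι_mul_ι_one (i + 2) a b
      simp only [fin3_add] at h
      simp [F.γ_ι, h, F.α_ι]
  exact ⟨LinearMap.congr_fun (h _ (Or.inl rfl)) X, LinearMap.congr_fun (h _ (Or.inr rfl)) X⟩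

theorem α_ι_mul (i : Fin 3) (X : W) {q : ZMod 2} {b : C} (hb : b ∈ part k C q) :
    F.α (i + 1) (J.mul (F.ι i b) X) = 2⁻¹ * S.b b (F.γ i X) := by
  refine LinearMap.congr_fun (f := F.α (i + 1) ∘ₗ J.mul (F.ι i b))
    (g := (2⁻¹ : k) • S.b b ∘ₗ F.γ i) ?_ X
  refine F.ext i ?_ ?_ ?_ (fun p a ha => ?_) (fun p a ha => ?_) (fun p a ha => ?_)
  · simp [F.γ_e, F.ι_mul_e, F.e_mul_ι_ite]
  · simp [F.γ_e, F.ι_mul_e, F.e_mul_ι_ite, F.α_ι]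
  · simp [F.γ_e, F.ι_mul_e, F.e_mul_ι_ite, F.α_ι]
  · simp [F.γ_ι, F.ι_mul_ι, F.α_e]
  · simp [F.γ_ι, F.ι_mul_ι_one, F.α_ι]
  · simp [F.γ_ι, F.ι_mul_ι_two i hb ha, F.α_ι]

theorem γ_mul_ι (i : Fin 3) (X : W) {q : ZMod 2} {b : C} (hb : b ∈ part k C q) :
    F.γ (i + 2) (J.mul X (F.ι (i + 1) b)) = (2⁻¹ : k) • S.mul (F.γ i X) b := by
  refine LinearMap.congr_fun (f := F.γ (i + 2) ∘ₗ J.mul.flip (F.ι (i + 1) b))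
    (g := (2⁻¹ : k) • S.mul.flip b ∘ₗ F.γ i) ?_ X
  refine F.ext i ?_ ?_ ?_ (fun p a ha => ?_) (fun p a ha => ?_) (fun p a ha => ?_)
  · simp [F.γ_e, F.e_mul_ι_ite, F.γ_ι]
  · simp [F.γ_e, F.e_mul_ι_ite]
  · simp [F.γ_e, F.e_mul_ι_ite, F.γ_ι]
  · simp [F.γ_ι, F.ι_mul_ι_one]
  · simp [F.γ_ι, F.ι_mul_ι, F.γ_e]
  · have h := F.ι_mul_ι_two (i + 2) ha hb
    simp only [fin3_add] at h
    simp [F.γ_ι, h]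

theorem γ_ι_mul (i : Fin 3) (X : W) {q : ZMod 2} {b : C} (hb : b ∈ part k C q) :
    F.γ (i + 2) (J.mul (F.ι i b) X) = (2⁻¹ : k) • S.mul b (F.γ (i + 1) X) := by
  refine LinearMap.congr_fun (f := F.γ (i + 2) ∘ₗ J.mul (F.ι i b))
    (g := (2⁻¹ : k) • S.mul b ∘ₗ F.γ (i + 1)) ?_ X
  refine F.ext i ?_ ?_ ?_ (fun p a ha => ?_) (fun p a ha => ?_) (fun p a ha => ?_)
  · simp [F.γ_e, F.ι_mul_e, F.e_mul_ι_ite]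
  · simp [F.γ_e, F.ι_mul_e, F.e_mul_ι_ite, F.γ_ι]
  · simp [F.γ_e, F.ι_mul_e, F.e_mul_ι_ite, F.γ_ι]
  · simp [F.γ_ι, F.ι_mul_ι, F.γ_e]
  · simp [F.γ_ι, F.ι_mul_ι_one]
  · simp [F.γ_ι, F.ι_mul_ι_two i hb ha]

variable [NeZero (2 : k)]

section Der

variable {D : Module.End k W} {p : ZMod 2} (hD : D ∈ der J) (hp : D ∈ part k (Module.End k W) p)
include hD hp

theorem der_hom {q : ZMod 2} {x : W} (hx : x ∈ part k W q) (y : W) :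
    D (J.mul x y) = J.mul (D x) y + sgn k (p * q) • J.mul x (D y) := by
  have h := hD p q x hx y
  rwa [proj_of_mem hp, if_pos rfl] at h

theorem der_e_mul (i : Fin 3) (y : W) :
    D (J.mul (F.e i) y) = J.mul (D (F.e i)) y + J.mul (F.e i) (D y) := by
  rw [der_hom hD hp (F.e_mem i), mul_zero, sgn_zero, one_smul]

/-- A superderivation maps the idempotents off the diagonal. The two components of its values
are linked by `D(eᵢ eᵢ₊₁) = 0`. -/
theorem der_e (i : Fin 3) :
    D (F.e i) = F.ι (i + 1) (F.γ (i + 1) (D (F.e i)))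
      - F.ι (i + 2) (F.γ (i + 2) (D (F.e (i + 1)))) := by
  have h2 := two_mul_half (k := k)
  have hc : ∀ i j, J.mul (D (F.e i)) (F.e j) = J.mul (F.e j) (D (F.e i)) := by
    intro i j
    rw [F.comm (mem_part_end.1 hp 0 _ (F.e_mem i)) (F.e_mem j), mul_zero, sgn_zero, one_smul]
  have h1 := F.der_e_mul hD hp i (F.e i)
  rw [F.e_mul_e, if_pos rfl, hc] at h1
  have h3 := F.der_e_mul hD hp i (F.e (i + 1))
  rw [F.e_mul_e, if_neg (by simp), map_zero, hc] at h3
  have hα : ∀ j, F.α j (D (F.e i)) = 0 := by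
    intro j
    have h := congrArg (F.α j) h1
    rw [map_add, α_e_mul] at h
    split_ifs at h
    · linear_combination -h
    · simpa using h
  have hγ := congrArg (F.γ i) h1
  simp only [map_add, γ_e_mul, if_true, add_zero] at hγ
  have hγ2 := congrArg (F.γ (i + 2)) h3
  simp only [map_add, γ_e_mul, fin3_ne, if_false, map_zero, ← smul_add] at hγ2
  have hne : (2⁻¹ : k) ≠ 0 := inv_ne_zero (NeZero.ne _)
  have hγ3 := (smul_eq_zero.1 hγ2.symm).resolve_left hne
  refine F.coord_ext (fun j => ?_) (fun j => ?_)
  · simp [hα, F.α_ι]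
  · obtain rfl | rfl | rfl := fin3_cases i j
    · simp [hγ, F.γ_ι]
    · simp [F.γ_ι]
    · simp [F.γ_ι, eq_neg_of_add_eq_zero_left hγ3]

/-- The part of `D(ιᵢ(a))` outside `ιᵢ(C)` is determined by the values of `D` at the
idempotents. -/
theorem der_ι (i : Fin 3) {q : ZMod 2} {a : C} (ha : a ∈ part k C q) (y : Fin 3 → C)
    (hy : ∀ i, y i ∈ part k C p)
    (hDe : ∀ i, D (F.e i) = F.ι (i + 1) (y (i + 1)) - F.ι (i + 2) (y (i + 2))) :
    D (F.ι i a) = F.ι i (F.γ i (D (F.ι i a))) + S.b (y i) a • (F.e (i + 1) - F.e (i + 2))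
      + F.ι (i + 1) (S.mul (y (i + 2)) a) - sgn k (p * q) • F.ι (i + 2) (S.mul a (y (i + 1))) := by
  have h2 := two_mul_half (k := k)
  have h0 := F.der_e_mul hD hp i (F.ι i a)
  have h1 := F.der_e_mul hD hp (i + 1) (F.ι i a)
  have h3 := F.der_e_mul hD hp (i + 2) (F.ι i a)
  have m1 := F.ι_mul_ι_one (i + 2) (y (i + 2)) a
  have m2 := F.ι_mul_ι_two (i + 1) (hy (i + 1)) ha
  simp only [fin3_add] at m1 m2
  simp only [F.e_mul_ι, F.e_mul_ι_one, F.e_mul_ι_two, hDe, map_zero, map_smul, map_sub,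
    LinearMap.sub_apply, fin3_add, m1, m2, F.ι_mul_ι] at h0 h1 h3
  have hα0 := congrArg (F.α i) h0
  have hγ1 := congrArg (F.γ (i + 1)) h0
  have hγ2 := congrArg (F.γ (i + 2)) h0
  have hα1 := congrArg (F.α (i + 1)) h1
  have hα2 := congrArg (F.α (i + 2)) h3
  simp only [map_zero, map_add, map_sub, map_smul, F.α_ι, F.γ_ι, α_e_mul, γ_e_mul, fin3_ne,
    if_true, if_false, smul_zero, F.α_e, smul_eq_mul, mul_one, add_zero, zero_add, sub_zero,
    zero_sub, mul_zero] at hα0 hγ1 hγ2 hα1 hα2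
  refine F.coord_ext (fun j => ?_) (fun j => ?_)
  · obtain rfl | rfl | rfl := fin3_cases i j
    all_goals simp only [map_add, map_sub, map_smul, F.α_ι, F.α_e, fin3_ne,
      if_true, if_false, smul_eq_mul, mul_one, add_zero, zero_add, sub_zero,
      zero_sub, mul_zero]
    · exact hα0.symm
    · grind
    · grind
  · obtain rfl | rfl | rfl := fin3_cases i j
    all_goals simp only [map_add, map_sub, map_smul, F.γ_ι, F.γ_e, fin3_ne,
      if_true, if_false, smul_zero, add_zero, zero_add, sub_zero,
      zero_sub]
    · have := congrArg (fun x => (2 : k) • x) hγ1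
      simp only [smul_add, smul_neg, smul_smul, h2, one_smul, smul_zero] at this
      linear_combination (norm := module) -this
    · have := congrArg (fun x => (2 : k) • x) hγ2
      simp only [smul_add, smul_smul, ← mul_assoc, h2, one_smul, smul_zero,
        _root_.one_mul] at this
      linear_combination (norm := module) -this

/-- The components of a superderivation along the `ιᵢ(C)` form a triality triple. -/
theorem der_tri : (fun i => F.γ i ∘ₗ D ∘ₗ F.ι i) ∈ S.triSubmodule := by
  have hne : (2⁻¹ : k) ≠ 0 := inv_ne_zero (NeZero.ne _)
  refine S.mem_tri (p := p) (fun i => ?_) (fun i => ?_) (fun q r x hx y hy => ?_)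
  · exact mem_part_end.2 fun q a ha =>
      F.γ_mem i (mem_part_end.1 hp q _ (F.ι_mem i ha))
  · refine S.mem_osp (p := p) ?_ fun q r x hx y hy => ?_
    · exact mem_part_end.2 fun q a ha =>
        F.γ_mem i (mem_part_end.1 hp q _ (F.ι_mem i ha))
    · have h := congrArg (F.α (i + 1)) (der_hom hD hp (F.ι_mem i hx) (F.ι i y))
      rw [F.ι_mul_ι, map_smul, map_add, F.der_e hD hp (i + 1), F.der_e hD hp (i + 2)] at h
      simp only [map_add, map_sub, map_smul, F.α_ι, (F.α_mul_ι i _ hy).1, F.α_ι_mul i _ hx,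
        smul_eq_mul, sub_zero, mul_zero, add_zero] at h
      refine (mul_eq_zero.1 (?_ : (2⁻¹ : k) * _ = 0)).resolve_left hne
      simp only [LinearMap.comp_apply]
      linear_combination -h
  · have h := congrArg (F.γ 0) (der_hom hD hp (F.ι_mem 1 hx) (F.ι 2 y))
    have e1 := F.γ_mul_ι 1 (D (F.ι 1 x)) hy
    have e2 := F.γ_ι_mul 1 (D (F.ι 2 y)) hx
    have e3 := F.ι_mul_ι_one 1 x y
    simp only [show (1 + 1 : Fin 3) = 2 from rfl, show (1 + 2 : Fin 3) = 0 from rfl] at e1 e2 e3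
    rw [map_add, map_smul, e1, e2, e3, map_smul, map_smul, smul_comm, ← smul_add] at h
    exact smul_right_injective _ hne h

/-- Every homogeneous superderivation is the sum of one that comes from a triality triple and of
inner ones: `up + down` is `-4` times a commutator of multiplications (`comm1`). -/
theorem exists_der_eq : ∃ d ∈ S.triSubmodule, ∃ y : Fin 3 → C,
    D = F.derOf d - ∑ i, (F.up i (y i) + F.down i (y i)) := by
  -- `D(eⱼ)` has no diagonal component, and the off-diagonal ones of all three are given by `y`
  let y : Fin 3 → C := fun i => F.γ i (D (F.e (i + 2)))
  have hy : ∀ i, y i ∈ part k C p := fun i => by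
    have h := F.γ_mem i (mem_part_end.1 hp 0 _ (F.e_mem (i + 2)))
    rwa [add_zero] at h
  have hDe : ∀ i, D (F.e i) = F.ι (i + 1) (y (i + 1)) - F.ι (i + 2) (y (i + 2)) := by
    intro i
    simpa only [y, fin3_add] using F.der_e hD hp i
  refine ⟨_, F.der_tri hD hp, y, F.ext_all (fun i => ?_) (fun i q a ha => ?_)⟩
  · have e1 := F.up_e_two (i + 1) (y (i + 1))
    have e2 := F.up_e_one (i + 2) (y (i + 2))
    have e3 := F.down_e_two (i + 1) (y (i + 1))
    have e4 := F.down_e_one (i + 2) (y (i + 2))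
    simp only [fin3_add] at e1 e2 e3 e4
    simp only [hDe, LinearMap.sub_apply, sum_fin3 i, LinearMap.add_apply,
      derOf_e, up_e_self, down_e_self, e1, e2, e3, e4]
    module
  · have e1 := F.up_ι_two (i + 1) (y (i + 1)) a
    have e2 := F.up_ι_one (i + 2) (y (i + 2)) a
    have e3 := F.down_ι_two (i + 1) (hy (i + 1)) ha
    have e4 := F.down_ι_one (i + 2) (y (i + 2)) a
    simp only [fin3_add] at e1 e2 e3 e4
    rw [F.der_ι hD hp i ha y hy hDe]
    simp only [LinearMap.sub_apply, sum_fin3 i, LinearMap.add_apply,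
      derOf_ι, up_ι_self, down_ι_self, e1, e2, e3, e4, LinearMap.comp_apply]
    module

end Der

theorem e_ne_zero (i : Fin 3) : F.e i ≠ 0 := by
  intro h
  have h' := F.α_e i i
  simp [h] at h'

include F in
/-- A homogeneous endomorphism that supercommutes with all multiplications is a scalar. It acts
by a scalar on each Peirce component, and the scalars agree because `ιᵢ(a)` is an eigenvector of
the multiplications by `eᵢ₊₁` and `eᵢ₊₂`; an odd one vanishes, since it preserves the even line
`ke₀`. -/
theorem eq_smul_one_of_central [Nontrivial C] {Z : Module.End k W} {p : ZMod 2}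
    (hp : Z ∈ part k (Module.End k W) p) (hZ : ∀ x, (gl k W).mul Z (J.mul x) = 0) :
    ∃ c : k, Z = c • 1 := by
  have h2 := two_mul_half (k := k)
  have hne : (2⁻¹ : k) ≠ 0 := inv_ne_zero (NeZero.ne _)
  have hcomm : ∀ {q x}, x ∈ part k W q → ∀ y, Z (J.mul x y) = sgn k (p * q) • J.mul x (Z y) := by
    intro q x hx y
    have h := LinearMap.congr_fun (hZ x) y
    rwa [gl_mul hp (leftMul_mem J hx), LinearMap.zero_apply, sub_eq_zero] at h
  have he : ∀ i, Z (F.e i) = F.α i (Z (F.e i)) • F.e i := by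
    intro i
    have h := hcomm (F.e_mem i) (F.e i)
    rw [F.e_mul_e, if_pos rfl, mul_zero, sgn_zero, one_smul] at h
    refine F.coord_ext (fun j => ?_) (fun j => ?_)
    · rw [map_smul, F.α_e]
      split_ifs with hj
      · rw [hj, smul_eq_mul, mul_one]
      · rw [h, α_e_mul, if_neg hj, smul_zero]
    · have h' := congrArg (F.γ j) h
      rw [γ_e_mul] at h'
      rw [map_smul, F.γ_e, smul_zero]
      split_ifs at h' with hj
      · exact h'
      · have h3 : (1 - 2⁻¹ : k) • F.γ j (Z (F.e i)) = 0 := by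
          rw [sub_smul, one_smul, ← h', sub_self]
        refine (smul_eq_zero.1 h3).resolve_left fun h4 => hne ?_
        linear_combination h2 + h4
  have hι1 : ∀ i {q a}, a ∈ part k C q →
      Z (F.ι i a) = (sgn k (p * q) * F.α (i + 1) (Z (F.e (i + 1)))) • F.ι i a := by
    intro i q a ha
    have h := hcomm (F.ι_mem i ha) (F.e (i + 1))
    rw [he (i + 1), map_smul, F.ι_mul_e, F.e_mul_ι_one, map_smul] at h
    have h' := congrArg (fun x => (2 : k) • x) h
    simp only [smul_smul, h2, one_smul] at h'
    rw [h']
    congr 1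
    linear_combination (sgn k (p * q) * F.α (i + 1) (Z (F.e (i + 1)))) * h2
  have hι2 : ∀ i {q a}, a ∈ part k C q →
      Z (F.ι i a) = (sgn k (p * q) * F.α (i + 2) (Z (F.e (i + 2)))) • F.ι i a := by
    intro i q a ha
    have h := hcomm (F.ι_mem i ha) (F.e (i + 2))
    rw [he (i + 2), map_smul, F.ι_mul_e, F.e_mul_ι_two, map_smul] at h
    have h' := congrArg (fun x => (2 : k) • x) h
    simp only [smul_smul, h2, one_smul] at h'
    rw [h']
    congr 1
    linear_combination (sgn k (p * q) * F.α (i + 2) (Z (F.e (i + 2)))) * h2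
  obtain ⟨q, a, ha, ha0⟩ : ∃ q, ∃ a ∈ part k C q, a ≠ 0 := by
    obtain ⟨a, ha⟩ := exists_ne (0 : C)
    by_contra! h
    refine ha ?_
    rw [← proj_add (k := k) a, h 0 _ (proj_mem 0 a), h 1 _ (proj_mem 1 a), add_zero]
  have hc : ∀ i, F.α (i + 1) (Z (F.e (i + 1))) = F.α (i + 2) (Z (F.e (i + 2))) := by
    intro i
    have h := congrArg (F.γ i) ((hι1 i ha).symm.trans (hι2 i ha))
    rw [map_smul, map_smul, F.γ_ι, if_pos rfl] at h
    have h' := smul_left_injective k ha0 h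
    have hs := sgn_mul_self (k := k) (p * q)
    have h4 := congrArg (sgn k (p * q) * ·) h'
    simpa only [← mul_assoc, hs, _root_.one_mul] using h4
  have hc' : ∀ i, F.α i (Z (F.e i)) = F.α 0 (Z (F.e 0)) := by
    intro i
    have h0 := hc 0
    have h1 := hc 1
    have h2 := hc 2
    fin_cases i
    · rfl
    · exact h2.symm
    · exact h1
  rcases zmod2 p with rfl | rfl
  · refine ⟨F.α 0 (Z (F.e 0)), F.ext_all (fun i => ?_) (fun i q a ha => ?_)⟩
    · rw [he, hc']; rfl
    · rw [hι1 i ha, hc', zero_mul, sgn_zero, _root_.one_mul]; rfl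
  · have h0 : F.α 0 (Z (F.e 0)) = 0 := by
      have h := mem_part_end.1 hp 0 _ (F.e_mem 0)
      rw [he] at h
      have h' := proj_of_mem (i := 0) (Submodule.smul_mem _ (F.α 0 (Z (F.e 0))) (F.e_mem 0))
      rw [proj_of_mem h, if_neg (by decide), if_pos rfl] at h'
      exact (smul_eq_zero.1 h'.symm).resolve_right (F.e_ne_zero 0)
    refine ⟨0, F.ext_all (fun i => ?_) (fun i q a ha => ?_)⟩
    · rw [he, hc', h0]; simp
    · rw [hι1 i ha, hc', h0]; simp

end PeirceFrame

/-! ### Generators of `𝔤(S, S')` -/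

section MagicGenerators

variable {k : Type*} [Field k]
variable {C : Type*} [AddCommGroup C] [Module k C] [Superspace k C]
variable {C' : Type*} [AddCommGroup C'] [Module k C'] [Superspace k C']
variable (S : SymmetricCompositionSuperalgebra k C) (S' : SymmetricCompositionSuperalgebra k C')

/-- The inclusion of `𝔱𝔯𝔦(S) ⊕ 𝔱𝔯𝔦(S')` in `𝔤(S, S')`. -/
def ofTri : (S.tri.toSubmodule × S'.tri.toSubmodule) →ₗ[k] MagicSpace S S' :=
  LinearMap.inl k _ (Fin 3 → C ⊗[k] C')

/-- The inclusion of `ιᵢ(S ⊗ S')` in `𝔤(S, S')`. -/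
def ofTensor (i : Fin 3) : (C ⊗[k] C') →ₗ[k] MagicSpace S S' :=
  LinearMap.inr k (S.tri.toSubmodule × S'.tri.toSubmodule) _ ∘ₗ
    LinearMap.single k (fun _ : Fin 3 => C ⊗[k] C') i

variable {S S'}

theorem ofTri_fst (d : S.tri.toSubmodule × S'.tri.toSubmodule) : (ofTri S S' d).1 = d := rfl

theorem ofTri_snd (d : S.tri.toSubmodule × S'.tri.toSubmodule) (j : Fin 3) :
    (ofTri S S' d).2 j = 0 := rfl

theorem ofTensor_fst (i : Fin 3) (w : C ⊗[k] C') : (ofTensor S S' i w).1 = 0 := rfl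

theorem ofTensor_snd (i j : Fin 3) (w : C ⊗[k] C') :
    (ofTensor S S' i w).2 j = if j = i then w else 0 := by
  change Pi.single (M := fun _ : Fin 3 => C ⊗[k] C') i w j = _
  rw [Pi.single_apply]

theorem magic_eq_sum (X : MagicSpace S S') :
    X = ofTri S S' X.1 + ∑ i, ofTensor S S' i (X.2 i) := by
  refine Prod.ext ?_ (funext fun j => ?_)
  · simp only [Prod.fst_add, Prod.fst_sum, ofTri_fst, ofTensor_fst, Finset.sum_const_zero,
      add_zero]
  · simp only [Prod.snd_add, Prod.snd_sum, Pi.add_apply, Finset.sum_apply, ofTri_snd,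
      ofTensor_snd, Finset.sum_ite_eq, Finset.mem_univ, if_true, zero_add]

theorem ofTri_mem {p : ZMod 2} {d : S.tri.toSubmodule} {d' : S'.tri.toSubmodule}
    (hd : d ∈ part k _ p) (hd' : d' ∈ part k _ p) :
    ofTri S S' (d, d') ∈ part k (MagicSpace S S') p :=
  Prod.ext (Prod.ext hd hd') (map_zero (proj k p))

theorem ofTensor_mem (i : Fin 3) {p : ZMod 2} {w : C ⊗[k] C'} (hw : w ∈ part k _ p) :
    ofTensor S S' i w ∈ part k (MagicSpace S S') p := by
  refine Prod.ext (Prod.ext ?_ ?_) (funext fun j => ?_)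
  · exact (proj k p : S.tri.toSubmodule →ₗ[k] _).map_zero
  · exact (proj k p : S'.tri.toSubmodule →ₗ[k] _).map_zero
  · change proj k p ((ofTensor S S' i w).2 j) = (ofTensor S S' i w).2 j
    rw [ofTensor_snd]
    split_ifs
    · exact hw
    · exact map_zero _

variable [NeZero (2 : k)]

theorem magic_fst_fst (X Y : MagicSpace S S') : ((magic S S').mul X Y).1.1
    = S.tri.alg.mul X.1.1 Y.1.1 + ∑ i, toTri S S' i (X.2 i) (Y.2 i) := rfl

theorem magic_fst_snd (X Y : MagicSpace S S') : ((magic S S').mul X Y).1.2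
    = S'.tri.alg.mul X.1.2 Y.1.2 + ∑ i, toTri' S S' i (X.2 i) (Y.2 i) := rfl

theorem magic_snd (X Y : MagicSpace S S') (i : Fin 3) : ((magic S S').mul X Y).2 i
    = leftAct S i X.1.1 (Y.2 i) + rightAct S' i X.1.2 (Y.2 i)
        - superSwap (leftAct S i) (X.2 i) Y.1.1 - superSwap (rightAct S' i) (X.2 i) Y.1.2
        + tensorMul S S' (X.2 (i + 1)) (Y.2 (i + 2))
        - superSwap (tensorMul S S') (X.2 (i + 2)) (Y.2 (i + 1)) := rfl

theorem magic_ofTri_ofTri (d e : S.tri.toSubmodule × S'.tri.toSubmodule) :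
    (magic S S').mul (ofTri S S' d) (ofTri S S' e)
      = ofTri S S' (S.tri.alg.mul d.1 e.1, S'.tri.alg.mul d.2 e.2) := by
  refine Prod.ext (Prod.ext ?_ ?_) (funext fun j => ?_) <;>
    simp only [magic_fst_fst, magic_fst_snd, magic_snd, ofTri_fst, ofTri_snd, LinearMap.map_zero,
      LinearMap.zero_apply, Finset.sum_const_zero, add_zero, sub_zero]

theorem magic_ofTri_ofTensor (d : S.tri.toSubmodule × S'.tri.toSubmodule) (i : Fin 3)
    (w : C ⊗[k] C') : (magic S S').mul (ofTri S S' d) (ofTensor S S' i w)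
      = ofTensor S S' i (leftAct S i d.1 w + rightAct S' i d.2 w) := by
  refine Prod.ext (Prod.ext ?_ ?_) (funext fun j => ?_)
  · simp only [magic_fst_fst, ofTri_fst, ofTri_snd, ofTensor_fst, LinearMap.map_zero,
      LinearMap.zero_apply, Finset.sum_const_zero, add_zero, Prod.fst_zero]
  · simp only [magic_fst_snd, ofTri_fst, ofTri_snd, ofTensor_fst, LinearMap.map_zero,
      LinearMap.zero_apply, Finset.sum_const_zero, add_zero, Prod.snd_zero]
  · simp only [magic_snd, ofTri_fst, ofTri_snd, ofTensor_fst, LinearMap.map_zero,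
      LinearMap.zero_apply, add_zero, sub_zero, ofTensor_snd]
    split_ifs with h
    · rw [h]
    · rw [LinearMap.map_zero, LinearMap.map_zero, add_zero]

theorem magic_ofTensor_ofTri (d : S.tri.toSubmodule × S'.tri.toSubmodule) (i : Fin 3)
    {p q : ZMod 2} {w : C ⊗[k] C'} (hw : w ∈ part k _ p) (hd : d.1 ∈ part k _ q)
    (hd' : d.2 ∈ part k _ q) : (magic S S').mul (ofTensor S S' i w) (ofTri S S' d)
      = -(sgn k (p * q) • (magic S S').mul (ofTri S S' d) (ofTensor S S' i w)) := by
  rw [magic_ofTri_ofTensor, ← LinearMap.map_smul, ← LinearMap.map_neg]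
  refine Prod.ext (Prod.ext ?_ ?_) (funext fun j => ?_)
  · simp only [magic_fst_fst, ofTri_fst, ofTri_snd, ofTensor_fst, LinearMap.map_zero,
      LinearMap.zero_apply, Finset.sum_const_zero, add_zero, Prod.fst_zero]
  · simp only [magic_fst_snd, ofTri_fst, ofTri_snd, ofTensor_fst, LinearMap.map_zero,
      LinearMap.zero_apply, Finset.sum_const_zero, add_zero, Prod.snd_zero]
  · simp only [magic_snd, ofTri_fst, ofTri_snd, ofTensor_fst, LinearMap.map_zero,
      add_zero, sub_zero, ofTensor_snd, Prod.fst_zero, Prod.snd_zero]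
    split_ifs with h
    · rw [h, superSwap_apply _ hw hd, superSwap_apply _ hw hd']
      module
    · simp only [LinearMap.map_zero, LinearMap.zero_apply, sub_zero]

theorem magic_ofTensor_self (i : Fin 3) (w w' : C ⊗[k] C') :
    (magic S S').mul (ofTensor S S' i w) (ofTensor S S' i w')
      = ofTri S S' (toTri S S' i w w', toTri' S S' i w w') := by
  refine Prod.ext (Prod.ext ?_ ?_) (funext fun j => ?_)
  · simp only [magic_fst_fst, ofTri_fst, ofTensor_fst, ofTensor_snd, sum_fin3 i, fin3_ne, if_true,
      if_false, LinearMap.map_zero, add_zero, zero_add, Prod.fst_zero]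
  · simp only [magic_fst_snd, ofTri_fst, ofTensor_fst, ofTensor_snd, sum_fin3 i, fin3_ne, if_true,
      if_false, LinearMap.map_zero, add_zero, zero_add, Prod.snd_zero]
  · simp only [magic_snd, ofTri_snd, ofTensor_fst, ofTensor_snd, LinearMap.map_zero,
      Prod.fst_zero, Prod.snd_zero, LinearMap.zero_apply]
    obtain rfl | rfl | rfl := fin3_cases i j <;>
    simp only [fin3_add, fin3_ne, if_true, if_false, LinearMap.map_zero, LinearMap.zero_apply,
      add_zero, sub_zero]

theorem magic_ofTensor_succ (i : Fin 3) (w w' : C ⊗[k] C') :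
    (magic S S').mul (ofTensor S S' i w) (ofTensor S S' (i + 1) w')
      = ofTensor S S' (i + 2) (tensorMul S S' w w') := by
  refine Prod.ext (Prod.ext ?_ ?_) (funext fun j => ?_)
  · simp only [magic_fst_fst, ofTensor_fst, ofTensor_snd, sum_fin3 i, fin3_ne, if_true,
      if_false, LinearMap.map_zero, LinearMap.zero_apply, add_zero, Prod.fst_zero]
  · simp only [magic_fst_snd, ofTensor_fst, ofTensor_snd, sum_fin3 i, fin3_ne, if_true,
      if_false, LinearMap.map_zero, LinearMap.zero_apply, add_zero, Prod.snd_zero]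
  · simp only [magic_snd, ofTensor_fst, ofTensor_snd, LinearMap.map_zero,
      Prod.fst_zero, Prod.snd_zero, LinearMap.zero_apply]
    obtain rfl | rfl | rfl := fin3_cases i j <;>
    simp only [fin3_add, fin3_ne, if_true, if_false, LinearMap.map_zero, LinearMap.zero_apply,
      add_zero, zero_add, sub_zero]

theorem magic_ofTensor_succ_swap (i : Fin 3) {p q : ZMod 2} {w w' : C ⊗[k] C'}
    (hw : w ∈ part k _ p) (hw' : w' ∈ part k _ q) :
    (magic S S').mul (ofTensor S S' (i + 1) w) (ofTensor S S' i w')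
      = -(sgn k (p * q) • (magic S S').mul (ofTensor S S' i w') (ofTensor S S' (i + 1) w)) := by
  rw [magic_ofTensor_succ, ← LinearMap.map_smul, ← LinearMap.map_neg]
  refine Prod.ext (Prod.ext ?_ ?_) (funext fun j => ?_)
  · simp only [magic_fst_fst, ofTensor_fst, ofTensor_snd, sum_fin3 i, fin3_ne, if_true,
      if_false, LinearMap.map_zero, LinearMap.zero_apply, add_zero, Prod.fst_zero]
  · simp only [magic_fst_snd, ofTensor_fst, ofTensor_snd, sum_fin3 i, fin3_ne, if_true,
      if_false, LinearMap.map_zero, LinearMap.zero_apply, add_zero, Prod.snd_zero]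
  · simp only [magic_snd, ofTensor_fst, ofTensor_snd, LinearMap.map_zero,
      Prod.fst_zero, Prod.snd_zero, LinearMap.zero_apply]
    obtain rfl | rfl | rfl := fin3_cases i j <;>
    simp only [fin3_add, fin3_ne, if_true, if_false, LinearMap.map_zero, LinearMap.zero_apply,
      add_zero, sub_zero, zero_sub, superSwap_apply _ hw hw']

end MagicGenerators

/-! ### The para-Hurwitz algebra `S₂` of `k × k` and its triality algebra -/

section Split

variable {k : Type*} [Field k]

theorem split_mul (x y : EvenOdd (k × k) Unit) :
    (splitK k).para.mul x y = ⟨(x.even.2 * y.even.2, x.even.1 * y.even.1), 0⟩ := by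
  have hc : ∀ x, (splitK k).conj x = ⟨(x.even.2, x.even.1), 0⟩ := by
    intro x
    rw [HurwitzSuperalgebra.conj_apply]
    have e : (splitK k).b x (splitK k).one = x.even.1 * 1 + x.even.2 * 1 := rfl
    rw [e]
    have hs : ∀ x y : EvenOdd (k × k) Unit, (x - y).even = x.even - y.even := fun _ _ => rfl
    ext <;> simp [hs, splitK]
  change (splitK k).mul ((splitK k).conj x) ((splitK k).conj y) = _
  rw [hc, hc]
  rfl

theorem split_b (x y : EvenOdd (k × k) Unit) :
    (splitK k).para.b x y = x.even.1 * y.even.2 + x.even.2 * y.even.1 := rfl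

variable (k) in
/-- The isotropic element `(1, 0)` of `k × k`, called `u`. -/
def splitU : EvenOdd (k × k) Unit := ⟨(1, 0), 0⟩

variable (k) in
/-- The isotropic element `(0, 1)` of `k × k`, called `v`. -/
def splitV : EvenOdd (k × k) Unit := ⟨(0, 1), 0⟩

theorem splitU_mem : splitU k ∈ part k (EvenOdd (k × k) Unit) 0 := rfl

theorem splitV_mem : splitV k ∈ part k (EvenOdd (k × k) Unit) 0 := rfl

theorem split_mem (x : EvenOdd (k × k) Unit) : x ∈ part k (EvenOdd (k × k) Unit) 0 := rfl

theorem split_eq (x : EvenOdd (k × k) Unit) :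
    x = x.even.1 • splitU k + x.even.2 • splitV k := by
  ext <;> simp [splitU, splitV]

theorem split_end_mem (f : Module.End k (EvenOdd (k × k) Unit)) :
    f ∈ part k (Module.End k (EvenOdd (k × k) Unit)) 0 := by
  refine mem_part_end.2 fun j x hx => ?_
  rw [zero_add]
  rcases zmod2 j with rfl | rfl
  · rfl
  · have : x = 0 := EvenOdd.ext (EvenOdd.mem_one.1 hx) rfl
    rw [this, map_zero]
    exact Submodule.zero_mem _

/-- The eigenvalue of `dⱼ` at `u`, for `d ∈ 𝔱𝔯𝔦(S₂)`; at `v` it is the negative of it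
(`split_tri_apply`). -/
def triCoeff (j : Fin 3) : (splitK k).para.tri.toSubmodule →ₗ[k] k where
  toFun d := ((d : Fin 3 → Module.End k _) j (splitU k)).even.1
  map_add' _ _ := rfl
  map_smul' _ _ := rfl

theorem triCoeff_theta (i j : Fin 3) (d : (splitK k).para.tri.toSubmodule) :
    triCoeff j ((splitK k).para.theta i d) = triCoeff (j - i) d := rfl

variable [NeZero (2 : k)]

theorem split_tri_apply (d : (splitK k).para.tri.toSubmodule) (j : Fin 3) :
    (d : Fin 3 → Module.End k _) j (splitU k) = triCoeff j d • splitU k ∧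
    (d : Fin 3 → Module.End k _) j (splitV k) = -triCoeff j d • splitV k := by
  have h := fun x y => SymmetricCompositionSuperalgebra.osp_hom (d.2.1 j) (split_end_mem _)
    (split_mem x) y
  have h1 := h (splitU k) (splitU k)
  have h2 := h (splitV k) (splitV k)
  have h3 := h (splitU k) (splitV k)
  have h0 : (2 : k) ≠ 0 := NeZero.ne _
  simp only [split_b, mul_zero, sgn_zero, splitU, splitV, mul_one, zero_mul, one_mul, add_zero,
    zero_add] at h1 h2 h3
  have e1 : ∀ a : k, a = -a → a = 0 := fun a ha => by
    have : 2 * a = 0 := by linear_combination ha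
    exact (mul_eq_zero.1 this).resolve_left h0
  refine ⟨EvenOdd.ext (Prod.ext ?_ ?_) rfl, EvenOdd.ext (Prod.ext ?_ ?_) rfl⟩
  · simp [triCoeff, splitU]
  · simpa [triCoeff, splitU] using e1 _ h1
  · simpa [triCoeff, splitV, -neg_smul] using e1 _ h2
  · simp [triCoeff, splitV, splitU, h3, -neg_smul]

/-- This is the triality relation at `u • u = v`. -/
theorem split_tri_sum (d : (splitK k).para.tri.toSubmodule) :
    triCoeff 0 d + triCoeff 1 d + triCoeff 2 d = 0 := by
  have h := SymmetricCompositionSuperalgebra.tri_hom d.2 (fun _ => split_end_mem _)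
    (split_mem (splitU k)) (splitU k)
  have e : (splitK k).para.mul (splitU k) (splitU k) = splitV k := by
    rw [split_mul]; simp [splitU, splitV]
  rw [e, (split_tri_apply d 0).2, (split_tri_apply d 1).1, (split_tri_apply d 2).1, map_smul,
    map_smul, LinearMap.smul_apply, e, mul_zero, sgn_zero, one_smul] at h
  have h' := congrArg (fun x => x.even.2) h
  simp [splitV, -neg_smul] at h'
  linear_combination -h'

theorem split_tri_ext {d : (splitK k).para.tri.toSubmodule} (h : ∀ j, triCoeff j d = 0) :
    d = 0 := by
  refine Subtype.ext (funext fun j => LinearMap.ext fun x => ?_)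
  rw [split_eq x, map_add, map_smul, map_smul, (split_tri_apply d j).1, (split_tri_apply d j).2, h]
  simp

theorem split_tri_mul (d e : (splitK k).para.tri.toSubmodule) :
    (splitK k).para.tri.alg.mul d e = 0 := by
  refine split_tri_ext fun j => ?_
  change ((gl k _).mul ((d : Fin 3 → Module.End k _) j) ((e : Fin 3 → Module.End k _) j)
    (splitU k)).even.1 = 0
  rw [gl_mul (split_end_mem _) (split_end_mem _), (split_tri_apply d j).1,
    (split_tri_apply e j).1, map_smul, map_smul, (split_tri_apply d j).1,
    (split_tri_apply e j).1, mul_zero, sgn_zero, one_smul, smul_smul, smul_smul, mul_comm, sub_self]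
  rfl

theorem triCoeff_tElem (x y : EvenOdd (k × k) Unit) :
    triCoeff 0 ((splitK k).para.tElem x y)
      = x.even.2 * y.even.1 - x.even.1 * y.even.2 ∧
    triCoeff 1 ((splitK k).para.tElem x y)
      = 2⁻¹ * (x.even.1 * y.even.2 - x.even.2 * y.even.1) ∧
    triCoeff 2 ((splitK k).para.tElem x y)
      = 2⁻¹ * (x.even.1 * y.even.2 - x.even.2 * y.even.1) := by
  have hs : ∀ x y : EvenOdd (k × k) Unit, (x - y).even = x.even - y.even := fun _ _ => rfl
  have h2 : (2 : k) * 2⁻¹ = 1 := mul_inv_cancel₀ (NeZero.ne _)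
  refine ⟨?_, ?_, ?_⟩
  · change ((splitK k).para.tTriple x y 0 (splitU k)).even.1 = _
    rw [PeirceFrame.sigma_eq (split_mem x) (split_mem y) splitU_mem]
    simp [hs, split_b, splitU, sgn_zero, mul_comm]
  · change ((splitK k).para.tTriple x y 1 (splitU k)).even.1 = _
    rw [SymmetricCompositionSuperalgebra.tTriple_apply_one (split_mem x) (split_mem y) splitU_mem]
    simp [hs, split_b, splitU, sgn_zero, split_mul]
    linear_combination x.even.2 * y.even.1 * h2
  · change ((splitK k).para.tTriple x y 2 (splitU k)).even.1 = _
    rw [SymmetricCompositionSuperalgebra.tTriple_apply_two (split_mem y) splitU_mem]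
    simp [hs, split_b, splitU, sgn_zero, split_mul]
    linear_combination x.even.2 * y.even.1 * h2

end Split

/-! ### Linear maps that preserve brackets up to a subspace -/

section Defect

variable {k : Type*} [Field k] [NeZero (2 : k)]
variable {C : Type*} [AddCommGroup C] [Module k C] [Superspace k C]
variable {C' : Type*} [AddCommGroup C'] [Module k C'] [Superspace k C']
variable {W : Type*} [AddCommGroup W] [Module k W] [Superspace k W]
variable {S : SymmetricCompositionSuperalgebra k C} {S' : SymmetricCompositionSuperalgebra k C'}

/-- To prove that a subspace of `𝔤(S, S')` is everything, it is enough to consider the homogeneous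
elements of `𝔱𝔯𝔦(S) ⊕ 𝔱𝔯𝔦(S')` and the elements `ιᵢ(x ⊗ y)` with `x` and `y` homogeneous. -/
theorem magic_induction (N : Submodule k (MagicSpace S S'))
    (h1 : ∀ p, ∀ d ∈ part k S.tri.toSubmodule p, ∀ d' ∈ part k S'.tri.toSubmodule p,
      ofTri S S' (d, d') ∈ N)
    (h2 : ∀ i p q, ∀ x ∈ part k C p, ∀ y ∈ part k C' q, ofTensor S S' i (x ⊗ₜ y) ∈ N)
    (X : MagicSpace S S') : X ∈ N := by
  rw [magic_eq_sum X]
  refine N.add_mem ?_ (N.sum_mem fun i _ => ?_)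
  · have : ofTri S S' X.1
        = ofTri S S' (proj k 0 X.1.1, proj k 0 X.1.2)
          + ofTri S S' (proj k 1 X.1.1, proj k 1 X.1.2) := by
      rw [← map_add, Prod.mk_add_mk, proj_add, proj_add]
    rw [this]
    exact N.add_mem (h1 0 _ (proj_mem _ _) _ (proj_mem _ _))
      (h1 1 _ (proj_mem _ _) _ (proj_mem _ _))
  · induction X.2 i with
    | zero => rw [map_zero]; exact N.zero_mem
    | add w w' h h' => rw [map_add]; exact N.add_mem h h'
    | tmul x y =>
      exact mem_of_hom ((TensorProduct.mk k C C').compr₂ (ofTensor S S' i)) N x y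
        fun p q => h2 i p q _ (proj_mem _ _) _ (proj_mem _ _)

/-- The failure `ρ[X, Y] - [ρ(X), ρ(Y)]` of a linear map `ρ : 𝔤(S, S') → 𝔤𝔩(W)` to preserve
brackets. -/
def defect (ρ : MagicSpace S S' →ₗ[k] Module.End k W) :
    MagicSpace S S' →ₗ[k] MagicSpace S S' →ₗ[k] Module.End k W :=
  (magic S S').mul.compr₂ ρ - (gl k W).mul.compl₁₂ ρ ρ

variable {ρ : MagicSpace S S' →ₗ[k] Module.End k W}

theorem defect_apply (X Y : MagicSpace S S') :
    defect ρ X Y = ρ ((magic S S').mul X Y) - (gl k W).mul (ρ X) (ρ Y) := rfl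

theorem defect_swap
    (hρ : ∀ p, ∀ X ∈ part k (MagicSpace S S') p, ρ X ∈ part k (Module.End k W) p)
    {p q : ZMod 2} {X Y : MagicSpace S S'} (hX : X ∈ part k _ p) (hY : Y ∈ part k _ q)
    (h : (magic S S').mul X Y = -(sgn k (p * q) • (magic S S').mul Y X)) :
    defect ρ X Y = -(sgn k (p * q) • defect ρ Y X) := by
  rw [defect_apply, defect_apply, h, gl_anticomm (hρ _ _ hX) (hρ _ _ hY), map_neg, map_smul]
  module

/-- Since the brackets on both sides are superanticommutative, it is enough to bound the defect of a
linear map on four kinds of pairs of generators. -/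
theorem defect_mem_of_generators
    (hρ : ∀ p, ∀ X ∈ part k (MagicSpace S S') p, ρ X ∈ part k (Module.End k W) p)
    (N : Submodule k (Module.End k W))
    (h1 : ∀ p q, ∀ d ∈ part k S.tri.toSubmodule p, ∀ d' ∈ part k S'.tri.toSubmodule p,
      ∀ e ∈ part k S.tri.toSubmodule q, ∀ e' ∈ part k S'.tri.toSubmodule q,
      defect ρ (ofTri S S' (d, d')) (ofTri S S' (e, e')) ∈ N)
    (h2 : ∀ p q r, ∀ d ∈ part k S.tri.toSubmodule p, ∀ d' ∈ part k S'.tri.toSubmodule p,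
      ∀ i, ∀ x ∈ part k C q, ∀ y ∈ part k C' r,
      defect ρ (ofTri S S' (d, d')) (ofTensor S S' i (x ⊗ₜ y)) ∈ N)
    (h3 : ∀ p q r s, ∀ x ∈ part k C p, ∀ a ∈ part k C' q, ∀ y ∈ part k C r, ∀ b ∈ part k C' s,
      ∀ i, defect ρ (ofTensor S S' i (x ⊗ₜ a)) (ofTensor S S' i (y ⊗ₜ b)) ∈ N)
    (h4 : ∀ p q r s, ∀ x ∈ part k C p, ∀ a ∈ part k C' q, ∀ y ∈ part k C r, ∀ b ∈ part k C' s,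
      ∀ i, defect ρ (ofTensor S S' i (x ⊗ₜ a)) (ofTensor S S' (i + 1) (y ⊗ₜ b)) ∈ N)
    (X Y : MagicSpace S S') : defect ρ X Y ∈ N := by
  refine magic_induction (N.comap ((defect ρ).flip Y)) (fun p d hd d' hd' => ?_)
    (fun i p q x hx a ha => ?_) X
  · refine magic_induction (N.comap (defect ρ (ofTri S S' (d, d')))) (fun q e he e' he' => ?_)
      (fun j q r y hy b hb => ?_) Y
    · exact h1 p q d hd d' hd' e he e' he'
    · exact h2 p q r d hd d' hd' j y hy b hb
  · refine magic_induction (N.comap (defect ρ (ofTensor S S' i (x ⊗ₜ a))))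
      (fun r e he e' he' => ?_) (fun j r s y hy b hb => ?_) Y
    · rw [Submodule.mem_comap, defect_swap hρ (ofTensor_mem i (tmul_mem hx ha))
        (ofTri_mem he he') (magic_ofTensor_ofTri (e, e') i (tmul_mem hx ha) he he')]
      exact N.neg_mem (N.smul_mem _ (h2 r p q e he e' he' i x hx a ha))
    · rw [Submodule.mem_comap]
      obtain rfl | rfl | rfl := fin3_cases i j
      · exact h3 p q r s x hx a ha y hy b hb _
      · exact h4 p q r s x hx a ha y hy b hb i
      -- for `j = i + 2` the pair is swapped, since then `i = j + 1`
      · obtain ⟨l, rfl⟩ : ∃ l, i = l + 1 := ⟨i + 2, fin3_add i |>.2.2.1.symm⟩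
        rw [(fin3_add l).2.1, defect_swap hρ (ofTensor_mem _ (tmul_mem hx ha))
          (ofTensor_mem _ (tmul_mem hy hb))
          (magic_ofTensor_succ_swap l (tmul_mem hx ha) (tmul_mem hy hb))]
        exact N.neg_mem (N.smul_mem _ (h4 r s p q y hy b hb x hx a ha l))

end Defect

/-! ### The representation of `𝔤(S₂, S)` modulo scalars -/

namespace PeirceFrame

variable {k : Type*} [Field k] [NeZero (2 : k)]
variable {C : Type*} [AddCommGroup C] [Module k C] [Superspace k C]
variable {W : Type*} [AddCommGroup W] [Module k W] [Superspace k W]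
variable {S : SymmetricCompositionSuperalgebra k C} {J : Superalgebra k W} (F : PeirceFrame S J)

/-- A diagonal whose differences `cᵢ₊₁ - cᵢ₊₂` are the eigenvalues of `d ∈ 𝔱𝔯𝔦(S₂)`. It is
determined by this up to adding a constant; the choice made here is `c₂ = 0`. -/
def triDiag : (splitK k).para.tri.toSubmodule →ₗ[k] (Fin 3 → k) :=
  LinearMap.pi ![-triCoeff 1, triCoeff 0, 0]

theorem triDiag_sub (d : (splitK k).para.tri.toSubmodule) (i : Fin 3) :
    triDiag d (i + 1) - triDiag d (i + 2) = triCoeff i d := by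
  have h := split_tri_sum d
  fin_cases i
  · simp [triDiag]
  · simp [triDiag]
  · simp [triDiag]
    linear_combination -h

/-- The operator that represents `ιᵢ(x ⊗ a)`, namely `up i a` for `x = u` and `down i a` for
`x = v`. -/
def tensorOp (i : Fin 3) : (EvenOdd (k × k) Unit ⊗[k] C) →ₗ[k] Module.End k W :=
  TensorProduct.lift <| LinearMap.mk₂ k
    (fun x a => x.even.1 • F.up i a + x.even.2 • F.down i a)
    (fun _ _ _ => by simp only [EvenOdd.even_add, Prod.fst_add, Prod.snd_add]; module)
    (fun _ _ _ => by
      simp only [EvenOdd.even_smul, Prod.smul_fst, Prod.smul_snd, smul_eq_mul]; module)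
    (fun _ _ _ => by simp only [map_add]; module)
    (fun _ _ _ => by simp only [map_smul]; module)

theorem tensorOp_tmul (i : Fin 3) (x : EvenOdd (k × k) Unit) (a : C) :
    F.tensorOp i (x ⊗ₜ a) = x.even.1 • F.up i a + x.even.2 • F.down i a := rfl

theorem tensorOp_U (i : Fin 3) (a : C) : F.tensorOp i (splitU k ⊗ₜ a) = F.up i a := by
  simp [tensorOp_tmul, splitU]

theorem tensorOp_V (i : Fin 3) (a : C) : F.tensorOp i (splitV k ⊗ₜ a) = F.down i a := by
  simp [tensorOp_tmul, splitV]

theorem exists_eq_add (w : EvenOdd (k × k) Unit ⊗[k] C) :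
    ∃ a b : C, w = splitU k ⊗ₜ a + splitV k ⊗ₜ b := by
  induction w with
  | zero => exact ⟨0, 0, by simp⟩
  | tmul x a =>
    refine ⟨x.even.1 • a, x.even.2 • a, ?_⟩
    conv_lhs => rw [split_eq x]
    rw [TensorProduct.add_tmul, TensorProduct.smul_tmul, TensorProduct.smul_tmul]
  | add w w' h h' =>
    obtain ⟨a, b, rfl⟩ := h
    obtain ⟨a', b', rfl⟩ := h'
    refine ⟨a + a', b + b', ?_⟩
    rw [TensorProduct.tmul_add, TensorProduct.tmul_add]
    abel

/-- The linear map from `𝔤(S₂, S)` to the structure superalgebra of `J`. It preserves brackets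
only up to scalars, because of the choice of a diagonal in `triDiag`. -/
def rep : MagicSpace (splitK k).para S →ₗ[k] Module.End k W :=
  (F.diag ∘ₗ triDiag).coprod (F.derOf ∘ₗ S.tri.toSubmodule.subtype) ∘ₗ LinearMap.fst k _ _ +
    ∑ i, F.tensorOp i ∘ₗ LinearMap.proj i ∘ₗ LinearMap.snd k _ _

theorem rep_apply (X : MagicSpace (splitK k).para S) :
    F.rep X = F.diag (triDiag X.1.1) + F.derOf X.1.2 + ∑ i, F.tensorOp i (X.2 i) := by
  simp [rep]

theorem rep_ofTri (d : (splitK k).para.tri.toSubmodule × S.tri.toSubmodule) :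
    F.rep (ofTri _ _ d) = F.diag (triDiag d.1) + F.derOf d.2 := by
  simp only [rep_apply, ofTri_fst, ofTri_snd, map_zero, Finset.sum_const_zero, add_zero]

theorem rep_ofTensor (i : Fin 3) (w : EvenOdd (k × k) Unit ⊗[k] C) :
    F.rep (ofTensor _ _ i w) = F.tensorOp i w := by
  simp only [rep_apply, ofTensor_fst, ofTensor_snd, sum_fin3 i, fin3_ne, if_true, if_false,
    map_zero, add_zero, Prod.fst_zero, Prod.snd_zero, ZeroMemClass.coe_zero, zero_add]

/-- `𝔱𝔯𝔦(S₂)` is even. -/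
theorem triDiag_odd {d : (splitK k).para.tri.toSubmodule}
    (hd : d ∈ part k (splitK k).para.tri.toSubmodule 1) : d = 0 := by
  refine split_tri_ext fun j => ?_
  have h := mem_part_end.1 (SymmetricCompositionSuperalgebra.mem_part_tri.1 hd j) 0 _ splitU_mem
  exact congrArg Prod.fst (EvenOdd.mem_one.1 h)

theorem tensorOp_mem (i : Fin 3) {p : ZMod 2} {w : EvenOdd (k × k) Unit ⊗[k] C}
    (hw : w ∈ part k _ p) : F.tensorOp i w ∈ part k (Module.End k W) p := by
  refine tensor_induction ((part k (Module.End k W) p).comap (F.tensorOp i))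
    (fun q r hqr x hx a ha => ?_) hw
  rw [Submodule.mem_comap, tensorOp_tmul]
  rcases zmod2 q with rfl | rfl
  · rw [zero_add] at hqr
    subst hqr
    exact Submodule.add_mem _ (Submodule.smul_mem _ _ (F.up_mem i ha))
      (Submodule.smul_mem _ _ (F.down_mem i ha))
  · rw [EvenOdd.mem_one.1 hx, Prod.fst_zero, Prod.snd_zero, zero_smul, zero_smul, add_zero]
    exact Submodule.zero_mem _

theorem rep_mem {p : ZMod 2} {X : MagicSpace (splitK k).para S} (hX : X ∈ part k _ p) :
    F.rep X ∈ part k (Module.End k W) p := by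
  have h1 : X.1.1 ∈ part k _ p := congrArg (fun Z : MagicSpace _ S => Z.1.1) hX
  have h2 : X.1.2 ∈ part k _ p := congrArg (fun Z : MagicSpace _ S => Z.1.2) hX
  have h3 : ∀ i, X.2 i ∈ part k _ p := fun i => congrArg (fun Z : MagicSpace _ S => Z.2 i) hX
  rw [rep_apply]
  refine Submodule.add_mem _ (Submodule.add_mem _ ?_ ?_) (Submodule.sum_mem _ fun i _ => ?_)
  · rcases zmod2 p with rfl | rfl
    · exact F.diag_mem _
    · rw [triDiag_odd h1, map_zero, map_zero]
      exact Submodule.zero_mem _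
  · exact F.derOf_mem (SymmetricCompositionSuperalgebra.mem_part_tri.1 h2)
  · exact F.tensorOp_mem i (h3 i)

theorem rep_mem_str (X : MagicSpace (splitK k).para S) : F.rep X ∈ (str J).toSubmodule := by
  rw [rep_apply]
  refine Submodule.add_mem _ (Submodule.add_mem _ (F.diag_mem_str _)
    (der_le_str (F.derOf_mem_der X.1.2.2))) (Submodule.sum_mem _ fun i _ => ?_)
  obtain ⟨a, b, h⟩ := exists_eq_add (X.2 i)
  rw [h, map_add, tensorOp_U, tensorOp_V]
  exact Submodule.add_mem _ (F.up_mem_str i a) (F.down_mem_str i b)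

variable (k W) in
/-- The scalar multiples of the identity. -/
def scalars : Submodule k (Module.End k W) := Submodule.span k {1}

theorem smul_one_mem_scalars (c : k) : c • (1 : Module.End k W) ∈ scalars k W :=
  Submodule.smul_mem _ _ (Submodule.mem_span_singleton_self _)

/-- Two diagonals with the same differences differ by a constant one, and the operator of a
constant diagonal is a scalar. -/
theorem diag_sub_mem {c c' : Fin 3 → k}
    (h : ∀ i, c (i + 1) - c (i + 2) = c' (i + 1) - c' (i + 2)) :
    F.diag c - F.diag c' ∈ scalars k W := by
  have h1 := h 1
  have h2 := h 2
  simp only [show (1 + 1 : Fin 3) = 2 from rfl, show (1 + 2 : Fin 3) = 0 from rfl,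
    show (2 + 1 : Fin 3) = 0 from rfl, show (2 + 2 : Fin 3) = 1 from rfl] at h1 h2
  rw [← map_sub, F.diag_eq_one (c := c - c') 0]
  · exact smul_one_mem_scalars _
  · simp only [Pi.sub_apply, zero_add]
    linear_combination -h2
  · simp only [Pi.sub_apply, zero_add]
    linear_combination h1

theorem defect_ofTri_ofTri (d e : (splitK k).para.tri.toSubmodule) {p q : ZMod 2}
    {d' e' : S.tri.toSubmodule} (hd' : d' ∈ part k _ p) (he' : e' ∈ part k _ q) :
    defect F.rep (ofTri _ _ (d, d')) (ofTri _ _ (e, e')) = 0 := by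
  have h1 : F.derOf (S.tri.alg.mul d' e')
      = (gl k W).mul (F.derOf d') (F.derOf e') := by
    rw [F.derOf_derOf (SymmetricCompositionSuperalgebra.mem_part_tri.1 hd')
      (SymmetricCompositionSuperalgebra.mem_part_tri.1 he')]
    rfl
  have h2 : ∀ c, (gl k W).mul (F.derOf d') (F.diag c) = 0 := by
    intro c
    rw [gl_anticomm (F.derOf_mem (SymmetricCompositionSuperalgebra.mem_part_tri.1 hd'))
      (F.diag_mem c), diag_derOf, smul_zero, neg_zero]
  rw [defect_apply, magic_ofTri_ofTri, rep_ofTri, rep_ofTri, rep_ofTri, split_tri_mul]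
  simp only [map_add, LinearMap.add_apply, diag_diag, diag_derOf, h1, h2, map_zero]
  abel

theorem defect_ofTri_U (d : (splitK k).para.tri.toSubmodule) {p q : ZMod 2}
    {d' : S.tri.toSubmodule} (hd' : d' ∈ part k _ p) (i : Fin 3) {a : C} (ha : a ∈ part k C q) :
    defect F.rep (ofTri _ _ (d, d')) (ofTensor _ _ i (splitU k ⊗ₜ a)) = 0 := by
  have hL : leftAct (C' := C) (splitK k).para i d (splitU k ⊗ₜ a)
      = ((d : Fin 3 → Module.End k _) i (splitU k)) ⊗ₜ a := rfl
  rw [defect_apply, magic_ofTri_ofTensor, rep_ofTri, rep_ofTensor, rep_ofTensor, hL,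
    rightAct_apply S i hd' splitU_mem, (split_tri_apply d i).1, map_add, map_smul,
    ← TensorProduct.smul_tmul', map_smul, tensorOp_U, tensorOp_U, map_add, LinearMap.add_apply,
    diag_up, derOf_up _ d'.2 (SymmetricCompositionSuperalgebra.mem_part_tri.1 hd') _ ha,
    triDiag_sub, mul_zero, sgn_zero, one_smul, sub_self]

theorem defect_ofTri_V (d : (splitK k).para.tri.toSubmodule) {p q : ZMod 2}
    {d' : S.tri.toSubmodule} (hd' : d' ∈ part k _ p) (i : Fin 3) {a : C} (ha : a ∈ part k C q) :
    defect F.rep (ofTri _ _ (d, d')) (ofTensor _ _ i (splitV k ⊗ₜ a)) = 0 := by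
  have hL : leftAct (C' := C) (splitK k).para i d (splitV k ⊗ₜ a)
      = ((d : Fin 3 → Module.End k _) i (splitV k)) ⊗ₜ a := rfl
  rw [defect_apply, magic_ofTri_ofTensor, rep_ofTri, rep_ofTensor, rep_ofTensor, hL,
    rightAct_apply S i hd' splitV_mem, (split_tri_apply d i).2, map_add, map_smul,
    ← TensorProduct.smul_tmul', map_smul, tensorOp_V, tensorOp_V, map_add, LinearMap.add_apply,
    diag_down _ _ _ ha, derOf_down _ d'.2
      (SymmetricCompositionSuperalgebra.mem_part_tri.1 hd') _ ha, triDiag_sub, mul_zero,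
      sgn_zero, one_smul, sub_self]

theorem defect_ofTri_tmul (d : (splitK k).para.tri.toSubmodule) {p q : ZMod 2}
    {d' : S.tri.toSubmodule} (hd' : d' ∈ part k _ p) (i : Fin 3) (x : EvenOdd (k × k) Unit) {a : C}
    (ha : a ∈ part k C q) : defect F.rep (ofTri _ _ (d, d')) (ofTensor _ _ i (x ⊗ₜ a)) = 0 := by
  rw [split_eq x, TensorProduct.add_tmul, ← TensorProduct.smul_tmul', ← TensorProduct.smul_tmul',
    map_add, map_add, map_smul, map_smul, map_smul, map_smul, F.defect_ofTri_U d hd' i ha,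
    F.defect_ofTri_V d hd' i ha, smul_zero, smul_zero, add_zero]

theorem tensorMul_split (x y : EvenOdd (k × k) Unit) {p q : ZMod 2} {a b : C}
    (ha : a ∈ part k C p) (hb : b ∈ part k C q) :
    tensorMul (splitK k).para S (x ⊗ₜ a) (y ⊗ₜ b) = ((splitK k).para.mul x y) ⊗ₜ S.mul a b := by
  rw [tensorMul, signedTensor_apply _ _ _ (split_mem x) ha (split_mem y) hb, mul_zero, sgn_zero,
    one_smul]

theorem toTri_split (i : Fin 3) (x y : EvenOdd (k × k) Unit) {p q : ZMod 2} {a b : C}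
    (ha : a ∈ part k C p) (hb : b ∈ part k C q) :
    toTri (splitK k).para S i (x ⊗ₜ a) (y ⊗ₜ b)
      = S.b a b • (splitK k).para.theta i ((splitK k).para.tElem x y) := by
  rw [toTri, LinearMap.compr₂_apply, signedTensor_apply _ _ _ (split_mem x) ha (split_mem y) hb]
  simp only [zero_mul, add_zero, sgn_zero, one_smul]
  rfl

theorem toTri'_split (i : Fin 3) (x y : EvenOdd (k × k) Unit) {p q : ZMod 2} {a b : C}
    (ha : a ∈ part k C p) (hb : b ∈ part k C q) :
    toTri' (splitK k).para S i (x ⊗ₜ a) (y ⊗ₜ b)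
      = (splitK k).para.b x y • S.theta i (S.tElem a b) := by
  rw [toTri', LinearMap.compr₂_apply, signedTensor_apply _ _ _ (split_mem x) ha (split_mem y) hb]
  simp only [zero_mul, sgn_zero, one_smul]
  rfl

theorem defect_ofTensor_self (i : Fin 3) (x y : EvenOdd (k × k) Unit) {p q : ZMod 2} {a b : C}
    (ha : a ∈ part k C p) (hb : b ∈ part k C q) :
    ∃ z ∈ scalars k W, defect F.rep (ofTensor _ _ i (x ⊗ₜ a)) (ofTensor _ _ i (y ⊗ₜ b)) = z := by
  rw [defect_apply, magic_ofTensor_self, rep_ofTri, rep_ofTensor, rep_ofTensor,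
    toTri_split _ _ _ ha hb, toTri'_split _ _ _ ha hb, tensorOp_tmul, tensorOp_tmul]
  simp only [map_add, map_smul, LinearMap.add_apply, LinearMap.smul_apply, up_up_self _ _ ha hb,
    down_down_self _ _ ha hb, up_down_self _ _ ha hb, down_up_self _ _ ha hb]
  obtain ⟨w0, w1, w2⟩ := weight_apply (k := k) i
  obtain ⟨t0, t1, t2⟩ := triCoeff_tElem x y
  have h2 := two_mul_half (k := k)
  have h := F.diag_sub_mem (c := S.b a b • triDiag ((splitK k).para.theta i
    ((splitK k).para.tElem x y)))
    (c' := (S.b a b * (x.even.1 * y.even.2 - x.even.2 * y.even.1)) • weight i) (fun j => ?_)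
  swap
  · have e := triDiag_sub ((splitK k).para.theta i ((splitK k).para.tElem x y)) j
    rw [triCoeff_theta] at e
    simp only [Pi.smul_apply, smul_eq_mul]
    rw [← mul_sub, e]
    obtain rfl | rfl | rfl := fin3_cases i j <;>
      simp only [sub_self, add_sub_cancel_left, t0, t1, t2, fin3_add, w0, w1, w2]
    · linear_combination S.b a b * (x.even.1 * y.even.2 - x.even.2 * y.even.1) * h2
    · ring
    · ring
  have hD : F.derOf (S.theta i (S.tElem a b) : Fin 3 → Module.End k C)
      = F.derOf fun j => S.tTriple a b (j - i) := rfl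
  rw [map_smul, map_smul] at h
  simp only [Submodule.coe_smul, map_smul, hD, split_b]
  refine ⟨_, h, ?_⟩
  module

theorem defect_ofTensor_succ (i : Fin 3) (x y : EvenOdd (k × k) Unit) {p q : ZMod 2} {a b : C}
    (ha : a ∈ part k C p) (hb : b ∈ part k C q) :
    defect F.rep (ofTensor _ _ i (x ⊗ₜ a)) (ofTensor _ _ (i + 1) (y ⊗ₜ b)) = 0 := by
  rw [defect_apply, magic_ofTensor_succ, rep_ofTensor, rep_ofTensor, rep_ofTensor,
    tensorMul_split _ _ ha hb, tensorOp_tmul, tensorOp_tmul, tensorOp_tmul, split_mul]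
  simp only [map_add, map_smul, LinearMap.add_apply, LinearMap.smul_apply, up_up_succ _ _ ha hb,
    down_down_succ _ _ ha hb, up_down_succ _ _ ha hb, down_up_succ _ _ ha hb]
  module

theorem defect_mem (X Y : MagicSpace (splitK k).para S) : defect F.rep X Y ∈ scalars k W := by
  refine defect_mem_of_generators (fun p X hX => F.rep_mem hX) _ ?_ ?_ ?_ ?_ X Y
  · intro p q d _ d' hd' e _ e' he'
    rw [F.defect_ofTri_ofTri d e hd' he']
    exact Submodule.zero_mem _
  · intro p q r d _ d' hd' i x _ a ha
    rw [F.defect_ofTri_tmul d hd' i x ha]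
    exact Submodule.zero_mem _
  · intro p q r s x _ a ha y _ b hb i
    obtain ⟨z, hz, e⟩ := F.defect_ofTensor_self i x y ha hb
    rw [e]
    exact hz
  · intro p q r s x _ a ha y _ b hb i
    rw [F.defect_ofTensor_succ i x y ha hb]
    exact Submodule.zero_mem _

end PeirceFrame

/-! ### The isomorphism with the projective structure superalgebra -/

section

variable {k : Type*} [Field k]
variable {G : Type*} [AddCommGroup G] [Module k G] [Superspace k G]
variable {W : Type*} [AddCommGroup W] [Module k W] [Superspace k W]

/-- A linear map into `𝔤𝔩(W)` with values in the structure superalgebra that is multiplicative and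
bijective modulo the center induces an isomorphism onto `𝔭𝔰𝔱𝔯 J`. The center is described by a
subspace `N` of `𝔤𝔩(W)`. -/
theorem isomorphic_pstr_of (M : Superalgebra k G) (J : Superalgebra k W)
    (N : Submodule k (Module.End k W))
    (hN : ∀ Z : (str J).toSubmodule, Z ∈ (str J).alg.center.toSubmodule ↔ (Z : Module.End k W) ∈ N)
    (ρ : G →ₗ[k] Module.End k W)
    (hp : ∀ p, ∀ X ∈ part k G p, ρ X ∈ part k (Module.End k W) p)
    (hs : ∀ X, ρ X ∈ (str J).toSubmodule)
    (hm : ∀ X Y, ρ (M.mul X Y) - (gl k W).mul (ρ X) (ρ Y) ∈ N)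
    (hinj : ∀ X, ρ X ∈ N → X = 0)
    (hsurj : ∀ f ∈ (str J).toSubmodule, ∃ X, f - ρ X ∈ N) : M.Isomorphic (pstr J) := by
  let σ : G →ₗ[k] (str J).toSubmodule := ρ.codRestrict _ hs
  let φ : G →ₗ[k] (str J).toSubmodule ⧸ (str J).alg.center.toSubmodule :=
    (str J).alg.center.toSubmodule.mkQ ∘ₗ σ
  have hφ : ∀ X, φ X = 0 ↔ ρ X ∈ N := fun X =>
    (Submodule.Quotient.mk_eq_zero _).trans (hN (σ X))
  have hpσ : ∀ p X, σ (proj k p X) = proj k p (σ X) := by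
    intro p X
    refine eq_of_hom (σ ∘ₗ proj k p) (proj k p ∘ₗ σ) (fun q Y hY => ?_) X
    have hq : σ Y ∈ part k _ q := (mem_part_sub _).2 (hp q Y hY)
    rw [LinearMap.comp_apply, LinearMap.comp_apply, proj_of_mem hY, proj_of_mem hq,
      apply_ite σ, map_zero]
  refine ⟨LinearEquiv.ofBijective φ ⟨?_, ?_⟩, fun p X => ?_, fun X Y => ?_⟩
  · rw [← LinearMap.ker_eq_bot, LinearMap.ker_eq_bot']
    exact fun X hX => hinj X ((hφ X).1 hX)
  · intro Z
    obtain ⟨Z, rfl⟩ := (str J).alg.center.toSubmodule.mkQ_surjective Z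
    obtain ⟨X, hX⟩ := hsurj Z Z.2
    exact ⟨X, ((Submodule.Quotient.eq _).2 ((hN (Z - σ X)).2 hX)).symm⟩
  · exact congrArg (str J).alg.center.toSubmodule.mkQ (hpσ p X)
  · exact (Submodule.Quotient.eq _).2
      ((hN (σ (M.mul X Y) - (str J).alg.mul (σ X) (σ Y))).2 (hm X Y))

end

section

variable {k : Type*} [Field k]

/-- The triple of endomorphisms of `k × k` that act on `u` by `s j` and on `v` by `-s j`. -/
def splitTriple (s : Fin 3 → k) (j : Fin 3) : Module.End k (EvenOdd (k × k) Unit) where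
  toFun x := ⟨(s j * x.even.1, -(s j * x.even.2)), 0⟩
  map_add' x y := by ext <;> simp <;> ring
  map_smul' c x := by ext <;> simp <;> ring

theorem splitTriple_mem {s : Fin 3 → k} (hs : s 0 + s 1 + s 2 = 0) :
    splitTriple s ∈ (splitK k).para.triSubmodule := by
  have hm : ∀ j, splitTriple s j ∈ part k (Module.End k _) 0 := fun j => split_end_mem _
  refine SymmetricCompositionSuperalgebra.mem_tri (p := 0) hm (fun j => ?_)
    (fun p q x _ y _ => ?_)
  · refine SymmetricCompositionSuperalgebra.mem_osp (p := 0) (hm j) fun p q x _ y _ => ?_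
    rw [zero_mul, sgn_zero, split_b, split_b]
    simp only [splitTriple, LinearMap.coe_mk, AddHom.coe_mk]
    ring
  · rw [zero_mul, sgn_zero, one_smul, split_mul, split_mul, split_mul]
    simp only [splitTriple, LinearMap.coe_mk, AddHom.coe_mk]
    ext
    · simp only [EvenOdd.even_add, Prod.fst_add]
      linear_combination x.even.2 * y.even.2 * hs
    · simp only [EvenOdd.even_add, Prod.snd_add]
      linear_combination -x.even.1 * y.even.1 * hs

/-- Every triple of eigenvalues with sum zero occurs in `𝔱𝔯𝔦(S₂)`. In characteristic `3` the
elements `θⁱ(t_{x,y})` are not enough for this: they all have equal eigenvalues. -/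
theorem exists_triCoeff {s : Fin 3 → k} (hs : s 0 + s 1 + s 2 = 0) :
    ∃ d : (splitK k).para.tri.toSubmodule, ∀ j, triCoeff j d = s j :=
  ⟨⟨splitTriple s, splitTriple_mem hs⟩, fun j => mul_one (s j)⟩

end

namespace PeirceFrame

variable {k : Type*} [Field k] [NeZero (2 : k)]
variable {C : Type*} [AddCommGroup C] [Module k C] [Superspace k C]
variable {W : Type*} [AddCommGroup W] [Module k W] [Superspace k W]
variable {S : SymmetricCompositionSuperalgebra k C} {J : Superalgebra k W} (F : PeirceFrame S J)

/-- The coefficients of `ρ(X)(eⱼ)` along the `ιᵢ` give the tensor components of `X`, the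
diagonal ones show that the triality element of `S₂` is zero, and the action on `ιⱼ(C)` gives
the remaining part. -/
theorem rep_injective {X : MagicSpace (splitK k).para S} (hX : F.rep X ∈ scalars k W) : X = 0 := by
  obtain ⟨s, hs⟩ := Submodule.mem_span_singleton.1 hX
  choose a b hab using fun i => exists_eq_add (X.2 i)
  have hr : s • (1 : Module.End k W) = F.diag (triDiag X.1.1) + F.derOf X.1.2
      + ∑ i, (F.up i (a i) + F.down i (b i)) := by
    rw [hs, rep_apply]
    simp only [hab, map_add, tensorOp_U, tensorOp_V]
  have he : ∀ j, s • F.e j = (2 * triDiag X.1.1 j) • F.e j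
      + (-F.ι (j + 1) (a (j + 1)) + F.ι (j + 2) (b (j + 2))) := by
    intro j
    have h := LinearMap.congr_fun hr (F.e j)
    have h1 := F.up_e_two (j + 1) (a (j + 1))
    have h2 := F.down_e_two (j + 1) (b (j + 1))
    have h3 := F.up_e_one (j + 2) (a (j + 2))
    have h4 := F.down_e_one (j + 2) (b (j + 2))
    simp only [fin3_add] at h1 h2 h3 h4
    simpa only [LinearMap.smul_apply, Module.End.one_apply, LinearMap.add_apply,
      LinearMap.sum_apply, sum_fin3 j, diag_e, derOf_e, up_e_self, down_e_self, h1, h2, h3, h4,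
      add_zero, zero_add] using h
  have ha : ∀ j, a j = 0 := by
    intro j
    have h := congrArg (F.γ j) (he (j + 2))
    simpa only [map_add, map_smul, map_neg, F.γ_e, F.γ_ι, fin3_add, fin3_ne, if_true, if_false,
      smul_zero, zero_add, add_zero, zero_eq_neg] using h
  have hb : ∀ j, b j = 0 := by
    intro j
    have h := congrArg (F.γ j) (he (j + 1))
    simpa only [map_add, map_smul, map_neg, F.γ_e, F.γ_ι, fin3_add, fin3_ne, if_true, if_false,
      smul_zero, zero_add, add_zero, neg_zero, eq_comm] using h
  have hc : ∀ j, s = 2 * triDiag X.1.1 j := by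
    intro j
    have h := congrArg (F.α j) (he j)
    simpa only [map_add, map_smul, map_neg, F.α_e, F.α_ι, if_true, smul_eq_mul, mul_one, neg_zero,
      add_zero] using h
  -- the diagonal is constant, and the triality element of `S₂` depends only on its differences
  have hd : X.1.1 = 0 := by
    refine split_tri_ext fun j => ?_
    rw [← triDiag_sub, sub_eq_zero]
    exact mul_left_cancel₀ (NeZero.ne (2 : k)) ((hc _).symm.trans (hc _))
  -- the normalization `c₂ = 0` makes `triDiag 0 = 0`, so that the scalar `s` vanishes as well
  have hd' : X.1.2 = 0 := by
    refine Subtype.ext (funext fun j => LinearMap.ext fun x => ?_)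
    have hs0 : s = 0 := by rw [hc 0, hd, map_zero, Pi.zero_apply, mul_zero]
    have h := congrArg (F.γ j) (LinearMap.congr_fun hr (F.ι j x))
    simp only [hs0, hd, ha, hb, map_zero, add_zero, zero_add, Finset.sum_const_zero, zero_smul,
      LinearMap.zero_apply, derOf_ι, F.γ_ι, if_true] at h
    exact h.symm
  refine Prod.ext (Prod.ext hd hd') (funext fun j => ?_)
  rw [hab, ha, hb, TensorProduct.tmul_zero, TensorProduct.tmul_zero, add_zero]
  rfl

theorem one_mem_part : (1 : Module.End k W) ∈ part k (Module.End k W) 0 :=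
  mem_part_end.2 fun j x hx => by rwa [zero_add]

theorem gl_mul_scalar_left (c : k) (f : Module.End k W) : (gl k W).mul (c • 1) f = 0 := by
  rw [map_smul, LinearMap.smul_apply, gl_mul_even_left one_mem_part, one_mul, mul_one, sub_self,
    smul_zero]

theorem gl_mul_scalar_right (c : k) (f : Module.End k W) : (gl k W).mul f (c • 1) = 0 := by
  rw [map_smul, gl_mul_even_right one_mem_part, one_mul, mul_one, sub_self, smul_zero]

/-- The center of the structure superalgebra consists of the scalars. -/
theorem mem_center_str_iff [Nontrivial C] (F : PeirceFrame S J) (Z : (str J).toSubmodule) :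
    Z ∈ (str J).alg.center.toSubmodule ↔ (Z : Module.End k W) ∈ scalars k W := by
  constructor
  · intro hZ
    have key : ∀ p, proj k p (Z : Module.End k W) ∈ scalars k W := by
      intro p
      have hp := (str J).alg.center.proj_mem' p hZ
      obtain ⟨c, hc⟩ := F.eq_smul_one_of_central (proj_mem p (Z : Module.End k W)) fun x =>
        congrArg Subtype.val (hp ⟨J.mul x, leftMul_mem_str x⟩).1
      rw [hc]
      exact smul_one_mem_scalars c
    rw [← proj_add (k := k) (Z : Module.End k W)]
    exact Submodule.add_mem _ (key 0) (key 1)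
  · intro hZ f
    obtain ⟨c, hc⟩ := Submodule.mem_span_singleton.1 hZ
    constructor <;> refine Subtype.ext ?_ <;> rw [Superalgebra.Sub.coe_mul, ← hc]
    · exact gl_mul_scalar_left c (f : Module.End k W)
    · exact gl_mul_scalar_right c (f : Module.End k W)

theorem rep_mem_sup (X : MagicSpace (splitK k).para S) :
    F.rep X ∈ LinearMap.range F.rep ⊔ scalars k W :=
  Submodule.mem_sup_left ⟨X, rfl⟩

theorem up_mem_sup (i : Fin 3) (a : C) : F.up i a ∈ LinearMap.range F.rep ⊔ scalars k W := by
  rw [← tensorOp_U, ← rep_ofTensor]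
  exact F.rep_mem_sup _

theorem down_mem_sup (i : Fin 3) (a : C) : F.down i a ∈ LinearMap.range F.rep ⊔ scalars k W := by
  rw [← tensorOp_V, ← rep_ofTensor]
  exact F.rep_mem_sup _

theorem derOf_mem_sup {d : Fin 3 → Module.End k C} (hd : d ∈ S.triSubmodule) :
    F.derOf d ∈ LinearMap.range F.rep ⊔ scalars k W := by
  have h := F.rep_ofTri (0, ⟨d, hd⟩)
  rw [map_zero, map_zero, zero_add] at h
  rw [← show F.rep _ = F.derOf d from h]
  exact F.rep_mem_sup _

theorem diag_mem_sup (c : Fin 3 → k) : F.diag c ∈ LinearMap.range F.rep ⊔ scalars k W := by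
  obtain ⟨d, hd⟩ := exists_triCoeff (s := fun j => c (j + 1) - c (j + 2)) (by
    simp only [zero_add, show (1 + 1 : Fin 3) = 2 from rfl, show (1 + 2 : Fin 3) = 0 from rfl,
      show (2 + 1 : Fin 3) = 0 from rfl, show (2 + 2 : Fin 3) = 1 from rfl]
    ring)
  have h := F.rep_ofTri (d, 0)
  rw [ZeroMemClass.coe_zero, map_zero, add_zero] at h
  -- `triDiag d` has the same differences as `c`, hence differs from it by a constant
  rw [← add_sub_cancel (F.diag (triDiag d)) (F.diag c)]
  refine Submodule.add_mem _ (h ▸ F.rep_mem_sup _) (Submodule.mem_sup_right ?_)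
  exact F.diag_sub_mem fun i => by rw [triDiag_sub, hd]

theorem leftMul_mem_sup (x : W) : J.mul x ∈ LinearMap.range F.rep ⊔ scalars k W := by
  have h2 : (2 : k) ≠ 0 := NeZero.ne _
  have he : J.mul (∑ i, F.α i x • F.e i) = (2⁻¹ : k) • F.diag fun i => F.α i x := by
    rw [diag, LinearMap.smul_apply, LinearMap.comp_apply, Fintype.linearCombination_apply,
      smul_smul, inv_mul_cancel₀ h2, one_smul]
  have hι : ∀ i a, J.mul (F.ι i a) = (2⁻¹ : k) • (F.down i a - F.up i a) := by
    intro i a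
    rw [down_sub_up, smul_smul, inv_mul_cancel₀ h2, one_smul]
  rw [← F.sum_eq x, map_add, he, map_sum]
  refine Submodule.add_mem _ (Submodule.smul_mem _ _ (F.diag_mem_sup _))
    (Submodule.sum_mem _ fun i _ => ?_)
  rw [hι]
  exact Submodule.smul_mem _ _ (Submodule.sub_mem _ (F.down_mem_sup i _) (F.up_mem_sup i _))

theorem der_mem_sup {D : Module.End k W} (hD : D ∈ der J) :
    D ∈ LinearMap.range F.rep ⊔ scalars k W := by
  have key : ∀ p, proj k p D ∈ LinearMap.range F.rep ⊔ scalars k W := by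
    intro p
    obtain ⟨d, hd, y, e⟩ := F.exists_der_eq (proj_mem_der J p hD) (proj_mem p D)
    rw [e]
    exact Submodule.sub_mem _ (F.derOf_mem_sup hd) (Submodule.sum_mem _ fun i _ =>
      Submodule.add_mem _ (F.up_mem_sup i _) (F.down_mem_sup i _))
  rw [← proj_add (k := k) D]
  exact Submodule.add_mem _ (key 0) (key 1)

/-- The image of `rep` and the scalars together contain the generators of the structure
superalgebra and are closed under brackets. -/
theorem str_le_sup : (str J).toSubmodule ≤ LinearMap.range F.rep ⊔ scalars k W := by
  intro f hf
  refine Submodule.mem_sInf.1 hf _ ⟨fun D hD => F.der_mem_sup hD, F.leftMul_mem_sup,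
    fun f hf g hg => ?_⟩
  obtain ⟨_, ⟨X, rfl⟩, z, hz, rfl⟩ := Submodule.mem_sup.1 hf
  obtain ⟨_, ⟨Y, rfl⟩, w, hw, rfl⟩ := Submodule.mem_sup.1 hg
  obtain ⟨c, rfl⟩ := Submodule.mem_span_singleton.1 hz
  obtain ⟨c', rfl⟩ := Submodule.mem_span_singleton.1 hw
  have e : (gl k W).mul (F.rep X + c • 1) (F.rep Y + c' • 1)
      = F.rep ((magic (splitK k).para S).mul X Y) - defect F.rep X Y := by
    rw [map_add (gl k W).mul, LinearMap.add_apply, gl_mul_scalar_left, add_zero, map_add,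
      gl_mul_scalar_right, add_zero, defect_apply, sub_sub_cancel]
  rw [e]
  exact Submodule.sub_mem _ (F.rep_mem_sup _) (Submodule.mem_sup_right (F.defect_mem X Y))

theorem magic_isomorphic_pstr [Nontrivial C] (F : PeirceFrame S J) :
    (magic (splitK k).para S).Isomorphic (pstr J) :=
  isomorphic_pstr_of _ J (scalars k W) F.mem_center_str_iff F.rep (fun _ _ => F.rep_mem)
    F.rep_mem_str F.defect_mem (fun _ => F.rep_injective) fun f hf => by
      obtain ⟨_, ⟨X, rfl⟩, z, hz, rfl⟩ := Submodule.mem_sup.1 (F.str_le_sup hf)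
      exact ⟨X, by rwa [add_sub_cancel_left]⟩

end PeirceFrame

/-! ### The Peirce frame of `H₃(C)` -/

namespace HurwitzSuperalgebra

variable {k : Type*} [Field k]
variable {C : Type*} [AddCommGroup C] [Module k C] [Superspace k C]
variable (A : HurwitzSuperalgebra k C)

/-- The linearization of `a (conj a) = q(a) 1`. -/
theorem mul_conj_add {p q : ZMod 2} {a b : C} (ha : a ∈ part k C p) (hb : b ∈ part k C q) :
    A.mul a (A.conj b) + sgn k (p * q) • A.mul b (A.conj a) = A.b a b • A.one := by
  have h := A.mul_add_mul ha hb
  have h0 := A.b_one_odd (x := a)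
  simp only [conj_apply, map_sub, map_smul, A.mul_one']
  rcases zmod2 p with rfl | rfl
  · simp only [zero_mul, sgn_zero, one_smul] at h ⊢
    linear_combination (norm := module) -h
  · simp only [h0 ha, zero_smul] at h ⊢
    linear_combination (norm := module) -h

theorem conj_mul_add {p q : ZMod 2} {a b : C} (ha : a ∈ part k C p) (hb : b ∈ part k C q) :
    A.mul (A.conj a) b + sgn k (p * q) • A.mul (A.conj b) a = A.b a b • A.one := by
  have h := A.mul_add_mul ha hb
  have h0 := A.b_one_odd (x := b)
  simp only [conj_apply, map_sub, map_smul, LinearMap.sub_apply, LinearMap.smul_apply, A.one_mul']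
  rcases zmod2 q with rfl | rfl
  · simp only [mul_zero, sgn_zero, one_smul] at h ⊢
    linear_combination (norm := module) -h
  · simp only [h0 hb, zero_smul] at h ⊢
    linear_combination (norm := module) -h

/-- `q(1) = 1`: nondegeneracy gives some `t` with `b(1, t) ≠ 0`, and
`b(1, 1) b(1, t) = 2 b(1, t)`. -/
theorem b_one_one [Nontrivial C] : A.b A.one A.one = 2 := by
  have hne : A.one ≠ 0 := by
    intro h
    obtain ⟨x, hx⟩ := exists_ne (0 : C)
    rw [← A.one_mul' x, h, map_zero, LinearMap.zero_apply] at hx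
    exact hx rfl
  by_contra h
  refine hne (A.b_nondeg _ fun t => ?_)
  refine eq_of_hom (A.b A.one) 0 (fun i t ht => ?_) t
  refine (mul_eq_zero.1 (?_ : (A.b A.one A.one - 2) * A.b A.one t = 0)).resolve_left
    (sub_ne_zero.2 h)
  linear_combination A.b_one_mul ht

theorem conj_one [Nontrivial C] : A.conj A.one = A.one := by
  rw [conj_apply, b_one_one]
  module

theorem matMul_single (i j l m : Fin 3) (a b : C) :
    A.matMul (Matrix.single i j a) (Matrix.single l m b)
      = if j = l then Matrix.single i m (A.mul a b) else 0 := by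
  ext r c
  rw [matMul_apply, Finset.sum_eq_single j]
  · by_cases hr : i = r <;> by_cases hc : m = c <;> by_cases hj : j = l <;>
      simp [hr, hc, hj, eq_comm (a := l) (b := j)]
  · intro l' _ hl
    simp [Matrix.single_apply, Ne.symm hl]
  · simp

theorem single_mem (i j : Fin 3) {p : ZMod 2} {a : C} (ha : a ∈ part k C p) :
    Matrix.single i j a ∈ part k (Matrix (Fin 3) (Fin 3) C) p := by
  refine Matrix.ext fun r c => ?_
  change proj k p (Matrix.single i j a r c) = _
  rw [Matrix.single_apply, apply_ite (proj k p), map_zero, mem_part.1 ha]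
  exact (Matrix.single_apply ..).symm

theorem matJordan_mul {p q : ZMod 2} {X Y : Matrix (Fin 3) (Fin 3) C} (hX : X ∈ part k _ p)
    (hY : Y ∈ part k _ q) : A.matJordan.mul X Y
      = (2⁻¹ : k) • (A.matMul X Y + sgn k (p * q) • A.matMul Y X) := by
  rw [← superSwap_apply A.matMul hX hY]
  rfl

/-- The diagonal idempotent `Eᵢᵢ`. -/
def unitMat (i : Fin 3) : Matrix (Fin 3) (Fin 3) C := Matrix.single i i A.one

/-- The hermitian matrix with entry `a` at `(i+2, i+1)` and `conj a` at `(i+1, i+2)`. -/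
def offMat (i : Fin 3) : C →ₗ[k] Matrix (Fin 3) (Fin 3) C :=
  Matrix.singleLinearMap k (i + 2) (i + 1) + Matrix.singleLinearMap k (i + 1) (i + 2) ∘ₗ A.conj

theorem offMat_apply (i : Fin 3) (a : C) : A.offMat i a
    = Matrix.single (i + 2) (i + 1) a + Matrix.single (i + 1) (i + 2) (A.conj a) := rfl

theorem unitMat_mem (i : Fin 3) : A.unitMat i ∈ part k (Matrix (Fin 3) (Fin 3) C) 0 :=
  single_mem i i A.one_mem

theorem offMat_mem (i : Fin 3) {p : ZMod 2} {a : C} (ha : a ∈ part k C p) :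
    A.offMat i a ∈ part k (Matrix (Fin 3) (Fin 3) C) p :=
  Submodule.add_mem _ (single_mem _ _ ha) (single_mem _ _ (A.conj_mem ha))

theorem conj_single (i j r c : Fin 3) (a : C) :
    A.conj (Matrix.single i j a c r) = Matrix.single j i (A.conj a) r c := by
  simp only [Matrix.single_apply, apply_ite A.conj, map_zero, and_comm]

theorem unitMat_mem_hermitian [Nontrivial C] (i : Fin 3) : A.unitMat i ∈ A.hermitian := by
  intro r c
  rw [unitMat, conj_single, conj_one]

theorem offMat_mem_hermitian (i : Fin 3) (a : C) : A.offMat i a ∈ A.hermitian := by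
  intro r c
  rw [offMat_apply, Matrix.add_apply, map_add, conj_single, conj_single, conj_conj, add_comm]
  rfl

theorem unitMat_mul_unitMat (i j : Fin 3) [NeZero (2 : k)] :
    A.matJordan.mul (A.unitMat i) (A.unitMat j) = if i = j then A.unitMat i else 0 := by
  have h := PeirceFrame.two_mul_half (k := k)
  rw [A.matJordan_mul (A.unitMat_mem i) (A.unitMat_mem j)]
  simp only [unitMat, matMul_single, A.one_mul', zero_mul, sgn_zero, one_smul, eq_comm (a := j)]
  split_ifs with hij
  · subst hij
    rw [← two_smul k, smul_smul, mul_comm, h, one_smul]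
  · rw [add_zero, smul_zero]

theorem unitMat_mul_offMat (i j : Fin 3) (a : C) : A.matJordan.mul (A.unitMat j) (A.offMat i a)
      = if j = i then 0 else (2⁻¹ : k) • A.offMat i a := by
  refine eq_of_hom (A.matJordan.mul (A.unitMat j) ∘ₗ A.offMat i)
    (if j = i then 0 else (2⁻¹ : k) • A.offMat i) (fun p a ha => ?_) a |>.trans ?_
  · rw [LinearMap.comp_apply, A.matJordan_mul (A.unitMat_mem j) (A.offMat_mem i ha)]
    obtain rfl | rfl | rfl := fin3_cases i j <;>
      simp only [unitMat, offMat_apply, map_add, LinearMap.add_apply, matMul_single, fin3_ne,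
        if_true, if_false, A.one_mul', A.mul_one', zero_mul, sgn_zero, one_smul, add_zero, zero_add,
        smul_zero, LinearMap.zero_apply, LinearMap.smul_apply, add_comm]
  · split_ifs <;> rfl

theorem offMat_mul_self {p q : ZMod 2} (i : Fin 3) {a b : C} (ha : a ∈ part k C p)
    (hb : b ∈ part k C q) : A.matJordan.mul (A.offMat i a) (A.offMat i b)
      = (2⁻¹ * A.b a b) • (A.unitMat (i + 1) + A.unitMat (i + 2)) := by
  rw [A.matJordan_mul (A.offMat_mem i ha) (A.offMat_mem i hb)]
  have h1 := congrArg (Matrix.singleLinearMap k (i + 2) (i + 2)) (A.mul_conj_add ha hb)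
  have h2 := congrArg (Matrix.singleLinearMap k (i + 1) (i + 1)) (A.conj_mul_add ha hb)
  rw [map_add, map_smul, map_smul] at h1 h2
  simp only [Matrix.singleLinearMap_apply] at h1 h2
  simp only [unitMat, offMat_apply, map_add, LinearMap.add_apply, matMul_single, fin3_ne,
    if_true, if_false, add_zero, zero_add]
  rw [mul_smul, smul_add (A.b a b), ← h1, ← h2]
  module

theorem offMat_mul_succ {p q : ZMod 2} (i : Fin 3) {a b : C} (ha : a ∈ part k C p)
    (hb : b ∈ part k C q) : A.matJordan.mul (A.offMat i a) (A.offMat (i + 1) b)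
      = (2⁻¹ : k) • A.offMat (i + 2) (A.para.mul a b) := by
  have e : A.para.mul a b = A.mul (A.conj a) (A.conj b) := rfl
  rw [A.matJordan_mul (A.offMat_mem i ha) (A.offMat_mem _ hb)]
  simp only [offMat_apply, map_add, LinearMap.add_apply, matMul_single, fin3_add, fin3_ne,
    if_true, if_false, add_zero, zero_add]
  rw [e, A.conj_mul (A.conj_mem ha) (A.conj_mem hb), conj_conj, conj_conj, Matrix.smul_single]

theorem matJordan_comm {p q : ZMod 2} {X Y : Matrix (Fin 3) (Fin 3) C} (hX : X ∈ part k _ p)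
    (hY : Y ∈ part k _ q) :
    A.matJordan.mul X Y = sgn k (p * q) • A.matJordan.mul Y X := by
  rw [A.matJordan_mul hX hY, A.matJordan_mul hY hX, mul_comm q p]
  have h := sgn_mul_self (k := k) (p * q)
  match_scalars <;> grind

theorem eq_smul_one_of_conj [NeZero (2 : k)] {a : C} (h : A.conj a = a) :
    (2⁻¹ * A.b a A.one) • A.one = a := by
  rw [conj_apply, sub_eq_iff_eq_add] at h
  rw [mul_smul, h, ← two_smul k, smul_smul, inv_mul_cancel₀ (NeZero.ne _), one_smul]

theorem sum_unitMat_offMat [NeZero (2 : k)] {X : Matrix (Fin 3) (Fin 3) C} (hX : X ∈ A.hermitian) :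
    (∑ i, (2⁻¹ * A.b (X i i) A.one) • A.unitMat i) + ∑ i, A.offMat i (X (i + 2) (i + 1)) = X := by
  have hX' : ∀ i j, A.conj (X j i) = X i j := hX
  ext r c
  rw [Matrix.add_apply, Matrix.sum_apply, Matrix.sum_apply, sum_fin3 r, sum_fin3 r]
  simp only [offMat_apply, unitMat, hX', Matrix.add_apply, Matrix.smul_apply, fin3_add]
  obtain rfl | rfl | rfl := fin3_cases r c <;>
    simp only [Matrix.single_apply, fin3_ne, and_self, and_true, and_false,
      if_true, if_false, smul_zero, add_zero, zero_add]
  exact A.eq_smul_one_of_conj (hX _ _)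

/-- The Peirce frame of `H₃(C)`, with the diagonal idempotents and the hermitian off-diagonal
matrices. The products of the latter are given by the para-Hurwitz superalgebra of `C`. -/
def peirceFrame [Nontrivial C] [NeZero (2 : k)] : PeirceFrame A.para A.H3.alg where
  e i := ⟨A.unitMat i, A.unitMat_mem_hermitian i⟩
  ι i := (A.offMat i).codRestrict A.hermitian (A.offMat_mem_hermitian i)
  α i := (2⁻¹ : k) • A.b.flip A.one ∘ₗ Matrix.entryLinearMap k C i i ∘ₗ A.hermitian.subtype
  γ i := Matrix.entryLinearMap k C (i + 2) (i + 1) ∘ₗ A.hermitian.subtype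
  sum_eq X := by
    refine Subtype.ext ?_
    refine Eq.trans ?_ (A.sum_unitMat_offMat X.2)
    simp only [Submodule.coe_add, Submodule.coe_sum, Submodule.coe_smul]
    rfl
  α_e i j := by
    change 2⁻¹ * A.b (Matrix.single j j A.one i i) A.one = _
    rw [Matrix.single_apply]
    by_cases h : i = j
    · subst h
      simp [b_one_one, NeZero.ne]
    · simp [h, Ne.symm h]
  α_ι i j a := by
    change 2⁻¹ * A.b (A.offMat j a i i) A.one = _
    rw [offMat_apply]
    obtain rfl | rfl | rfl := fin3_cases j i <;> simp
  γ_e i j := by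
    change Matrix.single j j A.one (i + 2) (i + 1) = 0
    obtain rfl | rfl | rfl := fin3_cases i j <;> simp
  γ_ι i j a := by
    change A.offMat j a (i + 2) (i + 1) = _
    rw [offMat_apply]
    obtain rfl | rfl | rfl := fin3_cases i j <;> simp [fin3_add]
  e_mem i := (mem_part_sub _).2 (A.unitMat_mem i)
  ι_mem i _ _ ha := (mem_part_sub _).2 (A.offMat_mem i ha)
  comm hx hy := Subtype.ext (A.matJordan_comm ((mem_part_sub _).1 hx) ((mem_part_sub _).1 hy))
  e_mul_e i j := by
    refine Subtype.ext ((A.unitMat_mul_unitMat i j).trans ?_)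
    split_ifs <;> rfl
  e_mul_ι i a := Subtype.ext ((A.unitMat_mul_offMat i i a).trans (if_pos rfl))
  e_mul_ι_one i a := Subtype.ext ((A.unitMat_mul_offMat i (i + 1) a).trans
    (if_neg (fin3_ne i).2.2.1))
  e_mul_ι_two i a := Subtype.ext ((A.unitMat_mul_offMat i (i + 2) a).trans
    (if_neg (fin3_ne i).2.2.2.2.1))
  ι_mul_ι i a b := by
    refine Subtype.ext ?_
    refine eq_of_hom (A.matJordan.mul.flip (A.offMat i b) ∘ₗ A.offMat i)
      (((2⁻¹ : k) • A.b.flip b).smulRight (A.unitMat (i + 1) + A.unitMat (i + 2)))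
      (fun p a ha => ?_) a
    exact eq_of_hom (A.matJordan.mul (A.offMat i a) ∘ₗ A.offMat i)
      (((2⁻¹ : k) • A.b a).smulRight (A.unitMat (i + 1) + A.unitMat (i + 2)))
      (fun q b hb => A.offMat_mul_self i ha hb) b
  ι_mul_ι_one i a b := by
    refine Subtype.ext ?_
    refine eq_of_hom (A.matJordan.mul.flip (A.offMat (i + 1) b) ∘ₗ A.offMat i)
      ((2⁻¹ : k) • A.offMat (i + 2) ∘ₗ A.para.mul.flip b) (fun p a ha => ?_) a
    exact eq_of_hom (A.matJordan.mul (A.offMat i a) ∘ₗ A.offMat (i + 1))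
      ((2⁻¹ : k) • A.offMat (i + 2) ∘ₗ A.para.mul a) (fun q b hb => A.offMat_mul_succ i ha hb) b

theorem magic_isomorphic_pstr [Nontrivial C] [NeZero (2 : k)] :
    (magic (splitK k).para A.para).Isomorphic (pstr A.H3.alg) :=
  A.peirceFrame.magic_isomorphic_pstr

/-- The identities of a Lie superalgebra hold in `𝔤(S₂, S)` because they hold in `𝔤𝔩`, hence in
`𝔭𝔰𝔱𝔯 H₃(C)`. -/
theorem magic_isLie [Nontrivial C] [NeZero (2 : k)] : (magic (splitK k).para A.para).IsLie :=
  A.magic_isomorphic_pstr.isLie (pstr_isLie _)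

end HurwitzSuperalgebra

end

end Supermagic

theorem corollary3p2 {k : Type*} [Field k] [CharP k 3] {V : Type*} [AddCommGroup V] [Module k V]
    (ω : LinearMap.BilinForm k V) (hV : Module.finrank k V = 2) (hω : ω.IsAlt) (hω0 : ω ≠ 0) :
    ((Supermagic.magic (Supermagic.splitK k).para (Supermagic.B12 ω hV hω hω0).para).IsLie ∧
      (Supermagic.pstr (Supermagic.B12 ω hV hω hω0).H3.alg).IsLie ∧
      (Supermagic.magic (Supermagic.splitK k).para (Supermagic.B12 ω hV hω hω0).para).Isomorphic
        (Supermagic.pstr (Supermagic.B12 ω hV hω hω0).H3.alg)) ∧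
    ((Supermagic.magic (Supermagic.splitK k).para (Supermagic.B42 ω hV hω hω0).para).IsLie ∧
      (Supermagic.pstr (Supermagic.B42 ω hV hω hω0).H3.alg).IsLie ∧
      (Supermagic.magic (Supermagic.splitK k).para (Supermagic.B42 ω hV hω hω0).para).Isomorphic
        (Supermagic.pstr (Supermagic.B42 ω hV hω hω0).H3.alg)) := by
  have : Nontrivial V := Module.nontrivial_of_finrank_pos (R := k) (by omega)
  have : Nontrivial (Supermagic.EvenOdd k V) :=
    ⟨⟨1, 0⟩, 0, fun h => one_ne_zero (congrArg Supermagic.EvenOdd.even h)⟩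
  have : Nontrivial (Supermagic.EvenOdd (Module.End k V) V) :=
    ⟨⟨1, 0⟩, 0, fun h => one_ne_zero (congrArg Supermagic.EvenOdd.even h)⟩
  exact ⟨⟨Supermagic.HurwitzSuperalgebra.magic_isLie _, Supermagic.pstr_isLie _,
      Supermagic.HurwitzSuperalgebra.magic_isomorphic_pstr _⟩,
    ⟨Supermagic.HurwitzSuperalgebra.magic_isLie _, Supermagic.pstr_isLie _,
      Supermagic.HurwitzSuperalgebra.magic_isomorphic_pstr _⟩⟩
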